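/- Let $n\ge 2$. For a Lebesgue-measurable set $X\subseteq\mathbb{R}^n$ let $\overline{\delta}(X)=\sup_{p\in\mathbb{R}^n}\limsup_{T\to\infty}\operatorname{vol}(X\cap(p+[-T,T]^n))/\operatorname{vol}([-T,T]^n)$ be its upper density. Let $G(\mathbb{R}^n,\{1\})$ be the unit-distance graph on $\mathbb{R}^n$ ($x,y$ are adjacent iff $\|x-y\|=1$), and let $\alpha_{\overline{\delta}}(G(\mathbb{R}^n,\{1\}))$, its independence density, be the supremum of $\overline{\delta}(I)$ over all Lebesgue-measurable sets $I\subseteq\mathbb{R}^n$ that contain no two points at distance $1$. Let $\Omega_n\colon[0,\infty)\to\mathbb{R}$ be given by $\Omega_n(\|u\|)=\frac{1}{\omega(S^{n-1})}\int_{S^{n-1}}e^{iu\cdot\xi}\,d\omega(\xi)$ for $u\in\mathbb{R}^n$, where $\omega$ is the surface measure on the unit sphere $S^{n-1}$. For a nonempty finite set $U\subseteq\mathbb{R}^n$ let $\mathcal{T}^*(U)$ be the set of symmetric matrices $Z\in\mathbb{R}^{U\times U}$ that are copositive (that is, $\sum_{x,y\in U}Z(x,y)f(x)f(y)\ge0$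 for all $f\colon U\to[0,\infty)$) and satisfy $\sum_{x,y\in U}|Z(x,y)|\le1$. Let $\mathcal{T}^*_{\aleph_0}(U)$ be a countable dense subset of $\mathcal{T}^*(U)$ such that $\operatorname{tr}Z>0$ and $\sum_{x,y\in U}Z(x,y)>0$ for all $Z\in\mathcal{T}^*_{\aleph_0}(U)$. Let $m(U)$ be the minimal distance between distinct points of $U$ (with $m(U)=1$ if $U$ has only one point). Consider all functions $r\colon[0,\infty)\to\mathbb{R}$ of the form $$r(t)=\sum_{x,y\in U}Z(x,y)\int_{B(x,\delta)}\int_{B(y,\delta)}\Omega_n(t\|x'-y'\|)\,dy'\,dx',$$ where $U\subseteq\mathbb{Q}^n$ is finite and nonempty, $Z\in\mathcal{T}^*_{\aleph_0}(U)$, $\delta=m(U)/(2k)$ for some integer $k\ge1$, and $B(x,\delta)$ is the open ball of radius $\delta$ centered at $x$. Let $r_1,r_2,\dots$ be an enumeration of these functions. For $N\ge 0$ let $\vartheta_N$ be the optimal value (supremum) of the problem: maximize $\alpha(\{0\})$ over all Borel measures $\alpha$ on $[0,\infty)$ with $$\alpha([0,\infty))=1,\qquad \int_0^\infty\Omega_n(t)\,d\alpha(t)=0,\qquad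 \int_0^\infty r_k(t)\,d\alpha(t)\ge0\quad(1\le k\le N),$$ and let $\vartheta_\infty$ be the optimal value of the problem in which the last constraint is imposed for all $k\ge1$. Then such sets $\mathcal{T}^*_{\aleph_0}(U)$ and such an enumeration exist, and for every choice of them $$\lim_{N\to\infty}\vartheta_N=\vartheta_\infty\qquad\text{and}\qquad\vartheta_\infty=\alpha_{\overline{\delta}}(G(\mathbb{R}^n,\{1\})).$$ -/

import Mathlib

open MeasureTheory Filter Topology
open scoped NNReal ENNReal RealInnerProductSpace

namespace ThickLP

/-- The space `ℝⁿ` with the Euclidean norm. -/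
abbrev Eucl (n : ℕ) : Type := EuclideanSpace ℝ (Fin n)

/-! ### Distance graphs and the independence density -/

/-- The cube `p + [-T, T]ⁿ`. -/
def cube {n : ℕ} (p : Eucl n) (T : ℝ) : Set (Eucl n) :=
  {x | ∀ i, |x i - p i| ≤ T}

/-- The upper density `sup_p limsup_{T → ∞} vol (X ∩ (p + [-T, T]ⁿ)) / vol [-T, T]ⁿ`. -/
noncomputable def upperDensity {n : ℕ} (X : Set (Eucl n)) : ℝ≥0∞ :=
  ⨆ p : Eucl n,
    limsup (fun T : ℝ => volume (X ∩ cube p T) / volume (cube (0 : Eucl n) T)) atTop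

/-- The `D`-distance graph `G(ℝⁿ, D)`: the points `x` and `y` are adjacent if `‖x - y‖ ∈ D`. -/
def distanceGraph (n : ℕ) (D : Set ℝ) : SimpleGraph (Eucl n) where
  Adj x y := x ≠ y ∧ ‖x - y‖ ∈ D
  symm := ⟨fun x y h => ⟨h.1.symm, by rw [norm_sub_rev]; exact h.2⟩⟩
  loopless := ⟨fun _ h => h.1 rfl⟩

/-- The independence density of a graph on `ℝⁿ`: the supremum of the upper densities of the
Lebesgue-measurable independent sets. -/
noncomputable def independenceDensity {n : ℕ} (G : SimpleGraph (Eucl n)) : ℝ≥0∞ :=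
  ⨆ I : {I : Set (Eucl n) // NullMeasurableSet I volume ∧ G.IsIndepSet I}, upperDensity I.1

/-! ### The function `Ω_n` -/

/-- The vector `t e₁ = (t, 0, …, 0)` of `ℝⁿ`. -/
noncomputable def firstAxis (n : ℕ) (t : ℝ) : Eucl n :=
  WithLp.toLp 2 fun i => if i.val = 0 then t else 0

/-- The function `Ω_n` with `Ω_n(‖u‖) = ω(S^{n-1})⁻¹ ∫_{S^{n-1}} e^{i u · ξ} dω(ξ)`, where `ω` is
the surface measure of the unit sphere. The right-hand side depends only on `‖u‖`, so `u = t e₁` is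
taken, and it is real (`ξ ↦ -ξ` preserves `ω`), so `e^{i u · ξ}` is replaced by its real part. -/
noncomputable def Omega (n : ℕ) (t : ℝ) : ℝ :=
  ⨍ ξ : Metric.sphere (0 : Eucl n) 1,
    Real.cos ⟪firstAxis n t, (ξ : Eucl n)⟫ ∂(volume : Measure (Eucl n)).toSphere

/-! ### Copositive matrices and thick constraints -/

/-- The cone `C*(U)` of copositive matrices, for a finite index set. -/
def copositiveCone (U : Type*) [Fintype U] : Set (Matrix U U ℝ) :=
  {Z | Z.IsSymm ∧ ∀ f : U → ℝ, (∀ x, 0 ≤ f x) → 0 ≤ ∑ x, ∑ y, Z x y * f x * f y}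

/-- The tip of `C*(U)`: the copositive matrices `Z` with `‖Z‖₁ = ∑ |Z(x, y)| ≤ 1`. -/
def copositiveTip (U : Type*) [Fintype U] : Set (Matrix U U ℝ) :=
  {Z | Z ∈ copositiveCone U ∧ ∑ x, ∑ y, |Z x y| ≤ 1}

/-- `T` picks, for every nonempty finite `U ⊆ ℝⁿ`, a countable dense subset `T(U)` of the tip of
`C*(U)` whose elements satisfy `tr Z > 0` and `⟨J, Z⟩ > 0`. -/
def IsCountableDenseChoice {n : ℕ} (T : (U : Finset (Eucl n)) → Set (Matrix U U ℝ)) : Prop :=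
  ∀ U : Finset (Eucl n), U.Nonempty →
    (T U).Countable ∧ T U ⊆ copositiveTip U ∧ copositiveTip U ⊆ closure (T U) ∧
      ∀ Z ∈ T U, 0 < Z.trace ∧ 0 < ∑ x, ∑ y, Z x y

open Classical in
/-- The minimal distance `m(U)` between distinct points of a finite set `U`. If `U` has only one
point there are no such pairs and any positive number may be used; we take `1`. -/
noncomputable def minDist {n : ℕ} (U : Finset (Eucl n)) : ℝ :=
  if (U : Set (Eucl n)).Nontrivial then (U : Set (Eucl n)).infsep else 1

/-- The function
`r(t) = ∑_{x, y ∈ U} Z(x, y) ∫_{B(x, δ)} ∫_{B(y, δ)} Ω_n(t ‖x' - y'‖) dy' dx'` on `[0, ∞)`. -/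
noncomputable def thickFunction {n : ℕ} (U : Finset (Eucl n)) (Z : Matrix U U ℝ) (δ : ℝ)
    (t : ℝ≥0) : ℝ :=
  ∑ x : U, ∑ y : U, Z x y *
    ∫ x' in Metric.ball (x : Eucl n) δ, ∫ y' in Metric.ball (y : Eucl n) δ,
      Omega n (t * ‖x' - y'‖)

/-- The functions `r` that come from the nonempty finite sets `U ⊆ ℚⁿ`, the matrices `Z ∈ T(U)` and
the radii `δ = m(U) / (2k)` for integers `k ≥ 1`. -/
def thickFunctions {n : ℕ} (T : (U : Finset (Eucl n)) → Set (Matrix U U ℝ)) : Set (ℝ≥0 → ℝ) :=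
  {r | ∃ U : Finset (Eucl n), U.Nonempty ∧ (∀ x ∈ U, ∀ i, ∃ q : ℚ, x i = q) ∧
    ∃ Z ∈ T U, ∃ k : ℕ, 1 ≤ k ∧ r = thickFunction U Z (minDist U / (2 * k))}

/-- The sequence `r` is an enumeration of the functions of the countably many thick constraints,
for some choice of the countable dense sets `T(U)`. The function called `r_k` in the usual
numbering `r_1, r_2, …` is `r (k - 1)`. -/
def IsThickEnumeration (n : ℕ) (r : ℕ → ℝ≥0 → ℝ) : Prop :=
  ∃ T : (U : Finset (Eucl n)) → Set (Matrix U U ℝ),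
    IsCountableDenseChoice T ∧ Set.range r = thickFunctions T

/-! ### The linear programs -/

/-- Feasibility of the Borel measure `α` on `[0, ∞)` for the problem that forbids the distance `1`
and has the constraints `∫ r dα ≥ 0` for the functions `r ∈ R`. -/
structure IsFeasible (n : ℕ) (R : Set (ℝ≥0 → ℝ)) (α : Measure ℝ≥0) : Prop where
  total_mass : α Set.univ = 1
  forbidden_distance : ∫ t : ℝ≥0, Omega n t ∂α = 0
  thick_constraint : ∀ r ∈ R, 0 ≤ ∫ t, r t ∂α

/-- The optimal value: the supremum of `α({0})` over all feasible `α`. -/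
noncomputable def optimalValue (n : ℕ) (R : Set (ℝ≥0 → ℝ)) : ℝ≥0∞ :=
  ⨆ α : {α : Measure ℝ≥0 // IsFeasible n R α}, α.1 {0}

/-- `ϑ_N`, with the constraints of the first `N` functions of the sequence. -/
noncomputable def thetaN (n : ℕ) (r : ℕ → ℝ≥0 → ℝ) (N : ℕ) : ℝ≥0∞ :=
  optimalValue n {s | ∃ k < N, s = r k}

/-- `ϑ_∞`, with the constraints of all functions of the sequence. -/
noncomputable def thetaInfty (n : ℕ) (r : ℕ → ℝ≥0 → ℝ) : ℝ≥0∞ :=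
  optimalValue n (Set.range r)

end ThickLP

namespace ThickLP

/-! The link between measures and sets is the radial function f(z) = ∫ Ω_n(t‖z‖) dα(t)
(`radialTransform`). For feasible α it is continuous and even, f(0) = 1, f = 0 on the unit sphere,
and the thick constraints say that ball averages of f pair nonnegatively with copositive matrices.
The mass α({0}) plays the role of the density.

Sets give measures. Cut an independent set to a cube and repeat it periodically, with a period
leaving a gap wider than 1 between copies. By Parseval its normalised autocorrelation is the cosine
transform of a probability measure on ℝⁿ whose mass at the origin is the density of the periodic
set. The law of ‖u‖ under that measure is feasible: its f is a rotation average of nonnegative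
products X(a)X(b), which copositive matrices pair with nonnegatively and which vanish at distance 1
(`exists_spectral_measure`, `isFeasible_map_norm`). The gap costs a factor tending to 1 as the cube
grows.

Measures give sets. Shrinking the balls turns the thick constraints into pointwise positivity of f
on rational points (`isPointwisePositive_radialTransform`), and discretisation extends this to
integral kernels on a bounded set Q (`kernel_nonneg`). Let b bound the volume of the independent
subsets of Q, and suppose the double integral of f over Q exceeds b vol(Q). For some c > b, the
kernel "c times the diagonal, minus 1, plus penalties on pairs at distance nearly 1" then pairs
negatively with f, since f is tiny where the penalties live. Hence it is not copositive: some g ≥ 0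
with ∫ g = 1 has ∫ g² ≤ 1/c and all penalties at most 1. With more and more penalties, a weak L²
limit G satisfies all of them, so G(x)G(x + ξ) = 0 almost everywhere for a dense set of unit vectors
ξ. The density points of {G > 0} form an independent set (`exists_independent_subset`), and
Cauchy–Schwarz makes its volume at least c > b, a contradiction (`integral_le_of_independent`).
Since Ω_n is of positive type, that double integral is at least α({0}) vol(Q)², so α({0}) vol(Q) ≤
b; repeating independent subsets of Q periodically bounds b by the independence density.

Convergence of ϑ_N is a compactness argument (`tendsto_optimalValue`). As n ≥ 2, Ω_n and all the r_k
vanish at infinity, so mass escaping to infinity is invisible to the constraints, and renormalising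
the limit can only increase the mass at 0. -/

/-! ### The uniform measure on the sphere -/

/-- The uniform probability measure on the unit sphere, as a measure on `ℝⁿ`: the radial projection
of the uniform measure on the unit ball. -/
noncomputable def sphereUnif (n : ℕ) : Measure (Eucl n) :=
  (volume (Metric.ball (0 : Eucl n) 1))⁻¹ •
    (volume.restrict (Metric.ball (0 : Eucl n) 1)).map (fun x => ‖x‖⁻¹ • x)

lemma measurable_radial (n : ℕ) : Measurable (fun x : Eucl n => ‖x‖⁻¹ • x) := by fun_prop

instance isProbabilityMeasure_sphereUnif (n : ℕ) : IsProbabilityMeasure (sphereUnif n) := by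
  constructor
  rw [sphereUnif, Measure.smul_apply, Measure.map_apply (measurable_radial n) .univ]
  simp only [Set.preimage_univ, Measure.restrict_apply_univ, smul_eq_mul]
  exact ENNReal.inv_mul_cancel (Metric.measure_ball_pos _ _ one_pos).ne' measure_ball_lt_top.ne

lemma ae_norm_eq_one_sphereUnif (n : ℕ) (hn : 1 ≤ n) : ∀ᵐ ξ ∂sphereUnif n, ‖ξ‖ = 1 := by
  have : NeZero n := ⟨by omega⟩
  refine Measure.ae_smul_measure ?_ _
  rw [ae_map_iff (measurable_radial n).aemeasurable
    (measurableSet_eq_fun measurable_norm measurable_const)]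
  refine ae_restrict_of_ae ?_
  have h0 : ∀ᵐ x : Eucl n, x ≠ 0 := by simp [ae_iff]
  filter_upwards [h0] with x hx
  rw [norm_smul, norm_inv, norm_norm, inv_mul_cancel₀ (norm_ne_zero_iff.2 hx)]

lemma map_isometry_sphereUnif (n : ℕ) (R : Eucl n ≃ₗᵢ[ℝ] Eucl n) :
    (sphereUnif n).map R = sphereUnif n := by
  have hR : Measurable R := R.continuous.measurable
  rw [sphereUnif, Measure.map_smul, Measure.map_map hR (measurable_radial n)]
  congr 1
  have : (R ∘ fun x : Eucl n => ‖x‖⁻¹ • x) = (fun x => ‖x‖⁻¹ • x) ∘ R := by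
    ext x : 1; simp
  rw [this, ← Measure.map_map (measurable_radial n) hR]
  congr 1
  have h := (R.measurePreserving.restrict_preimage (s := Metric.ball 0 1) measurableSet_ball).map_eq
  rwa [R.preimage_ball, map_zero] at h

/-- `toSphere` assigns to a set n times the volume of the cone over it inside the unit ball; up to
the origin, that cone is its preimage under radial projection. -/
lemma map_coe_toSphere (n : ℕ) (hn : 1 ≤ n) :
    (volume : Measure (Eucl n)).toSphere.map (↑) =
      (n : ℝ≥0∞) • (volume.restrict (Metric.ball (0 : Eucl n) 1)).map (fun x => ‖x‖⁻¹ • x) := by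
  have : NeZero n := ⟨by omega⟩
  ext s hs
  rw [Measure.map_apply measurable_subtype_coe hs,
    Measure.toSphere_apply' _ (measurable_subtype_coe hs), Measure.smul_apply,
    Measure.map_apply (measurable_radial n) hs, Measure.restrict_apply (measurable_radial n hs),
    finrank_euclideanSpace_fin, smul_eq_mul]
  congr 1
  have h0 : volume ({0} : Set (Eucl n)) = 0 := by simp
  rw [← measure_sdiff_null (s := _ ∩ _) h0]
  congr 1
  ext x
  simp only [Set.mem_smul, Set.mem_image, Set.mem_preimage, Subtype.exists, Set.mem_sdiff,
    Set.mem_inter_iff, Metric.mem_ball, dist_zero_right, Set.mem_singleton_iff]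
  constructor
  · rintro ⟨r, hr, y, ⟨z, hz, hzs, rfl⟩, rfl⟩
    have hz' : ‖z‖ = 1 := by simpa using hz
    refine ⟨⟨?_, ?_⟩, ?_⟩
    · rw [norm_smul, hz', mul_one, Real.norm_of_nonneg hr.1.le, smul_smul,
        inv_mul_cancel₀ hr.1.ne', one_smul]
      exact hzs
    · rw [norm_smul, hz', mul_one, Real.norm_of_nonneg hr.1.le]; exact hr.2
    · intro h
      have := congrArg norm h
      rw [norm_smul, hz', mul_one, Real.norm_of_nonneg hr.1.le, norm_zero] at this
      exact hr.1.ne' this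
  · rintro ⟨⟨hs, h1⟩, h0⟩
    have hx := norm_ne_zero_iff.2 h0
    refine ⟨‖x‖, ⟨by positivity, h1⟩, _, ⟨_, ?_, hs, rfl⟩, ?_⟩
    · simp [norm_smul, hx]
    · rw [smul_smul, mul_inv_cancel₀ hx, one_smul]

lemma norm_firstAxis (n : ℕ) (hn : 1 ≤ n) (t : ℝ) : ‖firstAxis n t‖ = |t| := by
  rw [EuclideanSpace.norm_eq, Finset.sum_eq_single (⟨0, hn⟩ : Fin n)]
  · simp [firstAxis, Real.sqrt_sq_eq_abs]
  · intro b _ hb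
    have : b.val ≠ 0 := fun h => hb (Fin.ext h)
    simp [firstAxis, this]
  · simp

lemma exists_isometry_eq {n : ℕ} {u v : Eucl n} (h : ‖u‖ = ‖v‖) :
    ∃ R : Eucl n ≃ₗᵢ[ℝ] Eucl n, R u = v :=
  ⟨_, Submodule.reflection_sub h⟩

lemma integral_cos_sphereUnif_congr {n : ℕ} {u v : Eucl n} (h : ‖u‖ = ‖v‖) :
    ∫ ξ, Real.cos ⟪u, ξ⟫ ∂sphereUnif n = ∫ ξ, Real.cos ⟪v, ξ⟫ ∂sphereUnif n := by
  obtain ⟨R, rfl⟩ := exists_isometry_eq h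
  conv_rhs => rw [← map_isometry_sphereUnif n R]
  rw [integral_map R.continuous.measurable.aemeasurable
    (by fun_prop)]
  simp

/-- Rotation invariance frees Ω_n from the fixed axis, and the factor n vol(ball) cancels against
the total mass of `toSphere`. -/
lemma omega_norm {n : ℕ} (hn : 1 ≤ n) (u : Eucl n) :
    Omega n ‖u‖ = ∫ ξ, Real.cos ⟪u, ξ⟫ ∂sphereUnif n := by
  have : NeZero n := ⟨by omega⟩
  have h1 : ‖u‖ = ‖firstAxis n ‖u‖‖ := by rw [norm_firstAxis n hn, abs_norm]
  rw [integral_cos_sphereUnif_congr h1, Omega, average_eq, sphereUnif, integral_smul_measure]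
  have h2 := integral_map (μ := (volume : Measure (Eucl n)).toSphere)
    (φ := ((↑) : Metric.sphere (0 : Eucl n) 1 → Eucl n))
    (f := fun ξ => Real.cos ⟪firstAxis n ‖u‖, ξ⟫) measurable_subtype_coe.aemeasurable (by fun_prop)
  rw [← h2, map_coe_toSphere n hn, integral_smul_measure, Measure.toSphere_real_apply_univ,
    smul_smul, finrank_euclideanSpace_fin]
  congr 1
  have hb : (volume : Measure (Eucl n)).real (Metric.ball 0 1) ≠ 0 := by
    rw [measureReal_def]
    exact (ENNReal.toReal_pos (Metric.measure_ball_pos _ _ one_pos).ne' measure_ball_lt_top.ne).ne'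
  have hn' : (n : ℝ) ≠ 0 := by exact_mod_cast this.1
  simp only [ENNReal.toReal_natCast, ENNReal.toReal_inv, ← measureReal_def]
  field_simp

lemma omega_eq {n : ℕ} (hn : 1 ≤ n) {t : ℝ} (ht : 0 ≤ t) (e : Eucl n) (he : ‖e‖ = 1) :
    Omega n t = ∫ ξ, Real.cos (t * ⟪e, ξ⟫) ∂sphereUnif n := by
  have := omega_norm hn (t • e)
  rw [norm_smul, he, mul_one, Real.norm_of_nonneg ht] at this
  simpa [real_inner_smul_left] using this

lemma omega_zero {n : ℕ} (hn : 1 ≤ n) : Omega n 0 = 1 := by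
  simpa using omega_norm hn (0 : Eucl n)

lemma continuous_integral_cos {n : ℕ} (ν : Measure (Eucl n)) [IsFiniteMeasure ν] :
    Continuous fun u : Eucl n => ∫ ξ, Real.cos ⟪u, ξ⟫ ∂ν := by
  refine continuous_of_dominated (bound := fun _ => 1) (fun u => by fun_prop) ?_
    (integrable_const _) ?_
  · intro u; filter_upwards with ξ; exact Real.abs_cos_le_one _
  · filter_upwards with ξ; fun_prop

lemma continuous_firstAxis (n : ℕ) : Continuous (firstAxis n) := by
  unfold firstAxis
  refine (PiLp.continuous_toLp 2 _).comp (continuous_pi fun i => ?_)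
  split_ifs <;> fun_prop

lemma continuous_omega {n : ℕ} (hn : 1 ≤ n) : Continuous fun t : ℝ≥0 => Omega n t := by
  have h : (fun t : ℝ≥0 => Omega n t) =
      fun t : ℝ≥0 => ∫ ξ, Real.cos ⟪firstAxis n t, ξ⟫ ∂sphereUnif n := by
    ext t
    rw [← omega_norm hn, norm_firstAxis n hn, NNReal.abs_eq]
  rw [h]
  exact (continuous_integral_cos (sphereUnif n)).comp
    ((continuous_firstAxis n).comp NNReal.continuous_coe)

lemma abs_omega_le_one {n : ℕ} (hn : 1 ≤ n) (t : ℝ≥0) : |Omega n t| ≤ 1 := by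
  have h := omega_norm hn (firstAxis n t)
  rw [norm_firstAxis n hn, NNReal.abs_eq] at h
  rw [h]
  refine (abs_integral_le_integral_abs).trans ?_
  refine (integral_mono_of_nonneg (ae_of_all _ fun _ => abs_nonneg _) (integrable_const 1)
    (ae_of_all _ fun ξ => Real.abs_cos_le_one _)).trans ?_
  simp

/-! ### Decay of `Ω_n` -/

lemma volume_coord_null {n : ℕ} (i : Fin n) {N : Set ℝ} (hN : volume N = 0) :
    volume {y : Eucl n | y i ∈ N} = 0 := by
  have h1 := (Measure.quasiMeasurePreserving_eval (fun _ : Fin n => (volume : Measure ℝ)) i).comp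
    (PiLp.volume_preserving_ofLp (Fin n)).quasiMeasurePreserving
  exact h1.preimage_null hN

/-- The set of the points whose direction has its first coordinate in a null set is null. -/
lemma volume_direction_null {n : ℕ} (hn : 2 ≤ n) {N : Set ℝ} (hN : volume N = 0) :
    volume {x : Eucl n | (‖x‖⁻¹ • x) ⟨0, by omega⟩ ∈ N} = 0 := by
  set i₀ : Fin n := ⟨0, by omega⟩
  set i₁ : Fin n := ⟨1, by omega⟩
  have hi : i₁ ≠ i₀ := by simp [i₀, i₁]
  set q : Eucl n → ℝ := fun y => ‖y‖ ^ 2 - y i₀ ^ 2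
  set S : Set (Eucl n) := {y | y i₀ ∈ N ∧ |y i₀| < 1 ∧ 0 < q y}
  -- `F` recovers x from the point y obtained by replacing the first coordinate of x by s = x₀/‖x‖:
  -- the other coordinates have square sum q, and x₀ = s√q/√(1 - s²). Being differentiable on the
  -- null set `S`, it has a null image.
  set F : Eucl n → Eucl n := fun y =>
    y + (y i₀ * √(q y) / √(1 - y i₀ ^ 2) - y i₀) • EuclideanSpace.single i₀ (1 : ℝ)
  have hS : volume S = 0 := measure_mono_null (fun y hy => hy.1) (volume_coord_null i₀ hN)
  have hcoord : Differentiable ℝ fun y : Eucl n => y i₀ :=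
    (EuclideanSpace.proj (𝕜 := ℝ) i₀).differentiable
  have hq : Differentiable ℝ q := (differentiable_id.norm_sq ℝ).sub (hcoord.pow 2)
  have hF : DifferentiableOn ℝ F S := by
    intro y hy
    have h1 : 1 - y i₀ ^ 2 ≠ 0 := by
      have := (sq_lt_one_iff_abs_lt_one _).2 hy.2.1; linarith
    have h1' : 0 < 1 - y i₀ ^ 2 := by
      have := (sq_lt_one_iff_abs_lt_one _).2 hy.2.1; linarith
    refine DifferentiableAt.differentiableWithinAt ?_
    refine differentiableAt_id.add (DifferentiableAt.smul_const ?_ _)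
    have h3 : DifferentiableAt ℝ (fun y : Eucl n => 1 - y i₀ ^ 2) y :=
      (differentiableAt_const (1 : ℝ)).sub ((hcoord y).pow 2)
    have h4 : DifferentiableAt ℝ (fun y : Eucl n => y i₀ * √(q y)) y :=
      (hcoord y).mul ((hq y).sqrt hy.2.2.ne')
    have h5 : DifferentiableAt ℝ (fun y : Eucl n => y i₀ * √(q y) / √(1 - y i₀ ^ 2)) y := by
      simp only [div_eq_mul_inv]
      exact h4.mul ((h3.sqrt h1).inv (Real.sqrt_pos.2 h1').ne')
    exact h5.sub (hcoord y)
  have hFS := addHaar_image_eq_zero_of_differentiableOn_of_addHaar_eq_zero volume hF hS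
  refine measure_mono_null (t := F '' S ∪ {y : Eucl n | y i₁ ∈ ({0} : Set ℝ)}) ?_
    (measure_union_null hFS (volume_coord_null i₁ (by simp)))
  intro x hx
  -- A nonzero second coordinate makes q positive, as `F` requires; this is where a second dimension
  -- is used.
  by_cases hx1 : x i₁ = 0
  · exact Or.inr hx1
  left
  have hsq : x i₀ ^ 2 + x i₁ ^ 2 ≤ ‖x‖ ^ 2 := by
    rw [EuclideanSpace.norm_sq_eq, ← Finset.sum_pair (f := fun i => x i ^ 2) hi.symm]
    simp only [Real.norm_eq_abs, sq_abs]
    exact Finset.sum_le_sum_of_subset_of_nonneg (Finset.subset_univ _) fun _ _ _ => sq_nonneg _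
  have hx1' : 0 < x i₁ ^ 2 := by positivity
  have hnx : 0 < ‖x‖ := by
    rw [norm_pos_iff]; rintro rfl; simp at hx1
  set s : ℝ := ‖x‖⁻¹ * x i₀ with hs
  set y : Eucl n := x + (s - x i₀) • EuclideanSpace.single i₀ (1 : ℝ) with hy
  have hy0 : y i₀ = s := by simp [hy]
  have hs2 : s ^ 2 = x i₀ ^ 2 / ‖x‖ ^ 2 := by rw [hs]; field_simp
  have hqy : q y = ‖x‖ ^ 2 - x i₀ ^ 2 := by
    simp only [q]
    rw [hy0, hy, norm_add_sq_real, real_inner_smul_right, EuclideanSpace.inner_single_right,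
      norm_smul, PiLp.norm_single]
    simp only [conj_trivial, one_mul, norm_one, mul_one, Real.norm_eq_abs, sq_abs]
    ring
  have hd : 0 < ‖x‖ ^ 2 - x i₀ ^ 2 := by linarith
  refine ⟨y, ⟨?_, ?_, ?_⟩, ?_⟩
  · rw [hy0]; simpa using hx
  · rw [hy0, ← sq_lt_one_iff_abs_lt_one, hs2, div_lt_one (by positivity)]; linarith
  · rw [hqy]; exact hd
  · have h1 : √(1 - s ^ 2) = √(‖x‖ ^ 2 - x i₀ ^ 2) / ‖x‖ := by
      rw [hs2, eq_div_iff hnx.ne', ← Real.sqrt_sq hnx.le, ← Real.sqrt_mul' _ (sq_nonneg _),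
        Real.sqrt_sq hnx.le]
      congr 1; field_simp
    have h2 : √(‖x‖ ^ 2 - x i₀ ^ 2) ≠ 0 := (Real.sqrt_pos.2 hd).ne'
    have h3 : s * √(‖x‖ ^ 2 - x i₀ ^ 2) / (√(‖x‖ ^ 2 - x i₀ ^ 2) / ‖x‖) = x i₀ := by
      rw [hs]; field_simp
    simp only [F]
    rw [hy0, hqy, h1, h3, hy, add_assoc, ← add_smul]
    simp

/-- The Riemann–Lebesgue lemma for the density of ν; the frequency is divided by 2π to match the
normalisation of `Real.fourierChar`. -/
lemma tendsto_integral_cos_of_absolutelyContinuous (ν : Measure ℝ) [IsFiniteMeasure ν]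
    (h : ν ≪ volume) :
    Tendsto (fun t : ℝ => ∫ x, Real.cos (t * x) ∂ν) atTop (𝓝 0) := by
  have h1 := Real.tendsto_integral_exp_smul_cocompact
    (fun x => ((ν.rnDeriv volume x).toReal : ℂ))
  have h2 : Tendsto (fun t : ℝ => t / (2 * Real.pi)) atTop (cocompact ℝ) :=
    (tendsto_id.atTop_div_const (by positivity)).mono_right atTop_le_cocompact
  have h3 := (Complex.continuous_re.tendsto _).comp (h1.comp h2)
  simp only [Complex.zero_re] at h3
  refine h3.congr fun t => ?_
  simp only [Function.comp]
  rw [← integral_rnDeriv_smul h]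
  have hint : Integrable (fun x => Real.fourierChar (-(x * (t / (2 * Real.pi)))) •
      ((ν.rnDeriv volume x).toReal : ℂ)) := by
    have h4 : Integrable (fun x => ((ν.rnDeriv volume x).toReal : ℂ)) :=
      Measure.integrable_toReal_rnDeriv.ofReal
    refine h4.norm.mono' ?_ (ae_of_all _ fun x => by simp)
    have h5 : Continuous fun x : ℝ => Real.fourierChar (-(x * (t / (2 * Real.pi)))) := by fun_prop
    exact h5.aestronglyMeasurable.smul h4.aestronglyMeasurable
  rw [← RCLike.re_eq_complex_re, ← integral_re hint]
  refine integral_congr_ae (ae_of_all _ fun x => ?_)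
  simp only [Circle.smul_def, Real.fourierChar_apply, RCLike.re_eq_complex_re, smul_eq_mul]
  rw [Complex.re_mul_ofReal, Complex.exp_ofReal_mul_I_re, mul_comm]
  congr 1
  rw [← Real.cos_neg]
  congr 1
  field_simp

/-- A coordinate of a uniform point of the sphere has an absolutely continuous law once n ≥ 2. For n
= 1 the law is two atoms and Ω is the cosine, with no decay. -/
lemma tendsto_omega {n : ℕ} (hn : 2 ≤ n) :
    Tendsto (fun t : ℝ => Omega n t) atTop (𝓝 0) := by
  set i₀ : Fin n := ⟨0, by omega⟩
  set p : Eucl n → ℝ := fun x => x i₀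
  have hp : Measurable p := by fun_prop
  have hac : (sphereUnif n).map p ≪ volume := by
    refine Measure.AbsolutelyContinuous.mk fun N hN h0 => ?_
    rw [Measure.map_apply hp hN, sphereUnif, Measure.smul_apply,
      Measure.map_apply (measurable_radial n) (hp hN)]
    have := measure_mono_null (Set.Subset.refl _) (volume_direction_null hn h0)
    rw [smul_eq_mul, mul_eq_zero]
    right
    exact Measure.restrict_le_self.absolutelyContinuous this
  have : IsProbabilityMeasure ((sphereUnif n).map p) :=
    Measure.isProbabilityMeasure_map hp.aemeasurable
  refine (tendsto_integral_cos_of_absolutelyContinuous _ hac).congr' ?_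
  filter_upwards [eventually_ge_atTop 0] with t ht
  rw [omega_eq (by omega) ht (EuclideanSpace.single i₀ 1) (by simp),
    integral_map hp.aemeasurable (by fun_prop)]
  simp [p, EuclideanSpace.inner_single_left]

/-! ### Integration of the constraint functions -/

/-- The radial function `z ↦ ∫ Ω_n(t ‖z‖) dα(t)` on `ℝⁿ`. -/
noncomputable def radialTransform (n : ℕ) (α : Measure ℝ≥0) (z : Eucl n) : ℝ :=
  ∫ t : ℝ≥0, Omega n (t * ‖z‖) ∂α

lemma continuous_omega_mul_norm {n : ℕ} (hn : 1 ≤ n) {X : Type*} [TopologicalSpace X]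
    {f : X → ℝ≥0} {g : X → Eucl n} (hf : Continuous f) (hg : Continuous g) :
    Continuous fun x => Omega n (f x * ‖g x‖) := by
  have h := (continuous_omega hn).comp (hf.mul hg.nnnorm)
  simpa [Function.comp_def] using h

lemma abs_omega_mul_norm_le {n : ℕ} (hn : 1 ≤ n) (t : ℝ≥0) (z : Eucl n) :
    |Omega n (t * ‖z‖)| ≤ 1 :=
  abs_omega_le_one hn (t * ‖z‖₊)

lemma continuous_radialTransform {n : ℕ} (hn : 1 ≤ n) (α : Measure ℝ≥0) [IsFiniteMeasure α] :
    Continuous (radialTransform n α) := by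
  refine continuous_of_dominated (bound := fun _ => 1) (fun z => ?_) (fun z => ?_)
    (integrable_const _) ?_
  · exact (continuous_omega_mul_norm hn continuous_id continuous_const).aestronglyMeasurable
  · exact ae_of_all _ fun t => abs_omega_mul_norm_le hn t z
  · exact ae_of_all _ fun t => continuous_omega_mul_norm hn continuous_const continuous_id

lemma radialTransform_neg {n : ℕ} (α : Measure ℝ≥0) (z : Eucl n) :
    radialTransform n α (-z) = radialTransform n α z := by simp [radialTransform]

lemma radialTransform_zero {n : ℕ} (hn : 1 ≤ n) (α : Measure ℝ≥0) :
    radialTransform n α 0 = α.real Set.univ := by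
  simp [radialTransform, omega_zero hn]

lemma abs_radialTransform_le {n : ℕ} (hn : 1 ≤ n) (α : Measure ℝ≥0) [IsProbabilityMeasure α]
    (z : Eucl n) : |radialTransform n α z| ≤ 1 := by
  refine abs_integral_le_integral_abs.trans ((integral_mono_of_nonneg
    (ae_of_all _ fun _ => abs_nonneg _) (integrable_const 1)
    (ae_of_all _ fun t => abs_omega_mul_norm_le hn t z)).trans ?_)
  simp

lemma integrable_omega_mul_norm {n : ℕ} (hn : 1 ≤ n) (t : ℝ≥0) (ρ : Measure (Eucl n × Eucl n))
    [IsFiniteMeasure ρ] : Integrable (fun p => Omega n (t * ‖p.1 - p.2‖)) ρ := by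
  refine Integrable.of_bound ?_ 1 (ae_of_all _ fun p => abs_omega_mul_norm_le hn t _)
  exact (continuous_omega_mul_norm hn continuous_const
    (continuous_fst.sub continuous_snd)).aestronglyMeasurable

/-- Lebesgue measure on the product of the balls of radius `δ` around `x` and `y`. -/
noncomputable def ballPair {n : ℕ} (x y : Eucl n) (δ : ℝ) : Measure (Eucl n × Eucl n) :=
  (volume.restrict (Metric.ball x δ)).prod (volume.restrict (Metric.ball y δ))

lemma isFiniteMeasure_restrict_ball {n : ℕ} (x : Eucl n) (δ : ℝ) :
    IsFiniteMeasure (volume.restrict (Metric.ball x δ)) :=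
  isFiniteMeasure_restrict.2 measure_ball_lt_top.ne

instance isFiniteMeasure_ballPair {n : ℕ} (x y : Eucl n) (δ : ℝ) :
    IsFiniteMeasure (ballPair x y δ) := by
  have := isFiniteMeasure_restrict_ball x δ
  have := isFiniteMeasure_restrict_ball y δ
  unfold ballPair
  infer_instance

lemma thickFunction_eq {n : ℕ} (hn : 1 ≤ n) (U : Finset (Eucl n)) (Z : Matrix U U ℝ) (δ : ℝ)
    (t : ℝ≥0) :
    thickFunction U Z δ t = ∑ x : U, ∑ y : U, Z x y *
      ∫ p, Omega n (t * ‖p.1 - p.2‖) ∂(ballPair (x : Eucl n) y δ) := by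
  unfold thickFunction
  refine Finset.sum_congr rfl fun x _ => Finset.sum_congr rfl fun y _ => ?_
  have h := integrable_omega_mul_norm hn t (ballPair (x : Eucl n) y δ)
  unfold ballPair at h ⊢
  rw [integral_prod _ h]

lemma integrable_omega_mul_norm_prod {n : ℕ} (hn : 1 ≤ n) (α : Measure ℝ≥0) [IsFiniteMeasure α]
    (ρ : Measure (Eucl n × Eucl n)) [IsFiniteMeasure ρ] :
    Integrable (fun q : ℝ≥0 × (Eucl n × Eucl n) => Omega n (q.1 * ‖q.2.1 - q.2.2‖))
      (α.prod ρ) := by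
  refine Integrable.of_bound ?_ 1 (ae_of_all _ fun p => abs_omega_mul_norm_le hn _ _)
  exact (continuous_omega_mul_norm hn continuous_fst
    (continuous_snd.fst.sub continuous_snd.snd)).aestronglyMeasurable

/-- Fubini: a constraint on α becomes a constraint on ball averages of the function `radialTransform
n α`. -/
lemma integral_thickFunction {n : ℕ} (hn : 1 ≤ n) (α : Measure ℝ≥0) [IsFiniteMeasure α]
    (U : Finset (Eucl n)) (Z : Matrix U U ℝ) (δ : ℝ) :
    ∫ t, thickFunction U Z δ t ∂α = ∑ x : U, ∑ y : U, Z x y *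
      ∫ p, radialTransform n α (p.1 - p.2) ∂(ballPair (x : Eucl n) y δ) := by
  have hint := fun x y : U => integrable_omega_mul_norm_prod hn α
    (ballPair (x : Eucl n) y δ)
  have hint' : ∀ x y : U, Integrable (fun t : ℝ≥0 => Z x y *
      ∫ p, Omega n (t * ‖p.1 - p.2‖) ∂ballPair (x : Eucl n) y δ) α := fun x y =>
    ((hint x y).integral_prod_left).const_mul _
  simp_rw [thickFunction_eq hn]
  rw [integral_finsetSum _ fun x _ => integrable_finsetSum _ fun y _ => hint' x y]
  refine Finset.sum_congr rfl fun x _ => ?_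
  rw [integral_finsetSum _ fun y _ => hint' x y]
  refine Finset.sum_congr rfl fun y _ => ?_
  rw [integral_const_mul, integral_integral_swap (hint x y)]
  rfl

lemma continuous_thickFunction {n : ℕ} (hn : 1 ≤ n) (U : Finset (Eucl n)) (Z : Matrix U U ℝ)
    (δ : ℝ) : Continuous (thickFunction U Z δ) := by
  have h : thickFunction U Z δ = fun t => _ := funext fun t => thickFunction_eq hn U Z δ t
  rw [h]
  refine continuous_finsetSum _ fun x _ => continuous_finsetSum _ fun y _ =>
    continuous_const.mul ?_
  refine continuous_of_dominated (bound := fun _ => 1) (fun z => ?_) (fun z => ?_)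
    (integrable_const _) ?_
  · exact (integrable_omega_mul_norm hn z _).aestronglyMeasurable
  · exact ae_of_all _ fun t => abs_omega_mul_norm_le hn _ _
  · exact ae_of_all _ fun t => continuous_omega_mul_norm hn continuous_id continuous_const

/-- Thickening matters here: the pairs x' = y', for which the integrand stays equal to 1, form a
null set, even when x = y. Without the balls, the diagonal terms would not decay. -/
lemma tendsto_thickFunction {n : ℕ} (hn : 2 ≤ n) (U : Finset (Eucl n)) (Z : Matrix U U ℝ)
    (δ : ℝ) : Tendsto (thickFunction U Z δ) atTop (𝓝 0) := by
  have hn1 : 1 ≤ n := by omega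
  have : NeZero n := ⟨by omega⟩
  have h : thickFunction U Z δ = fun t => _ := funext fun t => thickFunction_eq hn1 U Z δ t
  rw [h]
  have h0 : (0 : ℝ) = ∑ x : U, ∑ y : U, Z x y * 0 := by simp
  rw [h0]
  refine tendsto_finsetSum _ fun x _ => tendsto_finsetSum _ fun y _ =>
    tendsto_const_nhds.mul ?_
  set ρ := ballPair (x : Eucl n) y δ
  have hρ : ∀ᵐ p ∂ρ, p.1 ≠ p.2 := by
    have hm : MeasurableSet {p : Eucl n × Eucl n | p.1 ≠ p.2} :=
      (measurableSet_eq_fun measurable_fst measurable_snd).compl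
    simp only [ρ, ballPair]
    rw [Measure.ae_prod_iff_ae_ae hm]
    refine ae_of_all _ fun a => ae_restrict_of_ae ?_
    simp [ae_iff]
  rw [show (0 : ℝ) = ∫ p, (0 : ℝ) ∂ρ by simp]
  refine tendsto_integral_filter_of_dominated_convergence (fun _ => 1)
    (Eventually.of_forall fun t => (integrable_omega_mul_norm hn1 t _).aestronglyMeasurable)
    (Eventually.of_forall fun t => ae_of_all _ fun p => abs_omega_mul_norm_le hn1 _ _)
    (integrable_const _) ?_
  filter_upwards [hρ] with p hp
  have hp' : 0 < ‖p.1 - p.2‖ := norm_pos_iff.2 (sub_ne_zero.2 hp)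
  exact (tendsto_omega hn).comp
    ((NNReal.tendsto_coe_atTop.2 tendsto_id).atTop_mul_const hp')

/-! ### Limits of feasible measures -/

/-- A continuous function on `[0, ∞)` that vanishes at infinity, extended to `[0, ∞]`. -/
lemma continuous_extend_infty {h : ℝ≥0 → ℝ} (hc : Continuous h) (h0 : Tendsto h atTop (𝓝 0)) :
    Continuous fun x : ℝ≥0∞ => if x = ∞ then (0 : ℝ) else h x.toNNReal := by
  rw [continuous_iff_continuousAt]
  intro x
  by_cases hx : x = ∞
  · subst hx
    rw [ContinuousAt, if_pos rfl, ENNReal.nhds_top_basis.tendsto_iff Metric.nhds_basis_ball]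
    intro ε hε
    obtain ⟨a, ha⟩ := eventually_atTop.1 (h0.eventually (Metric.ball_mem_nhds 0 hε))
    refine ⟨a, ENNReal.coe_lt_top, fun y hy => ?_⟩
    by_cases hy' : y = ∞
    · simp [hy', hε]
    · rw [if_neg hy']
      refine ha _ ?_
      rw [← ENNReal.coe_le_coe, ENNReal.coe_toNNReal hy']
      exact (Set.mem_Ioi.1 hy).le
  · have : (fun x : ℝ≥0∞ => if x = ∞ then (0 : ℝ) else h x.toNNReal) =ᶠ[𝓝 x]
        fun x => h x.toNNReal := by
      filter_upwards [isOpen_compl_singleton.mem_nhds hx] with y hy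
      exact if_neg hy
    refine ContinuousAt.congr ?_ this.symm
    exact hc.continuousAt.comp (ENNReal.tendsto_toNNReal hx)

/-- Probability measures on `[0, ∞)` with mass at least `c` in `0` have a cluster point against the
continuous functions that vanish at infinity; it keeps the mass in `0`. -/
lemma exists_vague_limit (a : ℕ → Measure ℝ≥0) (ha : ∀ N, IsProbabilityMeasure (a N)) {c : ℝ≥0∞}
    (hc : ∀ N, c ≤ a N {0}) :
    ∃ (α : Measure ℝ≥0) (F : Filter ℕ), F.NeBot ∧ F ≤ atTop ∧ α Set.univ ≤ 1 ∧ c ≤ α {0} ∧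
      ∀ h : ℝ≥0 → ℝ, Continuous h → Tendsto h atTop (𝓝 0) →
        Tendsto (fun N => ∫ t, h t ∂a N) F (𝓝 (∫ t, h t ∂α)) := by
  have hcoe : MeasurableEmbedding ((↑) : ℝ≥0 → ℝ≥0∞) :=
    ENNReal.isOpenEmbedding_coe.measurableEmbedding
  set b : ℕ → ProbabilityMeasure ℝ≥0∞ := fun N =>
    ⟨(a N).map (↑), Measure.isProbabilityMeasure_map hcoe.measurable.aemeasurable⟩
  -- Pushed to the compact space [0, ∞], the measures live in a compact space of probability
  -- measures, so they converge along any ultrafilter.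
  set F : Ultrafilter ℕ := hyperfilter ℕ
  obtain ⟨β, -, hβ⟩ := isCompact_univ.ultrafilter_le_nhds (F.map b) (by simp)
  have hb : Tendsto b F (𝓝 β) := hβ
  -- `comap` discards the mass at ∞, hence only total mass at most 1. The mass at 0 survives by the
  -- portmanteau inequality for closed sets.
  refine ⟨(β : Measure ℝ≥0∞).comap (↑), F, inferInstance, ?_, ?_, ?_, ?_⟩
  · exact (hyperfilter_le_cofinite).trans Nat.cofinite_eq_atTop.le
  · rw [hcoe.comap_apply]; exact prob_le_one
  · rw [hcoe.comap_apply, Set.image_singleton, ENNReal.coe_zero]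
    have h1 := ProbabilityMeasure.limsup_measure_closed_le_of_tendsto hb
      (isClosed_singleton (x := (0 : ℝ≥0∞)))
    refine le_trans ?_ h1
    refine le_limsup_of_le ?_ fun d hd => ?_
    · isBoundedDefault
    · obtain ⟨N, hN⟩ := hd.exists
      refine (hc N).trans (le_trans (le_of_eq ?_) hN)
      simp only [b, ProbabilityMeasure.coe_mk]
      rw [hcoe.map_apply]
      congr 1
      ext; simp
  · intro h hh h0
    set H : ℝ≥0∞ → ℝ := fun x => if x = ∞ then (0 : ℝ) else h x.toNNReal
    have hH : Continuous H := continuous_extend_infty hh h0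
    have h1 := (ProbabilityMeasure.tendsto_iff_forall_integral_tendsto.1 hb)
      (BoundedContinuousFunction.mkOfCompact ⟨H, hH⟩)
    simp only [BoundedContinuousFunction.mkOfCompact_apply, ContinuousMap.coe_mk] at h1
    have h2 : ∀ N, ∫ x, H x ∂(b N : Measure ℝ≥0∞) = ∫ t, h t ∂a N := fun N => by
      simp only [b, ProbabilityMeasure.coe_mk]
      rw [hcoe.integral_map]
      simp [H]
    have h3 : ∫ x, H x ∂(β : Measure ℝ≥0∞) =
        ∫ t, h t ∂((β : Measure ℝ≥0∞).comap ((↑) : ℝ≥0 → ℝ≥0∞)) := by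
      have : ∀ t : ℝ≥0, h t = H t := fun t => by simp [H]
      simp_rw [this]
      rw [← hcoe.integral_map (g := H), hcoe.map_comap]
      refine (setIntegral_eq_integral_of_forall_compl_eq_zero fun x hx => ?_).symm
      have : x = ∞ := by
        by_contra hx'
        exact hx ⟨x.toNNReal, ENNReal.coe_toNNReal hx'⟩
      simp [H, this]
    simp_rw [h2, h3] at h1
    exact h1

/-- If the limit exceeded ϑ_∞, measures feasible for the first N constraints with mass at least c >
ϑ_∞ at 0 would have a vague limit. All constraints except total mass are homogeneous, so dividing by
the remaining mass m ≤ 1 restores feasibility without lowering the mass at 0. -/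
lemma tendsto_optimalValue {n : ℕ} (hn : 2 ≤ n) (r : ℕ → ℝ≥0 → ℝ) (hr : ∀ k, Continuous (r k))
    (hr0 : ∀ k, Tendsto (r k) atTop (𝓝 0)) :
    Tendsto (thetaN n r) atTop (𝓝 (thetaInfty n r)) := by
  have hanti : Antitone (thetaN n r) := by
    intro N M hNM
    refine iSup_le fun α => ?_
    have hα : IsFeasible n {s | ∃ k < N, s = r k} α.1 :=
      ⟨α.2.1, α.2.2, fun s ⟨k, hk, hs⟩ => α.2.3 s ⟨k, hk.trans_le hNM, hs⟩⟩
    exact le_iSup (fun α : {α : Measure ℝ≥0 // IsFeasible n {s | ∃ k < N, s = r k} α} =>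
      α.1 {0}) ⟨α.1, hα⟩
  have hle : ∀ N, thetaInfty n r ≤ thetaN n r N := by
    intro N
    refine iSup_le fun α => ?_
    have hα : IsFeasible n {s | ∃ k < N, s = r k} α.1 :=
      ⟨α.2.1, α.2.2, fun s ⟨k, hk, hs⟩ => α.2.3 s ⟨k, hs.symm⟩⟩
    exact le_iSup (fun α : {α : Measure ℝ≥0 // IsFeasible n {s | ∃ k < N, s = r k} α} =>
      α.1 {0}) ⟨α.1, hα⟩
  have hlim := tendsto_atTop_iInf hanti
  suffices h : ⨅ N, thetaN n r N = thetaInfty n r by rwa [h] at hlim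
  refine le_antisymm ?_ (le_iInf hle)
  by_contra! hlt
  obtain ⟨c, hc1, hc2⟩ := exists_between hlt
  have hex : ∀ N, ∃ α : {α : Measure ℝ≥0 // IsFeasible n {s | ∃ k < N, s = r k} α},
      c < α.1 {0} := fun N => lt_iSup_iff.1 (hc2.trans_le (iInf_le _ N))
  choose a ha using hex
  obtain ⟨α, F, hF, hF', hα1, hα0, hlimα⟩ := exists_vague_limit (fun N => (a N).1)
    (fun N => ⟨(a N).2.1⟩) (c := c) fun N => (ha N).le
  have hcpos : 0 < c := (zero_le).trans_lt hc1
  set m := α Set.univ with hm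
  have hm0 : m ≠ 0 := ((hcpos.trans_le hα0).trans_le (measure_mono (Set.subset_univ _))).ne'
  have hmt : m ≠ ∞ := (hα1.trans_lt ENNReal.one_lt_top).ne
  have hfeas : IsFeasible n (Set.range r) (m⁻¹ • α) := by
    refine ⟨?_, ?_, ?_⟩
    · rw [Measure.smul_apply, smul_eq_mul, ← hm, ENNReal.inv_mul_cancel hm0 hmt]
    · rw [integral_smul_measure]
      have := hlimα (fun t => Omega n t) (continuous_omega (by omega))
        ((tendsto_omega hn).comp (NNReal.tendsto_coe_atTop.2 tendsto_id))
      have h2 : ∀ N, ∫ t : ℝ≥0, Omega n t ∂(a N).1 = 0 := fun N => (a N).2.2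
      simp_rw [h2] at this
      rw [← tendsto_nhds_unique tendsto_const_nhds this, smul_zero]
    · rintro _ ⟨k, rfl⟩
      rw [integral_smul_measure]
      refine smul_nonneg ENNReal.toReal_nonneg ?_
      refine ge_of_tendsto (hlimα (r k) (hr k) (hr0 k)) ?_
      filter_upwards [hF' (eventually_gt_atTop k)] with N hN
      exact (a N).2.3 _ ⟨k, hN, rfl⟩
  have hle2 : (m⁻¹ • α) {0} ≤ thetaInfty n r :=
    le_iSup (fun α : {α : Measure ℝ≥0 // IsFeasible n (Set.range r) α} => α.1 {0}) ⟨_, hfeas⟩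
  refine absurd (hc1.trans_le (hα0.trans ?_)) (lt_irrefl _)
  refine le_trans ?_ hle2
  rw [Measure.smul_apply, smul_eq_mul]
  exact le_mul_of_one_le_left zero_le (ENNReal.one_le_inv.2 hα1)

/-! ### Enumerations of the thick constraints exist -/

lemma sum_nonneg_of_copositive {U : Type*} [Fintype U] {Z : Matrix U U ℝ}
    (hZ : Z ∈ copositiveCone U) : 0 ≤ ∑ x, ∑ y, Z x y := by
  simpa using hZ.2 (fun _ => 1) fun _ => zero_le_one

lemma diag_nonneg_of_copositive {U : Type*} [Fintype U] [DecidableEq U] {Z : Matrix U U ℝ}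
    (hZ : Z ∈ copositiveCone U) (i : U) : 0 ≤ Z i i := by
  have := hZ.2 (fun x => if x = i then 1 else 0) fun x => by split_ifs <;> norm_num
  simpa using this

lemma trace_nonneg_of_copositive {U : Type*} [Fintype U] {Z : Matrix U U ℝ}
    (hZ : Z ∈ copositiveCone U) : 0 ≤ Z.trace := by
  classical
  exact Finset.sum_nonneg fun i _ => diag_nonneg_of_copositive hZ i

lemma sum_one_apply (U : Type*) [Fintype U] [DecidableEq U] :
    ∑ x : U, ∑ y : U, (1 : Matrix U U ℝ) x y = Fintype.card U := by
  simp [Matrix.one_apply]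

/-- Mix Z with the identity scaled to norm 1: (1 - ε)Z + ε|U|⁻¹ I stays in the tip, and its trace
and entry sum are at least ε. -/
lemma copositiveTip_subset_closure (U : Type*) [Fintype U] [Nonempty U] :
    copositiveTip U ⊆
      closure {Z | Z ∈ copositiveTip U ∧ 0 < Z.trace ∧ 0 < ∑ x, ∑ y, Z x y} := by
  classical
  intro Z hZ
  have hcard : (0 : ℝ) < Fintype.card U := by exact_mod_cast Fintype.card_pos
  set c : ℝ := (Fintype.card U : ℝ)⁻¹ with hcdef
  have hc : 0 < c := inv_pos.2 hcard
  have hcc : c * Fintype.card U = 1 := inv_mul_cancel₀ hcard.ne'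
  let P : ℝ → Matrix U U ℝ := fun ε => (1 - ε) • Z + (ε * c) • (1 : Matrix U U ℝ)
  have hP : Tendsto P (𝓝[>] 0) (𝓝 Z) := by
    have : Continuous P := by fun_prop
    have h := this.tendsto 0
    simp only [P, sub_zero, one_smul, zero_mul, zero_smul, add_zero] at h
    exact h.mono_left nhdsWithin_le_nhds
  refine mem_closure_of_tendsto hP ?_
  filter_upwards [self_mem_nhdsWithin, Ioo_mem_nhdsGT (zero_lt_one' ℝ)] with ε hε hε1
  have hε0 : 0 < ε := hε
  have h1 : 0 ≤ 1 - ε := by linarith [hε1.2]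
  refine ⟨⟨⟨?_, fun f hf => ?_⟩, ?_⟩, ?_, ?_⟩
  · exact (hZ.1.1.smul _).add ((Matrix.isSymm_one).smul _)
  · have e : ∑ x, ∑ y, P ε x y * f x * f y =
        (1 - ε) * ∑ x, ∑ y, Z x y * f x * f y + ε * c * ∑ x, f x * f x := by
      simp only [P, Matrix.add_apply, Matrix.smul_apply, Matrix.one_apply, smul_eq_mul, add_mul,
        Finset.sum_add_distrib, Finset.mul_sum]
      simp [mul_assoc]
    rw [e]
    have := hZ.1.2 f hf
    have h2 : 0 ≤ ∑ x, f x * f x := Finset.sum_nonneg fun x _ => mul_self_nonneg _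
    positivity
  · calc ∑ x, ∑ y, |P ε x y|
        ≤ ∑ x, ∑ y, ((1 - ε) * |Z x y| + ε * c * (1 : Matrix U U ℝ) x y) := by
          refine Finset.sum_le_sum fun x _ => Finset.sum_le_sum fun y _ => ?_
          refine (abs_add_le _ _).trans (le_of_eq ?_)
          simp only [Matrix.smul_apply, smul_eq_mul, abs_mul, abs_of_nonneg h1,
            abs_of_pos hε0, abs_of_pos hc]
          congr 2
          rw [Matrix.one_apply]; split_ifs <;> simp
      _ = (1 - ε) * ∑ x, ∑ y, |Z x y| + ε * c * Fintype.card U := by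
          rw [← sum_one_apply]
          simp only [Finset.sum_add_distrib, Finset.mul_sum]
      _ ≤ 1 := by
          rw [mul_assoc, hcc]
          nlinarith [hZ.2]
  · have : (P ε).trace = (1 - ε) * Z.trace + ε := by
      simp only [P, Matrix.trace_add, Matrix.trace_smul, Matrix.trace_one, smul_eq_mul]
      rw [mul_assoc, hcc, mul_one]
    rw [this]
    have := trace_nonneg_of_copositive hZ.1
    positivity
  · have : ∑ x, ∑ y, P ε x y = (1 - ε) * ∑ x, ∑ y, Z x y + ε := by
      have h3 : ∑ x, ∑ y, P ε x y =
          (1 - ε) * ∑ x, ∑ y, Z x y + ε * c * ∑ x, ∑ y, (1 : Matrix U U ℝ) x y := by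
        simp only [P, Matrix.add_apply, Matrix.smul_apply, smul_eq_mul, Finset.sum_add_distrib,
          Finset.mul_sum]
      rw [h3, sum_one_apply, mul_assoc, hcc, mul_one]
    rw [this]
    have := sum_nonneg_of_copositive hZ.1
    positivity

lemma exists_countable_dense_subset_pi (U : Type*) [Fintype U] (S : Set (Matrix U U ℝ)) :
    ∃ D : Set (Matrix U U ℝ), D.Countable ∧ D ⊆ S ∧ S ⊆ closure D := by
  obtain ⟨D, hD, hc, hcl⟩ := (TopologicalSpace.IsSeparable.of_separableSpace
    (show Set (U → U → ℝ) from S)).exists_countable_dense_subset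
  exact ⟨D, hc, hD, hcl⟩

lemma exists_isCountableDenseChoice (n : ℕ) :
    ∃ T : (U : Finset (Eucl n)) → Set (Matrix U U ℝ), IsCountableDenseChoice T := by
  choose D hD using fun U : Finset (Eucl n) => exists_countable_dense_subset_pi U
    {Z | Z ∈ copositiveTip U ∧ 0 < Z.trace ∧ 0 < ∑ x, ∑ y, Z x y}
  refine ⟨D, fun U hU => ⟨(hD U).1, fun Z hZ => ((hD U).2.1 hZ).1, ?_,
    fun Z hZ => ((hD U).2.1 hZ).2⟩⟩
  have : Nonempty U := hU.to_subtype
  exact (copositiveTip_subset_closure U).trans (closure_minimal (hD U).2.2 isClosed_closure)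

lemma countable_rational_points (n : ℕ) :
    {x : Eucl n | ∀ i, ∃ q : ℚ, x i = q}.Countable := by
  have : {x : Eucl n | ∀ i, ∃ q : ℚ, x i = q} ⊆
      Set.range fun q : Fin n → ℚ => (WithLp.toLp 2 fun i => (q i : ℝ) : Eucl n) := by
    intro x hx
    choose q hq using hx
    exact ⟨q, by ext i; simp [hq]⟩
  exact (Set.countable_range _).mono this

lemma countable_rational_finsets (n : ℕ) :
    {U : Finset (Eucl n) | ∀ x ∈ U, ∀ i, ∃ q : ℚ, x i = q}.Countable := by
  have h := countable_rational_points n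
  have : Countable {x : Eucl n | ∀ i, ∃ q : ℚ, x i = q} := h.to_subtype
  refine (Set.countable_range fun V : Finset {x : Eucl n | ∀ i, ∃ q : ℚ, x i = q} =>
    V.map (Function.Embedding.subtype _)).mono ?_
  classical
  intro U hU
  refine ⟨U.subtype _, ?_⟩
  exact Finset.subtype_map_of_mem hU

lemma exists_isThickEnumeration (n : ℕ) : ∃ r : ℕ → ℝ≥0 → ℝ, IsThickEnumeration n r := by
  obtain ⟨T, hT⟩ := exists_isCountableDenseChoice n
  have hne : (thickFunctions T).Nonempty := by
    set U : Finset (Eucl n) := {0}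
    have hU : U.Nonempty := Finset.singleton_nonempty _
    -- An enumeration by ℕ needs a nonempty set of functions. The zero matrix lies in the tip, so
    -- the dense set `T U` cannot be empty.
    have h0 : (0 : Matrix U U ℝ) ∈ closure (T U) :=
      (hT U hU).2.2.1 ⟨⟨Matrix.isSymm_zero, fun f _ => by simp⟩, by simp⟩
    obtain ⟨Z, hZ⟩ := closure_nonempty_iff.1 ⟨_, h0⟩
    exact ⟨_, U, hU, fun x hx i => ⟨0, by simp [Finset.mem_singleton.1 hx]⟩, Z, hZ, 1, le_rfl, rfl⟩
  have hcount : (thickFunctions T).Countable := by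
    have : thickFunctions T ⊆ ⋃ U ∈ {U : Finset (Eucl n) | ∀ x ∈ U, ∀ i, ∃ q : ℚ, x i = q},
        ⋃ (_ : U.Nonempty), ⋃ Z ∈ T U, ⋃ k : ℕ, {thickFunction U Z (minDist U / (2 * k))} := by
      rintro _ ⟨U, hU, hq, Z, hZ, k, -, rfl⟩
      simp only [Set.mem_iUnion]
      exact ⟨U, hq, hU, Z, hZ, k, rfl⟩
    refine Set.Countable.mono this ?_
    refine (countable_rational_finsets n).biUnion fun U _ => Set.countable_iUnion fun hU =>
      (hT U hU).1.biUnion fun Z _ => Set.countable_iUnion fun k => Set.countable_singleton _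
  obtain ⟨r, hr⟩ := hcount.exists_eq_range hne
  exact ⟨r, T, hT, hr.symm⟩

/-! ### Averaging over the orthogonal group -/

instance continuousStar_clm (n : ℕ) : ContinuousStar (Eucl n →L[ℝ] Eucl n) :=
  ⟨(ContinuousLinearMap.adjoint (𝕜 := ℝ) (E := Eucl n) (F := Eucl n)).continuous⟩

lemma isCompact_unitary (n : ℕ) :
    IsCompact ((unitary (Eucl n →L[ℝ] Eucl n) : Submonoid _) : Set (Eucl n →L[ℝ] Eucl n)) := by
  refine Metric.isCompact_of_isClosed_isBounded isClosed_unitary ?_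
  refine isBounded_iff_forall_norm_le.2 ⟨1, fun A hA => ?_⟩
  refine ContinuousLinearMap.opNorm_le_bound _ zero_le_one fun x => ?_
  have h := (Unitary.linearIsometryEquiv ⟨A, hA⟩).norm_map x
  rw [one_mul]
  exact h.le

/-- Haar measure on the orthogonal group. By left invariance the average depends only on the norm of
u, so u may also be averaged over its sphere; swapping the integrals then yields Ω_n for every
rotation. -/
lemma exists_rotation_measure {n : ℕ} (hn : 1 ≤ n) :
    ∃ (G : Type) (_ : MeasurableSpace G) (μ : Measure G) (R : G → (Eucl n ≃ₗᵢ[ℝ] Eucl n)),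
      IsProbabilityMeasure μ ∧ Measurable (fun p : G × Eucl n => R p.1 p.2) ∧
      ∀ u w, ∫ g, Real.cos ⟪u, R g w⟫ ∂μ = Omega n (‖u‖ * ‖w‖) := by
  let G := unitary (Eucl n →L[ℝ] Eucl n)
  let _ : MeasurableSpace G := borel G
  have : BorelSpace G := ⟨rfl⟩
  have : CompactSpace G := isCompact_iff_compactSpace.1 (isCompact_unitary n)
  have : SecondCountableTopology (Eucl n →L[ℝ] Eucl n) := secondCountable_of_proper
  let K : TopologicalSpace.PositiveCompacts G := ⊤
  let μ : Measure G := Measure.haarMeasure K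
  have : IsProbabilityMeasure μ := ⟨by
    have := Measure.haarMeasure_self (K₀ := K)
    simpa [K] using this⟩
  let R : G → (Eucl n ≃ₗᵢ[ℝ] Eucl n) := fun g => Unitary.linearIsometryEquiv g
  have hR : ∀ (g : G) v, R g v = (g : Eucl n →L[ℝ] Eucl n) v := fun g v => rfl
  have hcont : Continuous (fun p : G × Eucl n => R p.1 p.2) := by
    simp_rw [hR]
    exact (continuous_subtype_val.comp continuous_fst).clm_apply continuous_snd
  refine ⟨G, inferInstance, μ, R, inferInstance, hcont.measurable, fun u w => ?_⟩
  set Ψ : Eucl n → ℝ := fun v => ∫ g, Real.cos ⟪v, R g w⟫ ∂μ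
  have hinv : ∀ v v' : Eucl n, ‖v‖ = ‖v'‖ → Ψ v = Ψ v' := by
    intro v v' h
    obtain ⟨L, hL⟩ := exists_isometry_eq h.symm
    let g₀ : G := Unitary.linearIsometryEquiv.symm L
    have hg₀ : ∀ x, R g₀ x = L x := fun x => by
      simp [R, g₀]
    have h1 := integral_mul_left_eq_self (μ := μ) (fun g => Real.cos ⟪v, R g w⟫) g₀
    simp only [Ψ]
    rw [← h1]
    refine integral_congr_ae (ae_of_all _ fun g => ?_)
    have : R (g₀ * g) w = L (R g w) := by
      rw [← hg₀]; rfl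
    simp only [this]
    rw [← hL, L.inner_map_map]
  have h2 : Ψ u = ∫ ξ, Ψ (‖u‖ • ξ) ∂sphereUnif n := by
    have : ∀ᵐ ξ ∂sphereUnif n, Ψ (‖u‖ • ξ) = Ψ u := by
      filter_upwards [ae_norm_eq_one_sphereUnif n hn] with ξ hξ
      exact hinv _ _ (by rw [norm_smul, hξ, norm_norm, mul_one])
    rw [integral_congr_ae this]
    simp
  have hint : Integrable (fun p : Eucl n × G => Real.cos ⟪‖u‖ • p.1, R p.2 w⟫)
      ((sphereUnif n).prod μ) := by
    refine Integrable.of_bound ?_ 1 (ae_of_all _ fun p => Real.abs_cos_le_one _)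
    have h3 : Continuous fun p : Eucl n × G => R p.2 w := by
      simp_rw [hR]
      exact (continuous_subtype_val.comp continuous_snd).clm_apply continuous_const
    have h4 : Continuous fun p : Eucl n × G => ⟪‖u‖ • p.1, R p.2 w⟫ :=
      (continuous_fst.const_smul ‖u‖).inner h3
    exact (Real.continuous_cos.comp h4).aestronglyMeasurable
  change Ψ u = _
  rw [h2, integral_integral_swap hint]
  have h4 : ∀ g : G, ∫ ξ, Real.cos ⟪‖u‖ • ξ, R g w⟫ ∂sphereUnif n = Omega n (‖u‖ * ‖w‖) := by
    intro g
    have := omega_norm hn (‖u‖ • R g w)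
    rw [norm_smul, norm_norm, LinearIsometryEquiv.norm_map] at this
    rw [this]
    refine integral_congr_ae (ae_of_all _ fun ξ => ?_)
    simp only [real_inner_smul_left]
    rw [real_inner_comm]
  simp [h4]

/-! ### Autocorrelation of sets on the torus -/

section Torus

open UnitAddTorus

-- Total mass 1, so that the characters of the torus are orthonormal and volumes of sets are
-- densities.
noncomputable local instance measureSpaceUnitAddCircle : MeasureSpace UnitAddCircle :=
  ⟨AddCircle.haarAddCircle⟩

local instance isAddHaarMeasure_unitAddCircle :
    Measure.IsAddHaarMeasure (volume : Measure UnitAddCircle) :=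
  inferInstanceAs (Measure.IsAddHaarMeasure AddCircle.haarAddCircle)

local instance isProbabilityMeasure_unitAddCircle :
    IsProbabilityMeasure (volume : Measure UnitAddCircle) :=
  inferInstanceAs (IsProbabilityMeasure AddCircle.haarAddCircle)

lemma mFourier_apply_add {n : ℕ} (k : Fin n → ℤ) (x y : UnitAddTorus (Fin n)) :
    mFourier k (x + y) = mFourier k x * mFourier k y := by
  simp [mFourier, fourier_apply, smul_add, AddCircle.toCircle_add, Finset.prod_mul_distrib]

lemma re_mFourier_coe {n : ℕ} (k : Fin n → ℤ) (v : Fin n → ℝ) :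
    (mFourier k (fun i => (v i : UnitAddCircle))).re = Real.cos (2 * Real.pi * ∑ i, k i * v i) := by
  simp only [mFourier, ContinuousMap.coe_mk, fourier_coe_apply]
  rw [← Complex.exp_sum, ← Complex.exp_ofReal_mul_I_re]
  congr 2
  push_cast
  rw [Finset.mul_sum, Finset.sum_mul]
  refine Finset.sum_congr rfl fun i _ => ?_
  ring

lemma mFourierCoeff_congr_ae {n : ℕ} {f g : UnitAddTorus (Fin n) → ℂ} (h : f =ᵐ[volume] g)
    (k : Fin n → ℤ) : mFourierCoeff f k = mFourierCoeff g k := by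
  refine integral_congr_ae ?_
  filter_upwards [h] with t ht
  rw [ht]

lemma mFourierCoeff_indicator_translate {n : ℕ} (S : Set (UnitAddTorus (Fin n)))
    (z : UnitAddTorus (Fin n)) (k : Fin n → ℤ) :
    mFourierCoeff (((fun t => t + z) ⁻¹' S).indicator fun _ => (1 : ℂ)) k =
      mFourier k z * mFourierCoeff (S.indicator fun _ => (1 : ℂ)) k := by
  unfold mFourierCoeff
  rw [← integral_add_right_eq_self (μ := (volume : Measure (UnitAddTorus (Fin n))))
    (fun t => mFourier (-k) t • S.indicator (fun _ => (1 : ℂ)) t) z, ← integral_const_mul]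
  refine integral_congr_ae (ae_of_all _ fun t => ?_)
  have h1 : mFourier k z * mFourier (-k) z = 1 := by
    rw [← mFourier_add, add_neg_cancel, mFourier_zero]; rfl
  simp only [mFourier_apply_add, smul_eq_mul]
  have h2 : ((fun t => t + z) ⁻¹' S).indicator (fun _ => (1 : ℂ)) t =
    S.indicator (fun _ => (1 : ℂ)) (t + z) := rfl
  rw [h2]
  linear_combination (-(mFourier (-k) t) * S.indicator (fun _ => (1 : ℂ)) (t + z)) * h1

/-- Parseval for the indicators of S and of its translate, whose coefficients differ by the factor
`mFourier k z`. -/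
lemma hasSum_autocorrelation {n : ℕ} {S : Set (UnitAddTorus (Fin n))} (hS : MeasurableSet S)
    (z : UnitAddTorus (Fin n)) :
    HasSum (fun k => ‖mFourierCoeff (S.indicator fun _ => (1 : ℂ)) k‖ ^ 2 * (mFourier k z).re)
      (volume.real (S ∩ (fun t => t + z) ⁻¹' S)) := by
  have hS' : MeasurableSet ((fun t => t + z) ⁻¹' S) := (measurable_add_const z) hS
  let f : Lp ℂ 2 (volume : Measure (UnitAddTorus (Fin n))) :=
    indicatorConstLp 2 hS (measure_ne_top _ _) 1
  let g : Lp ℂ 2 (volume : Measure (UnitAddTorus (Fin n))) :=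
    indicatorConstLp 2 hS' (measure_ne_top _ _) 1
  have hf : f =ᵐ[volume] S.indicator fun _ => (1 : ℂ) := indicatorConstLp_coeFn
  have hg : g =ᵐ[volume] ((fun t => t + z) ⁻¹' S).indicator fun _ => (1 : ℂ) :=
    indicatorConstLp_coeFn
  have h := Complex.reCLM.hasSum (hasSum_prod_mFourierCoeff f g)
  have hint : ∫ t, starRingEnd ℂ (f t) * g t =
      ((volume.real (S ∩ (fun t => t + z) ⁻¹' S) : ℝ) : ℂ) := by
    have h1 : (fun t => starRingEnd ℂ (f t) * g t) =ᵐ[volume]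
        (S ∩ (fun t => t + z) ⁻¹' S).indicator fun _ => (1 : ℂ) := by
      filter_upwards [hf, hg] with t h1 h2
      rw [h1, h2]
      by_cases ht : t ∈ S <;> by_cases ht' : t ∈ (fun t => t + z) ⁻¹' S <;> simp [ht, ht']
    rw [integral_congr_ae h1, integral_indicator_const _ (hS.inter hS')]
    simp
  rw [hint] at h
  simp only [Complex.reCLM_apply, Complex.ofReal_re] at h
  refine h.congr_fun fun k => ?_
  rw [mFourierCoeff_congr_ae hf, mFourierCoeff_congr_ae hg, mFourierCoeff_indicator_translate]
  set c := mFourierCoeff (S.indicator fun _ => (1 : ℂ)) k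
  have : starRingEnd ℂ c * (mFourier k z * c) = ((‖c‖ ^ 2 : ℝ) : ℂ) * mFourier k z := by
    rw [mul_left_comm, Complex.conj_mul', mul_comm]; norm_cast
  rw [this, Complex.re_ofReal_mul]

lemma mFourierCoeff_indicator_zero {n : ℕ} {S : Set (UnitAddTorus (Fin n))}
    (hS : MeasurableSet S) :
    mFourierCoeff (S.indicator fun _ => (1 : ℂ)) 0 = (volume.real S : ℝ) := by
  unfold mFourierCoeff
  rw [neg_zero, mFourier_zero]
  simp only [ContinuousMap.one_apply, one_smul]
  rw [integral_indicator_const _ hS]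
  simp

/-- The point of the torus given by the coordinates of `w` divided by `c`. -/
noncomputable def toTorus {n : ℕ} (c : ℝ) (w : Eucl n) : UnitAddTorus (Fin n) :=
  fun i => ((w i / c : ℝ) : UnitAddCircle)

lemma toTorus_sub {n : ℕ} (c : ℝ) (a b : Eucl n) :
    toTorus c (a - b) = toTorus c a - toTorus c b := by
  ext i; simp [toTorus, sub_div]

lemma measurable_toTorus {n : ℕ} (c : ℝ) : Measurable (toTorus (n := n) c) := by
  refine measurable_pi_lambda _ fun i => ?_
  have h : Measurable fun w : Eucl n => w i / c := by fun_prop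
  exact AddCircle.measurable_mk'.comp h

/-- The spectral measure of a set on the torus of side `c`. -/
lemma exists_spectral_measure_torus {n : ℕ} {S : Set (UnitAddTorus (Fin n))}
    (hS : MeasurableSet S) (hS0 : 0 < volume.real S) (c : ℝ) :
    ∃ ν : Measure (Eucl n), IsProbabilityMeasure ν ∧ volume S ≤ ν {0} ∧
      ∀ w : Eucl n, ∫ u, Real.cos ⟪u, w⟫ ∂ν =
        (volume.real S)⁻¹ * volume.real (S ∩ (fun t => t + toTorus c w) ⁻¹' S) := by
  set d := volume.real S with hd
  set a : (Fin n → ℤ) → ℝ := fun k => ‖mFourierCoeff (S.indicator fun _ => (1 : ℂ)) k‖ ^ 2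
  have ha : ∀ k, 0 ≤ a k := fun k => sq_nonneg _
  have hsum : HasSum a d := by
    have h := hasSum_autocorrelation hS 0
    have h0 : ∀ k : Fin n → ℤ, (mFourier k (0 : UnitAddTorus (Fin n))).re = 1 := by
      intro k
      have h1 := re_mFourier_coe k 0
      simp only [Pi.zero_apply, mul_zero, Finset.sum_const_zero, Real.cos_zero] at h1
      exact h1
    simpa [h0, a, hd] using h
  set freq : (Fin n → ℤ) → Eucl n := fun k =>
    WithLp.toLp 2 fun i => 2 * Real.pi * k i / c
  have hfreq : ∀ k w, Real.cos ⟪freq k, w⟫ = (mFourier k (toTorus c w)).re := by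
    intro k w
    unfold toTorus
    rw [re_mFourier_coe]
    congr 1
    rw [PiLp.inner_apply, Finset.mul_sum]
    refine Finset.sum_congr rfl fun i _ => ?_
    simp only [freq, RCLike.inner_apply, conj_trivial]
    ring
  -- Parseval at z = 0 gives ∑ a k = d, so dividing by d yields a probability measure. Since a 0 =
  -- d², the origin receives mass at least d.
  set ν : Measure (Eucl n) :=
    Measure.sum fun k => ENNReal.ofReal (a k / d) • Measure.dirac (freq k)
  have hν : IsProbabilityMeasure ν := by
    constructor
    simp only [ν, Measure.sum_apply _ MeasurableSet.univ, Measure.smul_apply, measure_univ,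
      smul_eq_mul, mul_one]
    rw [← ENNReal.ofReal_tsum_of_nonneg (fun k => div_nonneg (ha k) hS0.le)
      (hsum.summable.div_const d), (hsum.div_const d).tsum_eq, div_self hS0.ne',
      ENNReal.ofReal_one]
  refine ⟨ν, hν, ?_, fun w => ?_⟩
  · have h1 : (ENNReal.ofReal (a 0 / d) • Measure.dirac (freq 0)) {0} ≤ ν {0} :=
      Measure.le_sum _ _ _
    refine le_trans (le_of_eq ?_) h1
    have hf0 : freq 0 = 0 := by ext i; simp [freq]
    have ha0 : a 0 = d ^ 2 := by
      simp only [a]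
      rw [mFourierCoeff_indicator_zero hS, Complex.norm_real, Real.norm_of_nonneg hS0.le]
    rw [Measure.smul_apply, hf0, ha0, smul_eq_mul,
      Measure.dirac_apply' _ (measurableSet_singleton _),
      Set.indicator_of_mem (Set.mem_singleton _), Pi.one_apply,
      mul_one, sq, mul_div_cancel_right₀ _ hS0.ne', hd, measureReal_def, ENNReal.ofReal_toReal
      (measure_ne_top _ _)]
  · have hint : Integrable (fun u => Real.cos ⟪u, w⟫) ν :=
      Integrable.of_bound (by fun_prop) 1 (ae_of_all _ fun u => Real.abs_cos_le_one _)
    have h1 := hasSum_integral_measure hint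
    have h2 := (hasSum_autocorrelation hS (toTorus c w)).mul_left d⁻¹
    refine h1.unique (h2.congr_fun fun k => ?_)
    rw [integral_smul_measure, integral_dirac, hfreq, ENNReal.toReal_ofReal
      (div_nonneg (ha k) hS0.le), smul_eq_mul]
    simp only [a]
    ring

lemma volume_cube {n : ℕ} (p : Eucl n) (T : ℝ) :
    volume (cube p T) = ENNReal.ofReal (2 * T) ^ n := by
  have h : cube p T = WithLp.ofLp ⁻¹' (Set.univ.pi fun i => Set.Icc (p i - T) (p i + T)) := by
    ext x
    simp only [cube, Set.mem_ofPred_eq, Set.mem_preimage, Set.mem_univ_pi, Set.mem_Icc, abs_le]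
    exact forall_congr' fun i => ⟨fun h => ⟨by linarith [h.1], by linarith [h.2]⟩,
      fun h => ⟨by linarith [h.1], by linarith [h.2]⟩⟩
  rw [h, (PiLp.volume_preserving_ofLp (Fin n)).measure_preimage
    (MeasurableSet.univ_pi fun i => measurableSet_Icc).nullMeasurableSet, volume_pi_pi]
  have h2 : ∀ i, p i + T - (p i - T) = 2 * T := fun i => by ring
  simp [Real.volume_Icc, h2]

/-- The spectral measure of a bounded set that avoids the distance `1`. -/
lemma exists_spectral_measure {n : ℕ} {J : Set (Eucl n)} (hJ : MeasurableSet J) (p : Eucl n)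
    {T : ℝ} (hT : 0 < T) (hJT : J ⊆ cube p T) (hJ0 : volume J ≠ 0)
    (hJ1 : ∀ x ∈ J, ∀ y ∈ J, ‖x - y‖ ≠ 1) :
    ∃ (Θ : Type) (_ : MeasurableSpace Θ) (P : Measure Θ) (X : Θ × Eucl n → ℝ)
      (ν : Measure (Eucl n)) (c : ℝ), IsProbabilityMeasure P ∧ IsProbabilityMeasure ν ∧
      Measurable X ∧ (∀ q, 0 ≤ X q ∧ X q ≤ 1) ∧ 0 ≤ c ∧
      (∀ a b, ∫ u, Real.cos ⟪u, a - b⟫ ∂ν = c * ∫ θ, X (θ, a) * X (θ, b) ∂P) ∧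
      (∀ a b, ‖a - b‖ = 1 → ∀ θ, X (θ, a) * X (θ, b) = 0) ∧
      volume J / volume (cube (0 : Eucl n) (T + 1)) ≤ ν {0} := by
  -- The period is the side 2T of the cube plus a gap of 2, so points of different copies of `J` are
  -- never at distance 1.
  set Λ : ℝ := 2 * (T + 1) with hΛ
  have hΛ0 : 0 < Λ := by positivity
  let rep : UnitAddTorus (Fin n) → Fin n → ℝ := fun θ =>
    ((measurableEquivPiIoc fun _ : Fin n => (-1 / 2 : ℝ)) θ).1
  have hrep : Measurable rep := measurable_subtype_coe.comp (MeasurableEquiv.measurable _)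
  have hrep1 : ∀ θ, (fun i => (rep θ i : UnitAddCircle)) = θ := fun θ =>
    (measurableEquivPiIoc fun _ : Fin n => (-1 / 2 : ℝ)).symm_apply_apply θ
  have hrep2 : ∀ v : Fin n → ℝ, (∀ i, v i ∈ Set.Ioc (-1 / 2 : ℝ) (-1 / 2 + 1)) →
      rep (fun i => (v i : UnitAddCircle)) = v := fun v hv =>
    congrArg Subtype.val
      ((measurableEquivPiIoc fun _ : Fin n => (-1 / 2 : ℝ)).apply_symm_apply ⟨v, hv⟩)
  let ψ : (Fin n → ℝ) → Eucl n := fun v => p + Λ • WithLp.toLp 2 v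
  have hψ : Measurable ψ := by
    have : Measurable fun v : Fin n → ℝ => (WithLp.toLp 2 v : Eucl n) :=
      (PiLp.volume_preserving_toLp (Fin n)).measurable
    exact (this.const_smul Λ).const_add p
  let S : Set (UnitAddTorus (Fin n)) := {θ | ψ (rep θ) ∈ J}
  have hS : MeasurableSet S := (hψ.comp hrep) hJ
  have hvol : volume S = volume J / volume (cube (0 : Eucl n) (T + 1)) := by
    have h1 := UnitAddTorus.lintegral_preimage (S.indicator fun _ => 1)
      (fun _ : Fin n => (-1 / 2 : ℝ))
    rw [lintegral_indicator_const hS, one_mul] at h1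
    rw [h1]
    set B : Set (Fin n → ℝ) := {x | ∀ i, x i ∈ Set.Ioc (-1 / 2 : ℝ) (-1 / 2 + 1)}
    have hB : MeasurableSet B := by
      have : B = Set.univ.pi fun _ => Set.Ioc (-1 / 2 : ℝ) (-1 / 2 + 1) := by
        ext; simp [B]
      rw [this]
      exact MeasurableSet.univ_pi fun _ => measurableSet_Ioc
    have h2 : ∫⁻ x in B, S.indicator (fun _ => 1) (fun i => (x i : UnitAddCircle)) =
        ∫⁻ x in B, (ψ ⁻¹' J).indicator (fun _ => 1) x := by
      refine setLIntegral_congr_fun hB fun x hx => ?_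
      have h3 : (fun i => (x i : UnitAddCircle)) ∈ S ↔ x ∈ ψ ⁻¹' J := by
        change ψ (rep _) ∈ J ↔ ψ x ∈ J
        rw [hrep2 x hx]
      change S.indicator (fun _ => 1) (fun i => (x i : UnitAddCircle)) =
        (ψ ⁻¹' J).indicator (fun _ => 1) x
      by_cases h : x ∈ ψ ⁻¹' J
      · rw [Set.indicator_of_mem h, Set.indicator_of_mem (h3.2 h)]
      · rw [Set.indicator_of_notMem h, Set.indicator_of_notMem fun h' => h (h3.1 h')]
    rw [h2, lintegral_indicator_const (hψ hJ), one_mul, Measure.restrict_apply (hψ hJ)]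
    have h3 : ψ ⁻¹' J ∩ B = ψ ⁻¹' J := by
      refine Set.inter_eq_left.2 fun x hx i => ?_
      have := hJT hx i
      simp only [ψ, PiLp.add_apply, PiLp.smul_apply, smul_eq_mul, add_sub_cancel_left,
        abs_mul, abs_of_pos hΛ0] at this
      have h4 : |x i| < 1 / 2 := by
        by_contra! h
        have : Λ * (1 / 2) ≤ T := le_trans (by gcongr) this
        linarith
      rw [abs_lt] at h4
      exact ⟨by linarith [h4.1], by linarith [h4.2]⟩
    rw [h3]
    have h4 : ψ ⁻¹' J = WithLp.toLp 2 ⁻¹' ((fun y : Eucl n => Λ • y) ⁻¹'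
        ((fun y : Eucl n => p + y) ⁻¹' J)) := rfl
    have h5 : MeasurableSet ((fun y : Eucl n => p + y) ⁻¹' J) := (measurable_const_add p) hJ
    rw [h4, (PiLp.volume_preserving_toLp (Fin n)).measure_preimage
      ((measurable_const_smul Λ) h5).nullMeasurableSet, Measure.addHaar_preimage_smul _ hΛ0.ne',
      measure_preimage_add, finrank_euclideanSpace_fin, volume_cube, ← hΛ,
      abs_of_pos (by positivity), ENNReal.ofReal_inv_of_pos (by positivity),
      ENNReal.ofReal_pow hΛ0.le, mul_comm, div_eq_mul_inv]
  have hd : 0 < volume.real S := by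
    rw [measureReal_def]
    refine ENNReal.toReal_pos ?_ (measure_ne_top _ _)
    rw [hvol, volume_cube]
    exact (ENNReal.div_pos hJ0 (by finiteness)).ne'
  obtain ⟨ν, hν, hν0, hcos⟩ := exists_spectral_measure_torus hS hd Λ
  have hX : Measurable fun q : UnitAddTorus (Fin n) × Eucl n =>
      S.indicator (fun _ => (1 : ℝ)) (q.1 + toTorus Λ q.2) :=
    (measurable_const.indicator hS).comp
      (measurable_fst.add ((measurable_toTorus Λ).comp measurable_snd))
  refine ⟨UnitAddTorus (Fin n), inferInstance, volume, _, ν, (volume.real S)⁻¹, inferInstance, hν,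
    hX, fun q => ?_, by positivity, fun a b => ?_, fun a b hab θ => ?_, hvol ▸ hν0⟩
  · by_cases h : q.1 + toTorus Λ q.2 ∈ S <;> simp [h]
  · rw [hcos]
    congr 1
    -- Translating θ by the class of b makes the autocorrelation at a - b symmetric: an average of
    -- X(θ, a) X(θ, b), with X the indicator of the translated periodic set.
    have h1 := integral_add_right_eq_self (μ := (volume : Measure (UnitAddTorus (Fin n))))
      (fun θ => S.indicator (fun _ => (1 : ℝ)) (θ + toTorus Λ (a - b)) *
        S.indicator (fun _ => (1 : ℝ)) θ) (toTorus Λ b)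
    have h2 : ∀ θ, θ + toTorus Λ b + toTorus Λ (a - b) = θ + toTorus Λ a := by
      intro θ; rw [toTorus_sub]; abel
    simp only [h2] at h1
    have hS' : MeasurableSet ((fun t => t + toTorus Λ (a - b)) ⁻¹' S) := (measurable_add_const _) hS
    rw [h1, ← integral_indicator_one (hS.inter hS')]
    refine integral_congr_ae (ae_of_all _ fun θ => ?_)
    by_cases ht : θ ∈ S <;> by_cases ht' : θ + toTorus Λ (a - b) ∈ S <;> simp [ht, ht']
  · by_contra hne
    have ha : θ + toTorus Λ a ∈ S := by
      by_contra h; simp [h] at hne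
    have hb : θ + toTorus Λ b ∈ S := by
      by_contra h; simp [h] at hne
    refine hJ1 _ ha _ hb ?_
    refine Eq.trans (congrArg _ ?_) hab
    ext i
    set x := rep (θ + toTorus Λ a) i with hx
    set y := rep (θ + toTorus Λ b) i with hy
    have e1 : (x : UnitAddCircle) = θ i + ((a i / Λ : ℝ) : UnitAddCircle) :=
      congrFun (hrep1 (θ + toTorus Λ a)) i
    have e2 : (y : UnitAddCircle) = θ i + ((b i / Λ : ℝ) : UnitAddCircle) :=
      congrFun (hrep1 (θ + toTorus Λ b)) i
    have e3 : ((x - y - (a i / Λ - b i / Λ) : ℝ) : UnitAddCircle) = 0 := by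
      rw [AddCircle.coe_sub, AddCircle.coe_sub, AddCircle.coe_sub, e1, e2]; abel
    obtain ⟨m, hm⟩ := (AddCircle.coe_eq_zero_iff (1 : ℝ)).1 e3
    have hxT := hJT ha i
    have hyT := hJT hb i
    simp only [ψ, PiLp.add_apply, PiLp.smul_apply, smul_eq_mul, add_sub_cancel_left] at hxT hyT
    have hi : |a i - b i| ≤ 1 := by
      have := PiLp.norm_apply_le (a - b) i
      rw [hab] at this
      simpa using this
    have key : (m : ℝ) * Λ = Λ * x - Λ * y - (a i - b i) := by
      have : (m : ℝ) = x - y - (a i / Λ - b i / Λ) := by simpa using hm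
      rw [this]; field_simp
    -- m counts the periods by which the two representatives wrap around in coordinate i. Wrapping
    -- would require |m|Λ ≤ 2T + 1 < Λ with m ≠ 0.
    have hm1 : |(m : ℝ)| < 1 := by
      have : |(m : ℝ)| * Λ < Λ := by
        calc |(m : ℝ)| * Λ = |(m : ℝ) * Λ| := by rw [abs_mul, abs_of_pos hΛ0]
          _ ≤ T + T + 1 := by
            rw [key, abs_le]
            rw [abs_le] at hxT hyT hi
            constructor <;> linarith [hxT.1, hxT.2, hyT.1, hyT.2, hi.1, hi.2]
          _ < Λ := by rw [hΛ]; linarith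
      exact lt_of_mul_lt_mul_right (by linarith) hΛ0.le
    have hm0 : m = 0 := by
      rw [← Int.abs_lt_one_iff]; exact_mod_cast hm1
    rw [hm0] at key
    simp only [ψ, PiLp.sub_apply, PiLp.add_apply, PiLp.smul_apply, smul_eq_mul]
    simp only [Int.cast_zero, zero_mul] at key
    linarith

end Torus

/-! ### The independence density is a lower bound -/

/-- For fixed θ the integral over a pair of balls factors as h x θ * h y θ with h ≥ 0, so
copositivity of Z applies under the integral over θ. -/
lemma sum_integral_ballPair_nonneg {n : ℕ} {Θ : Type*} [MeasurableSpace Θ] (κ : Measure Θ)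
    [IsFiniteMeasure κ] {X : Θ × Eucl n → ℝ} (hX : Measurable X) (hX1 : ∀ q, 0 ≤ X q ∧ X q ≤ 1)
    (U : Finset (Eucl n)) {Z : Matrix U U ℝ} (hZ : Z ∈ copositiveCone U) (δ : ℝ) :
    0 ≤ ∑ x : U, ∑ y : U, Z x y *
      ∫ p, (∫ θ, X (θ, p.1) * X (θ, p.2) ∂κ) ∂ballPair (x : Eucl n) y δ := by
  set h : U → Θ → ℝ := fun x θ => ∫ z in Metric.ball (x : Eucl n) δ, X (θ, z)
  have hint : ∀ x y : U, Integrable (fun q : Θ × (Eucl n × Eucl n) =>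
      X (q.1, q.2.1) * X (q.1, q.2.2)) (κ.prod (ballPair (x : Eucl n) y δ)) := by
    intro x y
    refine Integrable.of_bound ?_ 1 (ae_of_all _ fun q => ?_)
    · exact ((hX.comp (measurable_fst.prodMk measurable_snd.fst)).mul
        (hX.comp (measurable_fst.prodMk measurable_snd.snd))).aestronglyMeasurable
    · rw [Real.norm_eq_abs, abs_mul, abs_of_nonneg (hX1 _).1, abs_of_nonneg (hX1 _).1]
      exact mul_le_one₀ (hX1 _).2 (hX1 _).1 (hX1 _).2
  have e1 : ∀ (x y : U) (θ : Θ),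
      ∫ p, X (θ, p.1) * X (θ, p.2) ∂ballPair (x : Eucl n) y δ = h x θ * h y θ := by
    intro x y θ
    exact integral_prod_mul (μ := volume.restrict (Metric.ball (x : Eucl n) δ))
      (ν := volume.restrict (Metric.ball (y : Eucl n) δ)) (fun a => X (θ, a)) (fun b => X (θ, b))
  have hint' : ∀ x y : U, Integrable (fun θ => Z x y * (h x θ * h y θ)) κ := by
    intro x y
    have := (hint x y).integral_prod_left.const_mul (Z x y)
    simpa only [e1] using this
  have e2 : ∀ x y : U, Z x y * ∫ p, (∫ θ, X (θ, p.1) * X (θ, p.2) ∂κ) ∂ballPair (x : Eucl n) y δ =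
      ∫ θ, Z x y * (h x θ * h y θ) ∂κ := by
    intro x y
    rw [integral_const_mul, ← integral_integral_swap (hint x y)]
    simp only [e1]
  simp_rw [e2]
  rw [Finset.sum_congr rfl fun x _ => (integral_finsetSum Finset.univ fun y _ => hint' x y).symm,
    ← integral_finsetSum _ fun x _ => integrable_finsetSum _ fun y _ => hint' x y]
  refine integral_nonneg fun θ => ?_
  have := hZ.2 (fun x => h x θ) fun x => integral_nonneg fun z => (hX1 _).1
  simp only [mul_assoc] at this
  exact this

/-- Passing to norms amounts to averaging over rotations: the radial transform at a - b is c times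
the mean of X(θ, Ra) X(θ, Rb) over θ and R. Such a mean vanishes at distance 1 and pairs
nonnegatively with copositive matrices. -/
lemma isFeasible_map_norm {n : ℕ} (hn : 1 ≤ n) {Θ : Type*} [MeasurableSpace Θ] {P : Measure Θ}
    [IsProbabilityMeasure P] {X : Θ × Eucl n → ℝ} {ν : Measure (Eucl n)} [IsProbabilityMeasure ν]
    {c : ℝ} (hX : Measurable X) (hX1 : ∀ q, 0 ≤ X q ∧ X q ≤ 1) (hc : 0 ≤ c)
    (hcos : ∀ a b, ∫ u, Real.cos ⟪u, a - b⟫ ∂ν = c * ∫ θ, X (θ, a) * X (θ, b) ∂P)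
    (hX0 : ∀ a b, ‖a - b‖ = 1 → ∀ θ, X (θ, a) * X (θ, b) = 0)
    {T : (U : Finset (Eucl n)) → Set (Matrix U U ℝ)} (hT : IsCountableDenseChoice T) :
    IsFeasible n (thickFunctions T) (ν.map fun u => ‖u‖₊) := by
  have : NeZero n := ⟨by omega⟩
  have hmeas : Measurable fun u : Eucl n => ‖u‖₊ := measurable_nnnorm
  have hα : IsProbabilityMeasure (ν.map fun u => ‖u‖₊) :=
    Measure.isProbabilityMeasure_map hmeas.aemeasurable
  obtain ⟨G, _, μ, R, hμ, hR, hRΩ⟩ := exists_rotation_measure hn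
  have hintR : ∀ w : Eucl n, Integrable (fun p : Eucl n × G => Real.cos ⟪p.1, R p.2 w⟫)
      (ν.prod μ) := by
    intro w
    refine Integrable.of_bound ?_ 1 (ae_of_all _ fun p => Real.abs_cos_le_one _)
    have h1 : Measurable fun p : Eucl n × G => R p.2 w :=
      hR.comp (measurable_snd.prodMk measurable_const)
    exact (Real.measurable_cos.comp (measurable_fst.inner h1)).aestronglyMeasurable
  have hrad : ∀ w : Eucl n, radialTransform n (ν.map fun u => ‖u‖₊) w =
      ∫ g, ∫ u, Real.cos ⟪u, R g w⟫ ∂ν ∂μ := by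
    intro w
    have hcont : Continuous fun t : ℝ≥0 => Omega n (t * ‖w‖) :=
      continuous_omega_mul_norm hn continuous_id continuous_const
    rw [radialTransform, integral_map hmeas.aemeasurable hcont.aestronglyMeasurable,
      ← integral_integral_swap (hintR w)]
    simp only [hRΩ, coe_nnnorm]
  refine ⟨measure_univ, ?_, ?_⟩
  · have h1 : ∫ t : ℝ≥0, Omega n t ∂(ν.map fun u => ‖u‖₊) =
        radialTransform n (ν.map fun u => ‖u‖₊) (EuclideanSpace.single (0 : Fin n) 1) := by
      simp [radialTransform]
    rw [h1, hrad]
    have h2 : ∀ g, ∫ u, Real.cos ⟪u, R g (EuclideanSpace.single (0 : Fin n) 1)⟫ ∂ν = 0 := by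
      intro g
      have hn1 : ‖R g (EuclideanSpace.single (0 : Fin n) 1) - 0‖ = 1 := by simp
      have h3 := hcos (R g (EuclideanSpace.single (0 : Fin n) 1)) 0
      rw [sub_zero] at h3
      simp [h3, hX0 _ _ hn1]
    simp [h2]
  · rintro _ ⟨U, hU, -, Z, hZ, k, -, rfl⟩
    rw [integral_thickFunction hn]
    have hY : Measurable fun q : (G × Θ) × Eucl n => X (q.1.2, R q.1.1 q.2) :=
      hX.comp (measurable_fst.snd.prodMk (hR.comp (measurable_fst.fst.prodMk measurable_snd)))
    have hκ := sum_integral_ballPair_nonneg (μ.prod P) hY (fun q => hX1 _) U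
      ((hT U hU).2.1 hZ).1 (minDist U / (2 * k))
    have e : ∀ a b : Eucl n, radialTransform n (ν.map fun u => ‖u‖₊) (a - b) =
        c * ∫ q : G × Θ, X (q.2, R q.1 a) * X (q.2, R q.1 b) ∂μ.prod P := by
      intro a b
      have hi : Integrable (fun q : G × Θ => X (q.2, R q.1 a) * X (q.2, R q.1 b))
          (μ.prod P) := by
        refine Integrable.of_bound ?_ 1 (ae_of_all _ fun q => ?_)
        · exact ((hY.comp (measurable_id.prodMk measurable_const)).mul
            (hY.comp (measurable_id.prodMk measurable_const))).aestronglyMeasurable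
        · rw [Real.norm_eq_abs, abs_mul, abs_of_nonneg (hX1 _).1, abs_of_nonneg (hX1 _).1]
          exact mul_le_one₀ (hX1 _).2 (hX1 _).1 (hX1 _).2
      rw [hrad, integral_prod _ hi, ← integral_const_mul]
      simp only [map_sub, hcos]
    have e2 : ∀ x y : U, Z x y * ∫ p, radialTransform n (ν.map fun u => ‖u‖₊) (p.1 - p.2)
          ∂ballPair (x : Eucl n) y (minDist U / (2 * k)) =
        c * (Z x y * ∫ p, (∫ q : G × Θ, X (q.2, R q.1 p.1) * X (q.2, R q.1 p.2) ∂μ.prod P)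
          ∂ballPair (x : Eucl n) y (minDist U / (2 * k))) := by
      intro x y
      simp only [e]
      rw [integral_const_mul]
      ring
    simp_rw [e2, ← Finset.mul_sum]
    exact mul_nonneg hc hκ

lemma density_bounded_le_optimalValue {n : ℕ} (hn : 1 ≤ n)
    {T : (U : Finset (Eucl n)) → Set (Matrix U U ℝ)} (hT : IsCountableDenseChoice T)
    {I : Set (Eucl n)} (hI : NullMeasurableSet I) (hI1 : (distanceGraph n {1}).IsIndepSet I)
    (p : Eucl n) {t : ℝ} (ht : 0 < t) :
    volume (I ∩ cube p t) / volume (cube (0 : Eucl n) (t + 1)) ≤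
      optimalValue n (thickFunctions T) := by
  have hcube : MeasurableSet (cube p t) := by
    have : cube p t = ⋂ i, {x : Eucl n | |x i - p i| ≤ t} := by ext; simp [cube]
    rw [this]
    refine MeasurableSet.iInter fun i => ?_
    exact measurableSet_le (by fun_prop) measurable_const
  -- A measurable subset of full measure stays independent, whereas a measurable superset might not.
  obtain ⟨J, hJI, hJ, hJae⟩ :=
    (hI.inter hcube.nullMeasurableSet).exists_measurable_subset_ae_eq
  rw [← measure_congr hJae]
  by_cases hJ0 : volume J = 0
  · simp [hJ0]
  have hJ1 : ∀ x ∈ J, ∀ y ∈ J, ‖x - y‖ ≠ 1 := by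
    intro x hx y hy hxy
    have hne : x ≠ y := by rintro rfl; simp at hxy
    exact hI1 (hJI hx).1 (hJI hy).1 hne ⟨hne, hxy⟩
  obtain ⟨Θ, _, P, X, ν, c, hP, hν, hX, hX1, hc, hcos, hX0, hν0⟩ :=
    exists_spectral_measure hJ p ht (fun x hx => (hJI hx).2) hJ0 hJ1
  refine hν0.trans ?_
  have hle : (ν.map fun u => ‖u‖₊) {0} ≤ optimalValue n (thickFunctions T) :=
    le_iSup (fun α : {α : Measure ℝ≥0 // IsFeasible n (thickFunctions T) α} => α.1 {0})
      ⟨_, isFeasible_map_norm hn hX hX1 hc hcos hX0 hT⟩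
  refine le_trans (le_of_eq ?_) hle
  rw [Measure.map_apply measurable_nnnorm (measurableSet_singleton _)]
  congr 1
  ext; simp

lemma tendsto_volume_cube_ratio (n : ℕ) :
    Tendsto (fun t : ℝ => volume (cube (0 : Eucl n) (t + 1)) / volume (cube (0 : Eucl n) t))
      atTop (𝓝 1) := by
  have h1 : Tendsto (fun t : ℝ => ENNReal.ofReal ((1 + t⁻¹) ^ n)) atTop (𝓝 1) := by
    have h2 : Tendsto (fun t : ℝ => (1 + t⁻¹) ^ n) atTop (𝓝 1) := by
      simpa using (tendsto_inv_atTop_zero.const_add (1 : ℝ)).pow n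
    simpa using ENNReal.tendsto_ofReal h2
  refine h1.congr' ?_
  filter_upwards [eventually_gt_atTop 0] with t ht
  rw [volume_cube, volume_cube, ← ENNReal.ofReal_pow (by positivity),
    ← ENNReal.ofReal_pow (by positivity), ← ENNReal.ofReal_div_of_pos (by positivity), ← div_pow]
  congr 2
  field_simp

lemma independenceDensity_le_optimalValue {n : ℕ} (hn : 1 ≤ n)
    {T : (U : Finset (Eucl n)) → Set (Matrix U U ℝ)} (hT : IsCountableDenseChoice T) :
    independenceDensity (distanceGraph n {1}) ≤ optimalValue n (thickFunctions T) := by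
  refine iSup_le fun ⟨I, hI, hI1⟩ => iSup_le fun p => ?_
  set θ := optimalValue n (thickFunctions T)
  have hlim : Tendsto (fun t : ℝ => θ *
      (volume (cube (0 : Eucl n) (t + 1)) / volume (cube (0 : Eucl n) t))) atTop (𝓝 θ) := by
    have := ENNReal.Tendsto.const_mul (a := θ) (tendsto_volume_cube_ratio n) (Or.inl one_ne_zero)
    rwa [mul_one] at this
  rw [← hlim.limsup_eq]
  refine limsup_le_limsup ?_
  filter_upwards [eventually_gt_atTop 0] with t ht
  have h1 := density_bounded_le_optimalValue hn hT hI hI1 p ht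
  have hpos : volume (cube (0 : Eucl n) (t + 1)) ≠ 0 := by
    rw [volume_cube]
    exact pow_ne_zero _ (ENNReal.ofReal_pos.2 (by positivity)).ne'
  have hfin : volume (cube (0 : Eucl n) (t + 1)) ≠ ∞ := by
    rw [volume_cube]; finiteness
  calc volume (I ∩ cube p t) / volume (cube (0 : Eucl n) t)
      = volume (I ∩ cube p t) / volume (cube (0 : Eucl n) (t + 1)) *
        (volume (cube (0 : Eucl n) (t + 1)) / volume (cube (0 : Eucl n) t)) := by
        rw [← mul_div_assoc, ENNReal.div_mul_cancel hpos hfin]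
    _ ≤ _ := by gcongr

/-! ### From thick constraints to pointwise constraints -/

lemma tendsto_average_ballPair {n : ℕ} {F : Eucl n × Eucl n → ℝ} (hF : Continuous F)
    (x y : Eucl n) {δ : ℕ → ℝ} (hδ : ∀ k, 0 < δ k) (hδ0 : Tendsto δ atTop (𝓝 0)) :
    Tendsto (fun k => ((ballPair x y (δ k)).real Set.univ)⁻¹ * ∫ p, F p ∂ballPair x y (δ k)) atTop
      (𝓝 (F (x, y))) := by
  -- The product carries the maximum metric, so a product of balls is a ball around (x, y).
  have heq : ∀ k, ballPair x y (δ k) = volume.restrict (Metric.ball (x, y) (δ k)) := by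
    intro k
    rw [ballPair, Measure.prod_restrict, ball_prod_same]
    rfl
  rw [Metric.tendsto_atTop]
  intro ε hε
  obtain ⟨r, hr, hr'⟩ := Metric.continuousAt_iff.1 (hF.continuousAt (x := (x, y))) (ε / 2)
    (half_pos hε)
  obtain ⟨N, hN⟩ := Metric.tendsto_atTop.1 hδ0 r hr
  refine ⟨N, fun k hk => ?_⟩
  have hk' : δ k < r := by
    have := hN k hk
    rw [Real.dist_0_eq_abs, abs_of_pos (hδ k)] at this
    exact this
  set v := (ballPair x y (δ k)).real Set.univ with hv
  have hvpos : 0 < v := by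
    rw [hv, measureReal_def, heq, Measure.restrict_apply_univ]
    exact ENNReal.toReal_pos (Metric.measure_ball_pos _ _ (hδ k)).ne' measure_ball_lt_top.ne
  have hbound : ∀ᵐ p ∂ballPair x y (δ k), ‖F p - F (x, y)‖ ≤ ε / 2 := by
    rw [heq]
    filter_upwards [ae_restrict_mem measurableSet_ball] with p hp
    exact (hr' ((Metric.mem_ball.1 hp).trans hk')).le
  have hint : Integrable F (ballPair x y (δ k)) := by
    have h1 : Integrable (fun p => F p - F (x, y)) (ballPair x y (δ k)) :=
      Integrable.of_bound (by fun_prop) _ hbound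
    refine (h1.add (integrable_const (F (x, y)))).congr (ae_of_all _ fun p => ?_)
    simp
  have h2 : ∫ p, (F p - F (x, y)) ∂ballPair x y (δ k) =
      ∫ p, F p ∂ballPair x y (δ k) - v * F (x, y) := by
    rw [integral_sub hint (integrable_const _), integral_const, smul_eq_mul]
  have h3 := norm_integral_le_of_norm_le_const hbound
  rw [h2, ← hv] at h3
  rw [Real.dist_eq]
  have h4 : v⁻¹ * ∫ p, F p ∂ballPair x y (δ k) - F (x, y) =
      v⁻¹ * (∫ p, F p ∂ballPair x y (δ k) - v * F (x, y)) := by field_simp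
  rw [h4, abs_mul, abs_of_pos (inv_pos.2 hvpos)]
  calc v⁻¹ * |∫ p, F p ∂ballPair x y (δ k) - v * F (x, y)| ≤ v⁻¹ * (ε / 2 * v) := by
        gcongr; exact h3
    _ = ε / 2 := by field_simp
    _ < ε := half_lt_self hε

/-- One normalising factor serves all pairs x, y, so a thick constraint can be divided by it as a
whole. -/
lemma ballPair_real_univ {n : ℕ} (x y : Eucl n) (δ : ℝ) :
    (ballPair x y δ).real Set.univ = (ballPair (0 : Eucl n) 0 δ).real Set.univ := by
  have h : ∀ z : Eucl n, volume (Metric.ball z δ) = volume (Metric.ball (0 : Eucl n) δ) :=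
    fun z => Measure.addHaar_ball_center _ _ _
  simp only [measureReal_def, ballPair, Measure.prod_restrict, Measure.restrict_apply_univ,
    Measure.prod_prod, h x, h y]

lemma minDist_pos {n : ℕ} (U : Finset (Eucl n)) : 0 < minDist U := by
  unfold minDist
  split_ifs with h
  · exact (U.finite_toSet.infsep_pos_iff_nontrivial).2 h
  · exact one_pos

/-- The functions `f` on `ℝⁿ` for which the matrices `(f (x - y))` for finite sets of rational
points are in the dual of the copositive cone. -/
def IsPointwisePositive {n : ℕ} (f : Eucl n → ℝ) : Prop :=
  ∀ U : Finset (Eucl n), U.Nonempty → (∀ x ∈ U, ∀ i, ∃ q : ℚ, x i = q) → ∀ A : Matrix U U ℝ,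
    (∀ g : U → ℝ, (∀ x, 0 ≤ g x) → 0 ≤ ∑ x, ∑ y, A x y * g x * g y) →
    0 ≤ ∑ x : U, ∑ y : U, A x y * f (x - y)

/-- Letting δ → 0 in the normalised constraints gives the inequality for Z in `T U`; density extends
it to the tip, and scaling to all symmetric copositive matrices. -/
lemma isPointwisePositive_radialTransform {n : ℕ} (hn : 1 ≤ n)
    {T : (U : Finset (Eucl n)) → Set (Matrix U U ℝ)} (hT : IsCountableDenseChoice T)
    {α : Measure ℝ≥0} (hα : IsFeasible n (thickFunctions T) α) :
    IsPointwisePositive (radialTransform n α) := by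
  intro U hU hq A hA
  have : IsProbabilityMeasure α := ⟨hα.1⟩
  set f := radialTransform n α
  have hf : Continuous f := continuous_radialTransform hn α
  have h1 : ∀ Z ∈ T U, 0 ≤ ∑ x : U, ∑ y : U, Z x y * f (x - y) := by
    intro Z hZ
    set δ : ℕ → ℝ := fun k => minDist U / (2 * ((k + 1 : ℕ) : ℝ))
    have hδ : ∀ k, 0 < δ k := fun k => div_pos (minDist_pos U) (by positivity)
    have hδ0 : Tendsto δ atTop (𝓝 0) := by
      refine Tendsto.div_atTop tendsto_const_nhds ?_
      exact (tendsto_natCast_atTop_atTop.comp (tendsto_add_atTop_nat 1)).const_mul_atTop two_pos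
    set v : ℕ → ℝ := fun k => ((ballPair (0 : Eucl n) 0 (δ k)).real Set.univ)⁻¹
    have hlim : Tendsto (fun k => ∑ x : U, ∑ y : U, Z x y *
        (v k * ∫ p, f (p.1 - p.2) ∂ballPair (x : Eucl n) y (δ k))) atTop
        (𝓝 (∑ x : U, ∑ y : U, Z x y * f (x - y))) := by
      refine tendsto_finsetSum _ fun x _ => tendsto_finsetSum _ fun y _ =>
        tendsto_const_nhds.mul ?_
      have := tendsto_average_ballPair (F := fun p : Eucl n × Eucl n => f (p.1 - p.2))
        (by fun_prop) x y hδ hδ0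
      simpa only [ballPair_real_univ (x : Eucl n) y] using this
    refine ge_of_tendsto' hlim fun k => ?_
    have h2 := hα.3 _ ⟨U, hU, hq, Z, hZ, k + 1, by omega, rfl⟩
    rw [integral_thickFunction hn] at h2
    have h3 : ∑ x : U, ∑ y : U, Z x y *
        (v k * ∫ p, f (p.1 - p.2) ∂ballPair (x : Eucl n) y (δ k)) =
        v k * ∑ x : U, ∑ y : U, Z x y * ∫ p, f (p.1 - p.2) ∂ballPair (x : Eucl n) y (δ k) := by
      simp only [Finset.mul_sum, mul_left_comm]
    rw [h3]
    exact mul_nonneg (inv_nonneg.2 measureReal_nonneg) h2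
  have h2 : ∀ Z ∈ copositiveTip U, 0 ≤ ∑ x : U, ∑ y : U, Z x y * f (x - y) := by
    intro Z hZ
    have hcl : IsClosed {Z : Matrix U U ℝ | 0 ≤ ∑ x : U, ∑ y : U, Z x y * f (x - y)} := by
      refine isClosed_le continuous_const ?_
      refine continuous_finsetSum _ fun x _ => continuous_finsetSum _ fun y _ => ?_
      exact (continuous_id.matrix_elem x y).mul continuous_const
    exact closure_minimal h1 hcl ((hT U hU).2.2.1 hZ)
  -- `A` need not be symmetric. As f is even, symmetrising doubles both the quadratic form and the
  -- pairing with f; the factor `s` moves the result into the tip.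
  set B : Matrix U U ℝ := A + A.transpose with hB
  set s : ℝ := (1 + ∑ x, ∑ y, |B x y|)⁻¹
  have hs0 : 0 ≤ ∑ x, ∑ y, |B x y| :=
    Finset.sum_nonneg fun x _ => Finset.sum_nonneg fun y _ => abs_nonneg _
  have hs : 0 < s := by positivity
  have hsB : s • B ∈ copositiveTip U := by
    refine ⟨⟨(Matrix.isSymm_add_transpose_self A).smul _, fun g hg => ?_⟩, ?_⟩
    · have e : ∑ x, ∑ y, (s • B) x y * g x * g y = s * (2 * ∑ x, ∑ y, A x y * g x * g y) := by
        have e1 : ∑ x, ∑ y, A y x * g x * g y = ∑ x, ∑ y, A x y * g x * g y := by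
          rw [Finset.sum_comm]
          refine Finset.sum_congr rfl fun x _ => Finset.sum_congr rfl fun y _ => by ring
        calc ∑ x, ∑ y, (s • B) x y * g x * g y
            = s * (∑ x, ∑ y, A x y * g x * g y + ∑ x, ∑ y, A y x * g x * g y) := by
              rw [← Finset.sum_add_distrib, Finset.mul_sum]
              refine Finset.sum_congr rfl fun x _ => ?_
              rw [← Finset.sum_add_distrib, Finset.mul_sum]
              refine Finset.sum_congr rfl fun y _ => ?_
              simp only [hB, Matrix.smul_apply, Matrix.add_apply, Matrix.transpose_apply,
                smul_eq_mul]
              ring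
          _ = _ := by rw [e1]; ring
      rw [e]
      have := hA g hg
      positivity
    · have e : ∑ x, ∑ y, |(s • B) x y| = s * ∑ x, ∑ y, |B x y| := by
        simp only [Matrix.smul_apply, smul_eq_mul, abs_mul, abs_of_pos hs, Finset.mul_sum]
      rw [e, inv_mul_le_one₀ (by positivity)]
      linarith
  have h3 := h2 _ hsB
  have e : ∑ x : U, ∑ y : U, (s • B) x y * f (x - y) =
      s * (2 * ∑ x : U, ∑ y : U, A x y * f (x - y)) := by
    have e1 : ∑ x : U, ∑ y : U, A y x * f (x - y) = ∑ x : U, ∑ y : U, A x y * f (x - y) := by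
      rw [Finset.sum_comm]
      refine Finset.sum_congr rfl fun x _ => Finset.sum_congr rfl fun y _ => ?_
      have h4 : f (y - x) = f (x - y) := by rw [← neg_sub]; exact radialTransform_neg α _
      rw [h4]
    calc ∑ x : U, ∑ y : U, (s • B) x y * f (x - y)
        = s * (∑ x : U, ∑ y : U, A x y * f (x - y) + ∑ x : U, ∑ y : U, A y x * f (x - y)) := by
          rw [← Finset.sum_add_distrib, Finset.mul_sum]
          refine Finset.sum_congr rfl fun x _ => ?_
          rw [← Finset.sum_add_distrib, Finset.mul_sum]
          refine Finset.sum_congr rfl fun y _ => ?_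
          simp only [hB, Matrix.smul_apply, Matrix.add_apply, Matrix.transpose_apply, smul_eq_mul]
          ring
      _ = _ := by rw [e1]; ring
  rw [e] at h3
  have := (mul_nonneg_iff_of_pos_left hs).1 h3
  linarith

/-! ### From finite sets of points to kernels -/

lemma integral_mul_comp_fintype {Ω ι : Type*} [MeasurableSpace Ω] [Fintype ι] [MeasurableSpace ι]
    [MeasurableSingletonClass ι] (μ : Measure Ω) {k : Ω → ℝ} (hk : Integrable k μ) {Ψ : Ω → ι}
    (hΨ : Measurable Ψ) (G : ι → ℝ) :
    ∫ ω, k ω * G (Ψ ω) ∂μ = ∑ i, (∫ ω in Ψ ⁻¹' {i}, k ω ∂μ) * G i := by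
  classical
  have hm : ∀ i, MeasurableSet (Ψ ⁻¹' {i}) := fun i => hΨ (measurableSet_singleton i)
  have h1 : ∀ ω, k ω * G (Ψ ω) = ∑ i, (Ψ ⁻¹' {i}).indicator k ω * G i := by
    intro ω
    rw [Finset.sum_eq_single (Ψ ω)]
    · simp
    · intro i _ hi
      have hω : ω ∉ Ψ ⁻¹' {i} := fun h => hi (Set.mem_singleton_iff.1 h).symm
      rw [Set.indicator_of_notMem hω, zero_mul]
    · simp
  simp_rw [h1]
  rw [integral_finsetSum _ fun i _ => (hk.indicator (hm i)).mul_const _]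
  refine Finset.sum_congr rfl fun i _ => ?_
  rw [integral_mul_const, integral_indicator (hm i)]

lemma exists_rational_denseRange (n : ℕ) :
    ∃ e : ℕ → Eucl n, DenseRange e ∧ ∀ k i, ∃ q : ℚ, e k i = q := by
  obtain ⟨q, hq⟩ := exists_surjective_nat (Fin n → ℚ)
  refine ⟨fun k => WithLp.toLp 2 fun i => (q k i : ℝ), ?_, fun k i => ⟨q k i, rfl⟩⟩
  have h1 : DenseRange fun (v : Fin n → ℚ) (i : Fin n) => ((v i : ℚ) : ℝ) :=
    DenseRange.piMap (f := fun (_ : Fin n) (x : ℚ) => (x : ℝ)) fun _ => Rat.denseRange_cast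
  have h2 : DenseRange (WithLp.toLp 2 : (Fin n → ℝ) → Eucl n) :=
    (WithLp.toLp_surjective 2).denseRange
  have h3 := (h2.comp h1 (PiLp.continuous_toLp 2 _)).comp hq.denseRange
    ((PiLp.continuous_toLp 2 _).comp (continuous_pi fun i =>
      Rat.continuous_coe_real.comp (continuous_apply i)))
  exact h3

/-- Round every point to the nearest of finitely many rational points. The kernel, with c times the
diagonal, becomes a matrix of cell masses, copositive because `hg` may be tested on functions
constant on cells. Positivity of f applies to it, and refining the cells gives the claim by
dominated convergence. -/
lemma kernel_nonneg {n : ℕ} {f : Eucl n → ℝ} (hf : Continuous f) (hf1 : ∀ z, |f z| ≤ 1)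
    (hpos : IsPointwisePositive f) (μ : Measure (Eucl n)) [IsFiniteMeasure μ] (c : ℝ)
    {k : Eucl n × Eucl n → ℝ} (hk : Integrable k (μ.prod μ))
    (hg : ∀ g : Eucl n → ℝ, Measurable g → (∀ x, 0 ≤ g x) → (∃ C, ∀ x, g x ≤ C) →
      0 ≤ c * ∫ x, g x ^ 2 ∂μ + ∫ p, k p * (g p.1 * g p.2) ∂μ.prod μ) :
    0 ≤ c * (μ.real Set.univ * f 0) + ∫ p, k p * f (p.1 - p.2) ∂μ.prod μ := by
  obtain ⟨e, he, heq⟩ := exists_rational_denseRange n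
  have hstep : ∀ N, 0 ≤ c * (μ.real Set.univ * f 0) + ∫ p, k p *
      f (SimpleFunc.nearestPt e N p.1 - SimpleFunc.nearestPt e N p.2) ∂μ.prod μ := by
    intro N
    set φ := SimpleFunc.nearestPt e N
    set U : Finset (Eucl n) := φ.range
    have hU : U.Nonempty := ⟨φ 0, SimpleFunc.mem_range_self _ _⟩
    have hUq : ∀ x ∈ U, ∀ i, ∃ q : ℚ, x i = q := by
      intro x hx
      obtain ⟨y, rfl⟩ := SimpleFunc.mem_range.1 hx
      exact heq (SimpleFunc.nearestPtInd e N y)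
    let ψ : Eucl n → U := fun x => ⟨φ x, SimpleFunc.mem_range_self _ _⟩
    have hψ : Measurable ψ := φ.measurable.subtype_mk
    let Ψ : Eucl n × Eucl n → U × U := fun p => (ψ p.1, ψ p.2)
    have hΨ : Measurable Ψ := (hψ.comp measurable_fst).prodMk (hψ.comp measurable_snd)
    classical
    let A : Matrix U U ℝ := fun x y =>
      (if x = y then c * μ.real (ψ ⁻¹' {x}) else 0) + ∫ p in Ψ ⁻¹' {(x, y)}, k p ∂μ.prod μ
    have key : ∀ F : U → U → ℝ, ∑ x, ∑ y, A x y * F x y =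
        c * ∫ q, F (ψ q) (ψ q) ∂μ + ∫ p, k p * F (ψ p.1) (ψ p.2) ∂μ.prod μ := by
      intro F
      have h1 := integral_mul_comp_fintype μ (integrable_const (1 : ℝ)) hψ fun x => F x x
      have h2 := integral_mul_comp_fintype (μ.prod μ) hk hΨ fun z => F z.1 z.2
      simp only [one_mul] at h1
      rw [h1, show (∫ p, k p * F (ψ p.1) (ψ p.2) ∂μ.prod μ) = _ from h2, Fintype.sum_prod_type,
        Finset.mul_sum, ← Finset.sum_add_distrib]
      refine Finset.sum_congr rfl fun x _ => ?_
      simp only [A, add_mul, Finset.sum_add_distrib, ite_mul, zero_mul]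
      simp [mul_assoc]
    have h3 := hpos U hU hUq A fun g hg0 => by
      have h4 := key fun x y => g x * g y
      simp only [← mul_assoc] at h4
      rw [h4]
      have h5 := hg (fun q => g (ψ q)) ((measurable_of_countable g).comp hψ) (fun q => hg0 _)
        ⟨∑ x, g x, fun q => Finset.single_le_sum (fun x _ => hg0 x) (Finset.mem_univ _)⟩
      simpa only [sq, mul_assoc] using h5
    have h6 := key fun x y => f (x - y)
    rw [h6] at h3
    simpa [ψ] using h3
  have hlim : Tendsto (fun N => c * (μ.real Set.univ * f 0) + ∫ p, k p *
      f (SimpleFunc.nearestPt e N p.1 - SimpleFunc.nearestPt e N p.2) ∂μ.prod μ) atTop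
      (𝓝 (c * (μ.real Set.univ * f 0) + ∫ p, k p * f (p.1 - p.2) ∂μ.prod μ)) := by
    refine tendsto_const_nhds.add ?_
    refine tendsto_integral_of_dominated_convergence (fun p => ‖k p‖) (fun N => ?_) hk.norm
      (fun N => ae_of_all _ fun p => ?_) (ae_of_all _ fun p => ?_)
    · have hm : Measurable fun p : Eucl n × Eucl n =>
          f (SimpleFunc.nearestPt e N p.1 - SimpleFunc.nearestPt e N p.2) :=
        hf.measurable.comp (((SimpleFunc.measurable _).comp measurable_fst).sub
          ((SimpleFunc.measurable _).comp measurable_snd))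
      exact hk.aestronglyMeasurable.mul hm.aestronglyMeasurable
    · rw [norm_mul]
      exact mul_le_of_le_one_right (norm_nonneg _) (hf1 _)
    · refine tendsto_const_nhds.mul ((hf.tendsto _).comp ?_)
      have hd : ∀ x, x ∈ closure (Set.range e) := fun x => he x
      exact (SimpleFunc.tendsto_nearestPt (hd _)).sub (SimpleFunc.tendsto_nearestPt (hd _))
  exact ge_of_tendsto' hlim hstep

/-! ### Weak limits in `L²` -/

/-- Sequential Banach–Alaoglu in the dual, carried back to H by the Riesz isometry. -/
lemma exists_weak_subseq_limit {H : Type*} [NormedAddCommGroup H] [InnerProductSpace ℝ H]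
    [CompleteSpace H] [TopologicalSpace.SeparableSpace H] {v : ℕ → H} {R : ℝ}
    (hv : ∀ k, ‖v k‖ ≤ R) :
    ∃ (w : H) (φ : ℕ → ℕ), StrictMono φ ∧ ‖w‖ ≤ R ∧
      ∀ h, Tendsto (fun k => ⟪v (φ k), h⟫) atTop (𝓝 ⟪w, h⟫) := by
  let D : ℕ → WeakDual ℝ H := fun k =>
    StrongDual.toWeakDual (𝕜 := ℝ) (E := H) (InnerProductSpace.toDual ℝ H (v k))
  have hD : ∀ k, D k ∈ (WeakDual.toStrongDual (𝕜 := ℝ) (E := H)) ⁻¹'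
      Metric.closedBall (0 : StrongDual ℝ H) R := by
    intro k
    have h1 : ‖InnerProductSpace.toDual ℝ H (v k)‖ ≤ R :=
      (LinearIsometryEquiv.norm_map _ _).le.trans (hv k)
    have h2 := mem_closedBall_zero_iff.2 h1
    exact h2
  obtain ⟨L, hL, φ, hφ, hlim⟩ := (WeakDual.isSeqCompact_closedBall ℝ H 0 R) hD
  refine ⟨(InnerProductSpace.toDual ℝ H).symm (WeakDual.toStrongDual L), φ, hφ, ?_, fun h => ?_⟩
  · rw [LinearIsometryEquiv.norm_map]
    simpa using hL
  · have h1 := ((WeakDual.eval_continuous h).tendsto L).comp hlim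
    rw [InnerProductSpace.toDual_symm_apply]
    exact h1

section WeakLimits

variable {Ω : Type*} [MeasurableSpace Ω]

lemma memLp_two_of_bounded {μ : Measure Ω} [IsFiniteMeasure μ] {h : Ω → ℝ} (hm : Measurable h)
    {C : ℝ} (hC : ∀ x, |h x| ≤ C) : MemLp h 2 μ :=
  MemLp.of_bound hm.aestronglyMeasurable C (ae_of_all _ hC)

lemma inner_toLp {μ : Measure Ω} {g h : Ω → ℝ} (hg : MemLp g 2 μ) (hh : MemLp h 2 μ) :
    ⟪hg.toLp, hh.toLp⟫ = ∫ x, g x * h x ∂μ := by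
  rw [L2.inner_def]
  refine integral_congr_ae ?_
  filter_upwards [hg.coeFn_toLp, hh.coeFn_toLp] with x h1 h2
  rw [h1, h2]
  simp [mul_comm]

lemma exists_weak_limit {μ : Measure Ω} [IsFiniteMeasure μ]
    [TopologicalSpace.SeparableSpace (Lp ℝ 2 μ)] {g : ℕ → Ω → ℝ} (hg : ∀ k, MemLp (g k) 2 μ)
    (hg0 : ∀ k x, 0 ≤ g k x) {C : ℝ} (hC : ∀ k, ∫ x, g k x ^ 2 ∂μ ≤ C) :
    ∃ (G : Ω → ℝ) (φ : ℕ → ℕ), StrictMono φ ∧ Measurable G ∧ (∀ x, 0 ≤ G x) ∧ MemLp G 2 μ ∧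
      ∫ x, G x ^ 2 ∂μ ≤ C ∧ ∀ h, MemLp h 2 μ →
        Tendsto (fun k => ∫ x, g (φ k) x * h x ∂μ) atTop (𝓝 (∫ x, G x * h x ∂μ)) := by
  have hsq : ∀ k, ‖(hg k).toLp‖ ^ 2 ≤ C := by
    intro k
    rw [← real_inner_self_eq_norm_sq, inner_toLp]
    simpa only [sq] using hC k
  have hC0 : 0 ≤ C := (sq_nonneg _).trans (hsq 0)
  obtain ⟨w, φ, hφ, hw, hlim⟩ := exists_weak_subseq_limit (v := fun k => (hg k).toLp) (R := √C)
    fun k => Real.le_sqrt_of_sq_le (hsq k)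
  have hwm : MemLp w 2 μ := Lp.memLp w
  have hlim' : ∀ h, MemLp h 2 μ →
      Tendsto (fun k => ∫ x, g (φ k) x * h x ∂μ) atTop (𝓝 (∫ x, w x * h x ∂μ)) := by
    intro h hh
    have h1 := hlim hh.toLp
    have h2 : ⟪w, hh.toLp⟫ = ∫ x, w x * h x ∂μ := by
      rw [← inner_toLp hwm hh, Lp.toLp_coeFn]
    simp only [inner_toLp] at h1
    rwa [h2] at h1
  have hw0 : 0 ≤ᵐ[μ] w := by
    -- Testing against indicators preserves nonnegativity almost everywhere; replacing w by max(w,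
    -- 0) afterwards makes it hold pointwise.
    refine ae_nonneg_of_forall_setIntegral_nonneg (hwm.integrable (by norm_num)) fun s hs _ => ?_
    have hind : MemLp (s.indicator fun _ => (1 : ℝ)) 2 μ :=
      memLp_indicator_const 2 hs 1 (Or.inr (measure_ne_top _ _))
    have h1 := hlim' _ hind
    have h2 : ∫ x, w x * s.indicator (fun _ => (1 : ℝ)) x ∂μ = ∫ x in s, w x ∂μ := by
      rw [← integral_indicator hs]
      refine integral_congr_ae (ae_of_all _ fun x => ?_)
      by_cases hx : x ∈ s <;> simp [hx]
    rw [h2] at h1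
    refine ge_of_tendsto' h1 fun k => integral_nonneg fun x => mul_nonneg (hg0 _ _) ?_
    exact Set.indicator_nonneg (fun _ _ => zero_le_one) _
  have hae : (fun x => max (w x) 0) =ᵐ[μ] w := by
    filter_upwards [hw0] with x h1
    exact max_eq_left h1
  refine ⟨_, φ, hφ, (Lp.stronglyMeasurable w).measurable.max measurable_const,
    fun x => le_max_right _ _, hwm.ae_eq hae.symm, ?_, fun h hh => ?_⟩
  · have h1 : ∫ x, w x ^ 2 ∂μ = ‖w‖ ^ 2 := by
      rw [← real_inner_self_eq_norm_sq, L2.inner_def]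
      refine integral_congr_ae (ae_of_all _ fun x => ?_)
      simp [sq]
    have h2 : ‖w‖ ^ 2 ≤ C := by
      have := Real.sq_sqrt hC0
      have h3 := norm_nonneg w
      nlinarith
    rw [← h1] at h2
    refine le_trans (le_of_eq (integral_congr_ae ?_)) h2
    filter_upwards [hae] with x hx
    rw [hx]
  · have h1 : ∫ x, w x * h x ∂μ = _ := integral_congr_ae (by
      filter_upwards [hae] with x hx
      rw [← hx])
    rw [← h1]
    exact hlim' h hh

/-- Cauchy–Schwarz in its weighted arithmetic–geometric form; the free weight t spares square roots
later. -/
lemma integral_mul_le_of_sq {μ : Measure Ω} {g h : Ω → ℝ} (hg : MemLp g 2 μ) (hh : MemLp h 2 μ)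
    {t : ℝ} (ht : 0 < t) :
    |∫ x, g x * h x ∂μ| ≤ t / 2 * ∫ x, g x ^ 2 ∂μ + 1 / (2 * t) * ∫ x, h x ^ 2 ∂μ := by
  rw [← integral_const_mul, ← integral_const_mul, ← integral_add (hg.integrable_sq.const_mul _)
    (hh.integrable_sq.const_mul _)]
  refine abs_integral_le_integral_abs.trans (integral_mono (hg.integrable_mul hh).abs
    ((hg.integrable_sq.const_mul _).add (hh.integrable_sq.const_mul _)) fun x => ?_)
  have h1 : t / 2 * g x ^ 2 + 1 / (2 * t) * h x ^ 2 - |g x| * |h x| =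
      1 / (2 * t) * (t * |g x| - |h x|) ^ 2 := by
    rw [← sq_abs (g x), ← sq_abs (h x)]; field_simp; ring
  have h2 : 0 ≤ 1 / (2 * t) * (t * |g x| - |h x|) ^ 2 := by positivity
  simp only [abs_mul]
  linarith

/-- A quadratic form with a bounded kernel is weakly continuous along bounded sequences. -/
lemma tendsto_kernel_of_weak {μ : Measure Ω} [IsFiniteMeasure μ] {g : ℕ → Ω → ℝ}
    (hgm : ∀ k, Measurable (g k)) (hg : ∀ k, MemLp (g k) 2 μ) {C : ℝ}
    (hC : ∀ k, ∫ x, g k x ^ 2 ∂μ ≤ C) {G : Ω → ℝ} (hGm : Measurable G) (hG : MemLp G 2 μ)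
    (hlim : ∀ h, MemLp h 2 μ →
      Tendsto (fun k => ∫ x, g k x * h x ∂μ) atTop (𝓝 (∫ x, G x * h x ∂μ)))
    {p : Ω × Ω → ℝ} (hp : Measurable p) {K : ℝ} (hK : ∀ q, |p q| ≤ K) :
    Tendsto (fun k => ∫ q, p q * (g k q.1 * g k q.2) ∂μ.prod μ) atTop
      (𝓝 (∫ q, p q * (G q.1 * G q.2) ∂μ.prod μ)) := by
  have hprod : ∀ u : Ω → ℝ, Measurable u → MemLp u 2 μ →
      ∫ q, p q * (u q.1 * u q.2) ∂μ.prod μ = ∫ x, u x * ∫ y, u y * p (x, y) ∂μ ∂μ := by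
    intro u hum hu
    have hu1 : Integrable u μ := hu.integrable (by norm_num)
    have hi : Integrable (fun q : Ω × Ω => p q * (u q.1 * u q.2)) (μ.prod μ) :=
      (hu1.mul_prod hu1).bdd_mul hp.aestronglyMeasurable (ae_of_all _ hK)
    rw [integral_prod _ hi]
    refine integral_congr_ae (ae_of_all _ fun x => ?_)
    simp only
    rw [← integral_const_mul]
    refine integral_congr_ae (ae_of_all _ fun y => ?_)
    ring
  simp_rw [hprod G hGm hG, hprod _ (hgm _) (hg _)]
  -- The integral operator is compact: weak convergence of g k gives pointwise convergence of `T (g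
  -- k)`, which is uniformly bounded, hence strong L² convergence. Weak against strong then passes
  -- to the limit.
  set T : (Ω → ℝ) → Ω → ℝ := fun u x => ∫ y, u y * p (x, y) ∂μ
  have hTm : ∀ u, Measurable u → Measurable (T u) := by
    intro u hu
    refine StronglyMeasurable.measurable ?_
    exact StronglyMeasurable.integral_prod_right' (f := fun q : Ω × Ω => u q.2 * p q)
      ((hu.comp measurable_snd).mul hp).stronglyMeasurable
  have hpx : ∀ x, MemLp (fun y => p (x, y)) 2 μ := fun x =>
    memLp_two_of_bounded (hp.comp (measurable_const.prodMk measurable_id)) fun y => hK (x, y)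
  have hpsq : ∀ x, ∫ y, p (x, y) ^ 2 ∂μ ≤ ∫ _, K ^ 2 ∂μ := fun x =>
    integral_mono (hpx x).integrable_sq (integrable_const _) fun y =>
      sq_le_sq' (by have := abs_le.1 (hK (x, y)); linarith) (abs_le.1 (hK (x, y))).2
  have hTbound : ∀ u, MemLp u 2 μ → ∀ D, ∫ x, u x ^ 2 ∂μ ≤ D → ∀ x,
      |T u x| ≤ 1 / 2 * D + 1 / 2 * ∫ _, K ^ 2 ∂μ := by
    intro u hu D hD x
    have h1 := integral_mul_le_of_sq hu (hpx x) one_pos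
    have h2 := hpsq x
    simp only [T]
    linarith
  have hTG : MemLp (T G) 2 μ := memLp_two_of_bounded (hTm G hGm) (hTbound G hG _ le_rfl)
  have hTg : ∀ k, MemLp (T (g k)) 2 μ := fun k =>
    memLp_two_of_bounded (hTm _ (hgm k)) (hTbound _ (hg k) _ (hC k))
  have hd : ∀ k, MemLp (fun x => T (g k) x - T G x) 2 μ := fun k => (hTg k).sub hTG
  have hdlim : Tendsto (fun k => ∫ x, (T (g k) x - T G x) ^ 2 ∂μ) atTop (𝓝 0) := by
    rw [show (0 : ℝ) = ∫ x, (0 : ℝ) ∂μ by simp]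
    set M : ℝ := (1 / 2 * C + 1 / 2 * ∫ _, K ^ 2 ∂μ) +
      (1 / 2 * ∫ x, G x ^ 2 ∂μ + 1 / 2 * ∫ _, K ^ 2 ∂μ)
    refine tendsto_integral_of_dominated_convergence (fun _ => M ^ 2)
      (fun k => (hd k).integrable_sq.aestronglyMeasurable) (integrable_const _)
      (fun k => ae_of_all _ fun x => ?_) (ae_of_all _ fun x => ?_)
    · rw [norm_pow, Real.norm_eq_abs]
      refine pow_le_pow_left₀ (abs_nonneg _) ((abs_sub _ _).trans ?_) 2
      exact add_le_add (hTbound _ (hg k) _ (hC k) x) (hTbound G hG _ le_rfl x)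
    · have h1 := ((hlim _ (hpx x)).sub_const (T G x)).pow 2
      simpa [T] using h1
  have hsplit : ∀ k, ∫ x, g k x * T (g k) x ∂μ =
      ∫ x, g k x * T G x ∂μ + ∫ x, g k x * (T (g k) x - T G x) ∂μ := by
    intro k
    have i1 : Integrable (fun x => g k x * T G x) μ := (hg k).integrable_mul hTG
    have i2 : Integrable (fun x => g k x * (T (g k) x - T G x)) μ := (hg k).integrable_mul (hd k)
    rw [← integral_add i1 i2]
    refine integral_congr_ae (ae_of_all _ fun x => ?_)
    ring
  have hrem : Tendsto (fun k => ∫ x, g k x * (T (g k) x - T G x) ∂μ) atTop (𝓝 0) := by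
    rw [Metric.tendsto_atTop]
    intro ε hε
    have hCpos : 0 < |C| + 1 := by positivity
    set t : ℝ := ε / (|C| + 1) with ht
    have ht0 : 0 < t := by positivity
    obtain ⟨N, hN⟩ := Metric.tendsto_atTop.1 hdlim (t * ε) (by positivity)
    refine ⟨N, fun k hk => ?_⟩
    have h1 := integral_mul_le_of_sq (hg k) (hd k) ht0
    have h2 := hN k hk
    rw [Real.dist_0_eq_abs] at h2 ⊢
    have h3 := (le_abs_self _).trans_lt h2
    have h4 : t / 2 * ∫ x, g k x ^ 2 ∂μ ≤ ε / 2 := by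
      calc t / 2 * ∫ x, g k x ^ 2 ∂μ ≤ t / 2 * (|C| + 1) := by
            gcongr
            exact (hC k).trans ((le_abs_self C).trans (by linarith))
        _ = ε / 2 := by rw [ht]; field_simp
    have h5 : 1 / (2 * t) * ∫ x, (T (g k) x - T G x) ^ 2 ∂μ < ε / 2 := by
      calc 1 / (2 * t) * ∫ x, (T (g k) x - T G x) ^ 2 ∂μ < 1 / (2 * t) * (t * ε) := by gcongr
        _ = ε / 2 := by field_simp
    linarith
  have := (hlim _ hTG).add hrem
  rw [add_zero] at this
  exact this.congr fun k => (hsplit k).symm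

end WeakLimits

/-! ### Lebesgue differentiation and independent sets -/

/-- By Lebesgue differentiation the averages over balls shrinking to x + ξ converge to u(x + ξ) for
almost every x; Fatou then bounds the integral of u(x)u(x + ξ) by lim a = 0. -/
lemma ae_mul_translate_eq_zero {n : ℕ} {u : Eucl n → ℝ≥0∞} (hu : Measurable u)
    (hu1 : ∫⁻ x, u x ≠ ∞) (ξ : Eucl n) {s : ℕ → ℝ} (hs : ∀ m, 0 < s m)
    (hs0 : Tendsto s atTop (𝓝 0)) {a : ℕ → ℝ≥0∞} (ha : Tendsto a atTop (𝓝 0))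
    (hbound : ∀ m, ∫⁻ x, u x * ((∫⁻ y in Metric.closedBall (x + ξ) (s m), u y) /
      volume (Metric.closedBall (x + ξ) (s m))) ≤ a m) :
    ∀ᵐ x, u x * u (x + ξ) = 0 := by
  set A : ℕ → Eucl n → ℝ≥0∞ := fun m x => (∫⁻ y in Metric.closedBall (x + ξ) (s m), u y) /
      volume (Metric.closedBall (x + ξ) (s m))
  have hA : ∀ m, Measurable (A m) := by
    intro m
    have h1 : A m = fun x => (∫⁻ y, {q : Eucl n × Eucl n | dist q.2 (q.1 + ξ) ≤ s m}.indicator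
        (fun q => u q.2) (x, y)) / volume (Metric.closedBall (0 : Eucl n) (s m)) := by
      ext x
      simp only [A]
      rw [← lintegral_indicator Metric.isClosed_closedBall.measurableSet,
        Measure.addHaar_closedBall_center]
      rfl
    rw [h1]
    refine Measurable.div_const ?_ _
    refine Measurable.lintegral_prod_right' ?_
    refine (hu.comp measurable_snd).indicator ?_
    exact measurableSet_le (by fun_prop) measurable_const
  have hleb : ∀ᵐ z, Tendsto (fun m => (∫⁻ y in Metric.closedBall z (s m), u y) /
      volume (Metric.closedBall z (s m))) atTop (𝓝 (u z)) := by
    filter_upwards [(Besicovitch.vitaliFamily (volume : Measure (Eucl n))).ae_tendsto_lintegral_div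
      hu.aemeasurable hu1] with z hz
    refine hz.comp ((Besicovitch.tendsto_filterAt volume z).comp ?_)
    exact tendsto_nhdsWithin_iff.2 ⟨hs0, Eventually.of_forall hs⟩
  have hleb' : ∀ᵐ x, Tendsto (fun m => A m x) atTop (𝓝 (u (x + ξ))) :=
    (measurePreserving_add_right volume ξ).quasiMeasurePreserving.ae hleb
  have hfin : ∀ᵐ x, u x < ∞ := ae_lt_top hu hu1
  have hm : Measurable fun x => u x * u (x + ξ) :=
    hu.mul (hu.comp (measurable_add_const ξ))
  refine (lintegral_eq_zero_iff' hm.aemeasurable).1 ?_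
  rw [← nonpos_iff_eq_zero]
  have h1 : ∫⁻ x, u x * u (x + ξ) = ∫⁻ x, liminf (fun m => u x * A m x) atTop := by
    refine lintegral_congr_ae ?_
    filter_upwards [hleb', hfin] with x hx hx'
    exact (ENNReal.Tendsto.const_mul hx (Or.inr hx'.ne)).liminf_eq.symm
  rw [h1]
  refine (lintegral_liminf_le fun m => hu.mul (hA m)).trans ?_
  rw [← ha.liminf_eq]
  exact liminf_le_liminf (Eventually.of_forall hbound)

lemma exists_dense_scale {n : ℕ} {S : Set (Eucl n)} {x₀ : Eucl n}
    (h : Tendsto (fun r => volume (S ∩ Metric.closedBall x₀ r) / volume (Metric.closedBall x₀ r))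
      (𝓝[>] 0) (𝓝 1)) :
    ∀ᶠ r in 𝓝[>] (0 : ℝ), 3 / 4 * (volume.real (Metric.closedBall (0 : Eucl n) r)) <
      volume.real (S ∩ Metric.closedBall x₀ r) := by
  have h34 : ENNReal.ofReal (3 / 4) < 1 := by
    rw [← ENNReal.ofReal_one]; exact (ENNReal.ofReal_lt_ofReal_iff one_pos).2 (by norm_num)
  filter_upwards [h.eventually (lt_mem_nhds h34), self_mem_nhdsWithin] with r hr hr0
  have hr0' : (0 : ℝ) < r := hr0
  have hpos : volume (Metric.closedBall x₀ r) ≠ 0 :=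
    (Metric.measure_closedBall_pos volume x₀ hr0').ne'
  have hfin : volume (Metric.closedBall x₀ r) ≠ ∞ := measure_closedBall_lt_top.ne
  rw [ENNReal.lt_div_iff_mul_lt (Or.inl hpos) (Or.inl hfin),
    Measure.addHaar_closedBall_center] at hr
  have h2 := (ENNReal.toReal_lt_toReal (ENNReal.mul_ne_top ENNReal.ofReal_ne_top
    measure_closedBall_lt_top.ne) (measure_ne_top_of_subset Set.inter_subset_right hfin)).2 hr
  rwa [ENNReal.toReal_mul, ENNReal.toReal_ofReal (by norm_num)] at h2

/-- Keep only density points. If two were at distance 1, S would fill over 3/4 of a small ball at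
each. Shifting one ball by some ξ i close to their difference puts both pieces in a ball of less
than 3/2 the volume, so they overlap in positive measure, against `hSξ`. -/
lemma exists_independent_subset {n : ℕ} {S : Set (Eucl n)} (hS : MeasurableSet S)
    {ξ : ℕ → Eucl n} (hξ : ∀ z : Eucl n, ‖z‖ = 1 → z ∈ closure (Set.range ξ))
    (hSξ : ∀ i, ∀ᵐ x, ¬ (x ∈ S ∧ x + ξ i ∈ S)) :
    ∃ I ⊆ S, MeasurableSet I ∧ volume I = volume S ∧ ∀ x ∈ I, ∀ y ∈ I, ‖x - y‖ ≠ 1 := by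
  have hdens := Besicovitch.ae_tendsto_measure_inter_div_of_measurableSet volume hS
  set D : Set (Eucl n) := {x | Tendsto (fun r => volume (S ∩ Metric.closedBall x r) /
    volume (Metric.closedBall x r)) (𝓝[>] 0) (𝓝 (S.indicator 1 x))}
  have hD : volume Dᶜ = 0 := hdens
  refine ⟨S \ toMeasurable volume Dᶜ, Set.sdiff_subset, hS.diff (measurableSet_toMeasurable _ _),
    measure_sdiff_null (by rw [measure_toMeasurable, hD]), ?_⟩
  intro x₀ hx₀ y₀ hy₀ hxy
  have hdense : ∀ x ∈ S \ toMeasurable volume Dᶜ, Tendsto (fun r =>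
      volume (S ∩ Metric.closedBall x r) / volume (Metric.closedBall x r)) (𝓝[>] 0) (𝓝 1) := by
    intro x hx
    have hxD : x ∈ D := by
      by_contra h
      exact hx.2 (subset_toMeasurable _ _ h)
    have h2 : S.indicator (1 : Eucl n → ℝ≥0∞) x = 1 := by simp [hx.1]
    have h3 : Tendsto _ _ (𝓝 (S.indicator 1 x)) := hxD
    rwa [h2] at h3
  obtain ⟨s, hsx, hsy, hs⟩ := ((exists_dense_scale (hdense x₀ hx₀)).and
    ((exists_dense_scale (hdense y₀ hy₀)).and self_mem_nhdsWithin)).exists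
  have hs0 : (0 : ℝ) < s := hs
  have hρ : ∃ ρ > 0, (s + ρ) ^ n < 3 / 2 * s ^ n := by
    have h1 : Tendsto (fun ρ : ℝ => (s + ρ) ^ n) (𝓝[>] 0) (𝓝 (s ^ n)) := by
      have : Continuous fun ρ : ℝ => (s + ρ) ^ n := by fun_prop
      have h2 := this.tendsto 0
      rw [add_zero] at h2
      exact h2.mono_left nhdsWithin_le_nhds
    have h3 : s ^ n < 3 / 2 * s ^ n := by
      have : 0 < s ^ n := by positivity
      linarith
    obtain ⟨ρ, h4, h5⟩ := ((h1.eventually (gt_mem_nhds h3)).and self_mem_nhdsWithin).exists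
    exact ⟨ρ, h5, h4⟩
  obtain ⟨ρ, hρ0, hρ⟩ := hρ
  have hz : ‖y₀ - x₀‖ = 1 := by rw [norm_sub_rev]; exact hxy
  obtain ⟨_, ⟨i, rfl⟩, hi⟩ := Metric.mem_closure_iff.1 (hξ _ hz) ρ hρ0
  set A₁ := S ∩ Metric.closedBall x₀ s
  set A₂ := (fun x => x + ξ i) ⁻¹' (S ∩ Metric.closedBall y₀ s)
  have hA₂m : MeasurableSet A₂ :=
    (measurable_add_const (ξ i)) (hS.inter Metric.isClosed_closedBall.measurableSet)
  have hA₂ : volume.real A₂ = volume.real (S ∩ Metric.closedBall y₀ s) := by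
    simp only [measureReal_def, A₂, measure_preimage_add_right]
  have hnull : volume (A₁ ∩ A₂) = 0 := by
    have h0 : volume {x | ¬ ¬ (x ∈ S ∧ x + ξ i ∈ S)} = 0 := hSξ i
    refine measure_mono_null (fun x hx => ?_) h0
    exact not_not.2 ⟨hx.1.1, hx.2.1⟩
  have hsub : A₁ ∪ A₂ ⊆ Metric.closedBall x₀ (s + ρ) := by
    rintro x (hx | hx)
    · exact Metric.closedBall_subset_closedBall (by linarith) hx.2
    · have h1 : dist (x + ξ i) y₀ ≤ s := hx.2
      rw [Metric.mem_closedBall, dist_eq_norm]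
      rw [dist_eq_norm] at h1 hi
      calc ‖x - x₀‖ = ‖(x + ξ i - y₀) + (y₀ - x₀ - ξ i)‖ := by congr 1; abel
        _ ≤ s + ρ := (norm_add_le _ _).trans (add_le_add h1 hi.le)
  have hfin : volume (Metric.closedBall x₀ (s + ρ)) ≠ ∞ := measure_closedBall_lt_top.ne
  have hA₁fin : volume A₁ ≠ ∞ := measure_ne_top_of_subset (Set.subset_union_left.trans hsub) hfin
  have hA₂fin : volume A₂ ≠ ∞ := measure_ne_top_of_subset (Set.subset_union_right.trans hsub) hfin
  have h1 : volume.real A₁ + volume.real A₂ ≤ volume.real (Metric.closedBall x₀ (s + ρ)) := by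
    have h2 := measureReal_union_add_inter (μ := volume) (s := A₁) hA₂m hA₁fin hA₂fin
    rw [show volume.real (A₁ ∩ A₂) = 0 by rw [measureReal_def, hnull]; rfl, add_zero] at h2
    rw [← h2]
    exact measureReal_mono hsub hfin
  have hball : ∀ (x : Eucl n) {r : ℝ}, 0 ≤ r → volume.real (Metric.closedBall x r) =
      r ^ n * volume.real (Metric.ball (0 : Eucl n) 1) := by
    intro x r hr
    rw [measureReal_def, Measure.addHaar_closedBall _ _ hr, ENNReal.toReal_mul,
      finrank_euclideanSpace_fin, ENNReal.toReal_ofReal (by positivity), measureReal_def]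
  have hv : 0 < volume.real (Metric.ball (0 : Eucl n) 1) := by
    rw [measureReal_def]
    exact ENNReal.toReal_pos (Metric.measure_ball_pos _ _ one_pos).ne' measure_ball_lt_top.ne
  rw [hball _ (by positivity), hA₂] at h1
  rw [hball _ hs0.le] at hsx hsy
  have h3 : 3 / 2 * s ^ n * volume.real (Metric.ball (0 : Eucl n) 1) <
      (s + ρ) ^ n * volume.real (Metric.ball (0 : Eucl n) 1) := by
    linarith
  exact absurd (lt_of_mul_lt_mul_right h3 hv.le) (not_lt.2 hρ.le)

/-! ### Positive functions on a bounded set -/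

/-- The kernel of the quadratic form `w ⨍_{|z - ξ| ≤ s} ∫ g(x) g(x + z) dx dz`. -/
noncomputable def shiftKernel {n : ℕ} (ξ : Eucl n) (s w : ℝ) (q : Eucl n × Eucl n) : ℝ :=
  w / volume.real (Metric.closedBall (0 : Eucl n) s) *
    {q : Eucl n × Eucl n | dist q.2 (q.1 + ξ) ≤ s}.indicator (fun _ => 1) q

lemma measurableSet_shift {n : ℕ} (ξ : Eucl n) (s : ℝ) :
    MeasurableSet {q : Eucl n × Eucl n | dist q.2 (q.1 + ξ) ≤ s} :=
  measurableSet_le (by fun_prop) measurable_const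

lemma measurable_shiftKernel {n : ℕ} (ξ : Eucl n) (s w : ℝ) : Measurable (shiftKernel ξ s w) :=
  (measurable_const.indicator (measurableSet_shift ξ s)).const_mul _

lemma shiftKernel_nonneg {n : ℕ} (ξ : Eucl n) (s : ℝ) {w : ℝ} (hw : 0 ≤ w)
    (q : Eucl n × Eucl n) : 0 ≤ shiftKernel ξ s w q :=
  mul_nonneg (div_nonneg hw measureReal_nonneg) (Set.indicator_nonneg (fun _ _ => zero_le_one) _)

lemma abs_shiftKernel_le {n : ℕ} (ξ : Eucl n) (s : ℝ) {w : ℝ} (hw : 0 ≤ w)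
    (q : Eucl n × Eucl n) :
    |shiftKernel ξ s w q| ≤ w / volume.real (Metric.closedBall (0 : Eucl n) s) := by
  rw [abs_of_nonneg (shiftKernel_nonneg ξ s hw q)]
  refine mul_le_of_le_one_right (div_nonneg hw measureReal_nonneg) ?_
  exact Set.indicator_apply_le' (fun _ => le_rfl) fun _ => zero_le_one

lemma integrable_shiftKernel {n : ℕ} (μ : Measure (Eucl n)) [IsFiniteMeasure μ] (ξ : Eucl n)
    (s : ℝ) {w : ℝ} (hw : 0 ≤ w) : Integrable (shiftKernel ξ s w) (μ.prod μ) :=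
  Integrable.of_bound (measurable_shiftKernel ξ s w).aestronglyMeasurable _
    (ae_of_all _ fun q => abs_shiftKernel_le ξ s hw q)

lemma volume_real_closedBall_pos {n : ℕ} {s : ℝ} (hs : 0 < s) :
    0 < volume.real (Metric.closedBall (0 : Eucl n) s) := by
  rw [measureReal_def]
  exact ENNReal.toReal_pos (Metric.measure_closedBall_pos _ _ hs).ne' measure_closedBall_lt_top.ne

lemma integral_shiftKernel_le {n : ℕ} (Q : Set (Eucl n)) [IsFiniteMeasure (volume.restrict Q)]
    (ξ : Eucl n) {s w : ℝ} (hs : 0 < s) (hw : 0 ≤ w) :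
    ∫ q, shiftKernel ξ s w q ∂(volume.restrict Q).prod (volume.restrict Q) ≤
      w * (volume.restrict Q).real Set.univ := by
  set μ := volume.restrict Q
  have hv := volume_real_closedBall_pos (n := n) hs
  rw [integral_prod _ (integrable_shiftKernel μ ξ s hw)]
  have h1 : ∀ x, ∫ y, shiftKernel ξ s w (x, y) ∂μ ≤ w := by
    intro x
    have h2 : ∀ y, shiftKernel ξ s w (x, y) =
        w / volume.real (Metric.closedBall (0 : Eucl n) s) *
          (Metric.closedBall (x + ξ) s).indicator (fun _ => 1) y := fun y => rfl
    simp_rw [h2]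
    rw [integral_const_mul, integral_indicator_const _ Metric.isClosed_closedBall.measurableSet,
      smul_eq_mul, mul_one, div_mul_eq_mul_div]
    refine div_le_of_le_mul₀ hv.le hw (mul_le_mul_of_nonneg_left ?_ hw)
    have h3 : volume (Metric.closedBall (x + ξ) s) = volume (Metric.closedBall (0 : Eucl n) s) :=
      Measure.addHaar_closedBall_center _ _ _
    rw [measureReal_def, measureReal_def, ← h3]
    exact ENNReal.toReal_mono measure_closedBall_lt_top.ne (Measure.restrict_le_self _)
  refine (integral_mono (integrable_shiftKernel μ ξ s hw).integral_prod_left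
    (integrable_const w) h1).trans (le_of_eq ?_)
  rw [integral_const, smul_eq_mul, mul_comm]

/-- The kernel sees only pairs whose difference is within s of ξ, where |f| ≤ η; its total mass is
at most w vol(Q). -/
lemma integral_shiftKernel_mul_le {n : ℕ} (Q : Set (Eucl n)) [IsFiniteMeasure (volume.restrict Q)]
    {f : Eucl n → ℝ} (hf : Continuous f) (hf1 : ∀ z, |f z| ≤ 1) (hf2 : ∀ z, f (-z) = f z)
    {ξ : Eucl n} {s w η : ℝ} (hs : 0 < s) (hw : 0 ≤ w) (hη : 0 ≤ η)
    (hfη : ∀ z ∈ Metric.closedBall ξ s, |f z| ≤ η) :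
    ∫ q, shiftKernel ξ s w q * f (q.1 - q.2) ∂(volume.restrict Q).prod (volume.restrict Q) ≤
      η * (w * (volume.restrict Q).real Set.univ) := by
  have hint := integrable_shiftKernel (volume.restrict Q) ξ s hw
  have h1 : ∀ q, shiftKernel ξ s w q * f (q.1 - q.2) ≤ η * shiftKernel ξ s w q := by
    intro q
    by_cases hq : dist q.2 (q.1 + ξ) ≤ s
    · rw [mul_comm]
      refine mul_le_mul_of_nonneg_right ?_ (shiftKernel_nonneg ξ s hw q)
      rw [← hf2]
      refine (le_abs_self _).trans (hfη _ ?_)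
      rw [Metric.mem_closedBall, dist_eq_norm]
      rw [dist_eq_norm] at hq
      convert hq using 2
      abel
    · have : shiftKernel ξ s w q = 0 := by
        rw [shiftKernel, Set.indicator_of_notMem (by exact hq), mul_zero]
      simp [this]
  have hint2 : Integrable (fun q : Eucl n × Eucl n => shiftKernel ξ s w q * f (q.1 - q.2))
      ((volume.restrict Q).prod (volume.restrict Q)) :=
    hint.mul_bdd (c := 1) (by fun_prop) (ae_of_all _ fun q => hf1 _)
  refine (integral_mono hint2 (hint.const_mul η) h1).trans ?_
  rw [integral_const_mul]
  exact mul_le_mul_of_nonneg_left (integral_shiftKernel_le Q ξ hs hw) hη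

/-- Rewrites a penalty as an average over shrinking balls, the form needed for Lebesgue
differentiation; the weight w turns the bound 1 into w⁻¹. -/
lemma lintegral_translate_le_of_shiftKernel {n : ℕ} {Q : Set (Eucl n)} (hQ : MeasurableSet Q)
    [IsFiniteMeasure (volume.restrict Q)] {G : Eucl n → ℝ} (hG : Measurable G) (hG0 : ∀ x, 0 ≤ G x)
    (hG2 : Integrable G (volume.restrict Q)) (ξ : Eucl n) {s w : ℝ} (hs : 0 < s) (hw : 0 < w)
    (h : ∫ q, shiftKernel ξ s w q * (G q.1 * G q.2)
      ∂(volume.restrict Q).prod (volume.restrict Q) ≤ 1) :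
    ∫⁻ x, Q.indicator (fun x => ENNReal.ofReal (G x)) x *
      ((∫⁻ y in Metric.closedBall (x + ξ) s, Q.indicator (fun x => ENNReal.ofReal (G x)) y) /
        volume (Metric.closedBall (x + ξ) s)) ≤ ENNReal.ofReal w⁻¹ := by
  set μ := volume.restrict Q with hμ
  set v := volume.real (Metric.closedBall (0 : Eucl n) s) with hv
  have hv0 : 0 < v := volume_real_closedBall_pos hs
  set u : Eucl n → ℝ≥0∞ := fun x => ENNReal.ofReal (G x)
  have hu : Measurable u := hG.ennreal_ofReal
  have hvol : ∀ x : Eucl n, volume (Metric.closedBall x s) = ENNReal.ofReal v := by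
    intro x
    rw [hv, measureReal_def, ENNReal.ofReal_toReal measure_closedBall_lt_top.ne,
      Measure.addHaar_closedBall_center]
  have hint : Integrable (fun q : Eucl n × Eucl n => shiftKernel ξ s w q * (G q.1 * G q.2))
      (μ.prod μ) :=
    (hG2.mul_prod hG2).bdd_mul (measurable_shiftKernel ξ s w).aestronglyMeasurable
      (ae_of_all _ fun q => abs_shiftKernel_le ξ s hw.le q)
  have h1 := ofReal_integral_eq_lintegral_ofReal hint (ae_of_all _ fun q =>
    mul_nonneg (shiftKernel_nonneg ξ s hw.le q) (mul_nonneg (hG0 _) (hG0 _)))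
  rw [lintegral_prod _ hint.aestronglyMeasurable.aemeasurable.ennreal_ofReal] at h1
  have h2 : ∀ x y, ENNReal.ofReal (shiftKernel ξ s w (x, y) * (G x * G y)) =
      ENNReal.ofReal (w / v) * u x * (Metric.closedBall (x + ξ) s).indicator u y := by
    intro x y
    by_cases hy : y ∈ Metric.closedBall (x + ξ) s
    · have : shiftKernel ξ s w (x, y) = w / v := by
        rw [shiftKernel, Set.indicator_of_mem (by exact hy), mul_one]
      rw [this, Set.indicator_of_mem hy, ENNReal.ofReal_mul (by positivity),
        ENNReal.ofReal_mul (hG0 x), mul_assoc]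
    · have : shiftKernel ξ s w (x, y) = 0 := by
        rw [shiftKernel, Set.indicator_of_notMem (by exact hy), mul_zero]
      rw [this, Set.indicator_of_notMem hy]
      simp
  have h3 : ∀ x, ∫⁻ y, ENNReal.ofReal (shiftKernel ξ s w (x, y) * (G x * G y)) ∂μ =
      ENNReal.ofReal w * (u x * ((∫⁻ y in Metric.closedBall (x + ξ) s, Q.indicator u y) /
        volume (Metric.closedBall (x + ξ) s))) := by
    intro x
    simp_rw [h2]
    rw [lintegral_const_mul _ (hu.indicator Metric.isClosed_closedBall.measurableSet),
      lintegral_indicator Metric.isClosed_closedBall.measurableSet, lintegral_indicator hQ,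
      hvol, hμ, Measure.restrict_restrict hQ,
      Measure.restrict_restrict Metric.isClosed_closedBall.measurableSet, Set.inter_comm,
      ENNReal.ofReal_div_of_pos hv0, div_eq_mul_inv, div_eq_mul_inv]
    ring
  have h4 : ∫⁻ x, Q.indicator u x * ((∫⁻ y in Metric.closedBall (x + ξ) s, Q.indicator u y) /
        volume (Metric.closedBall (x + ξ) s)) =
      ∫⁻ x, u x * ((∫⁻ y in Metric.closedBall (x + ξ) s, Q.indicator u y) /
        volume (Metric.closedBall (x + ξ) s)) ∂μ := by
    rw [hμ, ← lintegral_indicator hQ]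
    refine lintegral_congr fun x => ?_
    by_cases hx : x ∈ Q <;> simp [hx]
  rw [h4]
  simp_rw [h3] at h1
  rw [lintegral_const_mul' _ _ ENNReal.ofReal_ne_top] at h1
  rw [ENNReal.ofReal_inv_of_pos hw, ← one_div, ENNReal.le_div_iff_mul_le
    (Or.inl (ENNReal.ofReal_pos.2 hw).ne') (Or.inl ENNReal.ofReal_ne_top), mul_comm, ← h1,
    ← ENNReal.ofReal_one]
  exact ENNReal.ofReal_le_ofReal h

/-- If the penalties of a function of integral `1` are at most `1` at all scales, then its support
is independent up to a null set, and hence its square integral is not small. -/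
lemma le_of_penalties {n : ℕ} {Q : Set (Eucl n)} (hQ : MeasurableSet Q)
    [IsFiniteMeasure (volume.restrict Q)] {b c : ℝ} (hc : 0 < c)
    (hb : ∀ I ⊆ Q, MeasurableSet I → (∀ x ∈ I, ∀ y ∈ I, ‖x - y‖ ≠ 1) → volume.real I ≤ b)
    {ξ : ℕ → Eucl n} (hξ : ∀ z : Eucl n, ‖z‖ = 1 → z ∈ closure (Set.range ξ))
    {s : ℕ → ℕ → ℝ} (hs : ∀ i m, 0 < s i m) (hs1 : ∀ i m, s i m ≤ 1 / ((m : ℝ) + 1))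
    {G : Eucl n → ℝ} (hG : Measurable G) (hG0 : ∀ x, 0 ≤ G x) (hG2 : MemLp G 2 (volume.restrict Q))
    (hG1 : ∫ x in Q, G x = 1) (hGc : ∫ x in Q, G x ^ 2 ≤ c⁻¹)
    (hp : ∀ i m, ∫ q, shiftKernel (ξ i) (s i m) ((m : ℝ) + 1) q * (G q.1 * G q.2)
      ∂(volume.restrict Q).prod (volume.restrict Q) ≤ 1) : c ≤ b := by
  have hGint : Integrable G (volume.restrict Q) := hG2.integrable (by norm_num)
  set u : Eucl n → ℝ≥0∞ := Q.indicator fun x => ENNReal.ofReal (G x)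
  have hu : Measurable u := hG.ennreal_ofReal.indicator hQ
  have hu1 : ∫⁻ x, u x ≠ ∞ := by
    rw [lintegral_indicator hQ]
    exact hGint.lintegral_lt_top.ne
  have hae : ∀ i, ∀ᵐ x, u x * u (x + ξ i) = 0 := by
    intro i
    have hlim1 : Tendsto (fun m : ℕ => 1 / ((m : ℝ) + 1)) atTop (𝓝 0) :=
      tendsto_one_div_add_atTop_nhds_zero_nat
    refine ae_mul_translate_eq_zero hu hu1 (ξ i) (s := s i) (hs i)
      (squeeze_zero (fun m => (hs i m).le) (hs1 i) hlim1)
      (a := fun m : ℕ => ENNReal.ofReal ((m : ℝ) + 1)⁻¹) ?_ fun m => ?_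
    · have := ENNReal.tendsto_ofReal hlim1
      simpa [one_div] using this
    · exact lintegral_translate_le_of_shiftKernel hQ hG hG0 hGint (ξ i) (hs i m) (by positivity)
        (hp i m)
  set S : Set (Eucl n) := Q ∩ {x | 0 < G x}
  have hS : MeasurableSet S := hQ.inter (measurableSet_lt measurable_const hG)
  have huS : ∀ x ∈ S, u x ≠ 0 := by
    intro x hx
    simp only [u]
    rw [Set.indicator_of_mem hx.1]
    exact (ENNReal.ofReal_pos.2 hx.2).ne'
  obtain ⟨I, hIS, hI, hIvol, hIind⟩ := exists_independent_subset hS hξ fun i => by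
    filter_upwards [hae i] with x hx h
    exact mul_ne_zero (huS _ h.1) (huS _ h.2) hx
  have hSb : volume.real S ≤ b := by
    rw [measureReal_def, ← hIvol, ← measureReal_def]
    exact hb I (hIS.trans Set.inter_subset_left) hI hIind
  have hind : MemLp (S.indicator fun _ => (1 : ℝ)) 2 (volume.restrict Q) :=
    memLp_indicator_const 2 hS 1 (Or.inr (measure_ne_top _ _))
  -- With weight c, 1 = ∫ G·1_S ≤ (c/2)·c⁻¹ + vol(S)/(2c), that is, vol(S) ≥ c.
  have h1 := integral_mul_le_of_sq hG2 hind hc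
  have h2 : ∫ x in Q, G x * S.indicator (fun _ => (1 : ℝ)) x = 1 := by
    refine Eq.trans ?_ hG1
    refine setIntegral_congr_fun hQ fun x hx => ?_
    by_cases hGx : 0 < G x
    · have : x ∈ S := ⟨hx, hGx⟩
      simp [this]
    · have : G x = 0 := le_antisymm (not_lt.1 hGx) (hG0 x)
      simp [this]
  have h3 : ∫ x in Q, S.indicator (fun _ => (1 : ℝ)) x ^ 2 = volume.real S := by
    have h4 : ∀ x, S.indicator (fun _ => (1 : ℝ)) x ^ 2 = S.indicator (fun _ => (1 : ℝ)) x := by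
      intro x
      by_cases hx : x ∈ S <;> simp [hx]
    simp_rw [h4]
    rw [integral_indicator_const _ hS, measureReal_restrict_apply hS,
      Set.inter_eq_left.2 (show S ⊆ Q from Set.inter_subset_left)]
    simp
  rw [h2, h3, abs_one] at h1
  have h5 : c / 2 * ∫ x in Q, G x ^ 2 ≤ 1 / 2 := by
    calc c / 2 * ∫ x in Q, G x ^ 2 ≤ c / 2 * c⁻¹ := by gcongr
      _ = 1 / 2 := by field_simp
  have h6 : 1 / 2 ≤ 1 / (2 * c) * volume.real S := by linarith
  have h7 : c ≤ volume.real S := by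
    have : 1 / 2 * (2 * c) ≤ 1 / (2 * c) * volume.real S * (2 * c) := by gcongr
    field_simp at this
    linarith
  exact h7.trans hSb

/-! ### The bound for functions that vanish on the unit sphere -/

/-- Contrapositive of `kernel_nonneg`: c on the diagonal plus the kernel ∑ p j - 1 pairs negatively
with f, so some g ≥ 0 satisfies c∫g² + ∑∬ p j g g < (∫g)². Every term on the left is nonnegative;
dividing g by its integral bounds each one. -/
lemma exists_test_function {n : ℕ} (Q : Set (Eucl n)) [IsFiniteMeasure (volume.restrict Q)]
    {f : Eucl n → ℝ} (hf : Continuous f) (hf1 : ∀ z, |f z| ≤ 1) (hf0 : f 0 = 1)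
    (hpos : IsPointwisePositive f) {c ε : ℝ} (hc : 0 < c)
    (hlt : c * (volume.restrict Q).real Set.univ + ε <
      ∫ q, f (q.1 - q.2) ∂(volume.restrict Q).prod (volume.restrict Q))
    {p : ℕ → Eucl n × Eucl n → ℝ}
    (hpi : ∀ j, Integrable (p j) ((volume.restrict Q).prod (volume.restrict Q)))
    (hpm : ∀ j q, 0 ≤ p j q) (M : ℕ)
    (hpf : ∑ j ∈ Finset.range M, ∫ q, p j q * f (q.1 - q.2)
      ∂(volume.restrict Q).prod (volume.restrict Q) ≤ ε) :
    ∃ h : Eucl n → ℝ, Measurable h ∧ (∀ x, 0 ≤ h x) ∧ (∃ C, ∀ x, h x ≤ C) ∧ ∫ x in Q, h x = 1 ∧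
      ∫ x in Q, h x ^ 2 ≤ c⁻¹ ∧ ∀ j < M, ∫ q, p j q * (h q.1 * h q.2)
        ∂(volume.restrict Q).prod (volume.restrict Q) ≤ 1 := by
  set μ := volume.restrict Q
  have hfi : Integrable (fun q : Eucl n × Eucl n => f (q.1 - q.2)) (μ.prod μ) :=
    Integrable.of_bound (by fun_prop) 1 (ae_of_all _ fun q => hf1 _)
  set k : Eucl n × Eucl n → ℝ := fun q => ∑ j ∈ Finset.range M, p j q - 1
  have hk : Integrable k (μ.prod μ) :=
    (integrable_finsetSum _ fun j _ => hpi j).sub (integrable_const 1)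
  have hkF : ∀ F : Eucl n × Eucl n → ℝ, Measurable F → (∃ C, ∀ q, |F q| ≤ C) →
      ∫ q, k q * F q ∂μ.prod μ =
        ∑ j ∈ Finset.range M, ∫ q, p j q * F q ∂μ.prod μ - ∫ q, F q ∂μ.prod μ := by
    rintro F hF ⟨C, hC⟩
    have h1 : ∀ j, Integrable (fun q => p j q * F q) (μ.prod μ) := fun j =>
      (hpi j).mul_bdd hF.aestronglyMeasurable (ae_of_all _ hC)
    have h2 : Integrable F (μ.prod μ) :=
      Integrable.of_bound hF.aestronglyMeasurable C (ae_of_all _ hC)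
    rw [← integral_finsetSum _ fun j _ => h1 j,
      ← integral_sub (integrable_finsetSum _ fun j _ => h1 j) h2]
    refine integral_congr_ae (ae_of_all _ fun q => ?_)
    simp only [k, sub_mul, one_mul, Finset.sum_mul]
  have hnot : ¬ ∀ g : Eucl n → ℝ, Measurable g → (∀ x, 0 ≤ g x) → (∃ C, ∀ x, g x ≤ C) →
      0 ≤ c * ∫ x, g x ^ 2 ∂μ + ∫ q, k q * (g q.1 * g q.2) ∂μ.prod μ := by
    intro hall
    have h1 := kernel_nonneg hf hf1 hpos μ c hk hall
    rw [hf0, mul_one, hkF (fun q => f (q.1 - q.2)) (by fun_prop) ⟨1, fun q => hf1 _⟩] at h1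
    linarith
  push Not at hnot
  obtain ⟨g, hgm, hg0, ⟨C, hC⟩, hneg⟩ := hnot
  have hgabs : ∀ x, |g x| ≤ C := fun x => (abs_of_nonneg (hg0 x)).trans_le (hC x)
  rw [hkF (fun q => g q.1 * g q.2) (by fun_prop) ⟨C * C, fun q => by
    rw [abs_mul]
    exact mul_le_mul (hgabs _) (hgabs _) (abs_nonneg _) ((abs_nonneg _).trans (hgabs q.1))⟩,
    integral_prod_mul] at hneg
  set I := ∫ x, g x ∂μ with hI
  have hP : ∀ j, 0 ≤ ∫ q, p j q * (g q.1 * g q.2) ∂μ.prod μ := fun j =>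
    integral_nonneg fun q => mul_nonneg (hpm j q) (mul_nonneg (hg0 _) (hg0 _))
  have hsum : ∀ j < M, ∫ q, p j q * (g q.1 * g q.2) ∂μ.prod μ ≤
      ∑ j ∈ Finset.range M, ∫ q, p j q * (g q.1 * g q.2) ∂μ.prod μ := fun j hj =>
    Finset.single_le_sum (f := fun j => ∫ q, p j q * (g q.1 * g q.2) ∂μ.prod μ)
      (fun j _ => hP j) (Finset.mem_range.2 hj)
  have hsum0 : 0 ≤ ∑ j ∈ Finset.range M, ∫ q, p j q * (g q.1 * g q.2) ∂μ.prod μ :=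
    Finset.sum_nonneg fun j _ => hP j
  have hsq : 0 ≤ ∫ x, g x ^ 2 ∂μ := integral_nonneg fun x => sq_nonneg _
  have hI0 : 0 ≤ I := integral_nonneg hg0
  have hII : 0 < I * I := by
    have := mul_nonneg hc.le hsq
    linarith
  have hIpos : 0 < I := by
    rcases hI0.lt_or_eq with h | h
    · exact h
    · rw [← h] at hII; simp at hII
  refine ⟨fun x => I⁻¹ * g x, hgm.const_mul _, fun x => mul_nonneg (inv_nonneg.2 hI0) (hg0 x),
    ⟨I⁻¹ * C, fun x => mul_le_mul_of_nonneg_left (hC x) (inv_nonneg.2 hI0)⟩, ?_, ?_,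
    fun j hj => ?_⟩
  · rw [integral_const_mul, ← hI, inv_mul_cancel₀ hIpos.ne']
  · have h1 : ∫ x, (I⁻¹ * g x) ^ 2 ∂μ = (I * I)⁻¹ * ∫ x, g x ^ 2 ∂μ := by
      rw [← integral_const_mul]
      refine integral_congr_ae (ae_of_all _ fun x => ?_)
      simp only [mul_pow, mul_inv]; ring
    rw [h1, inv_mul_le_iff₀ hII, ← div_eq_mul_inv, le_div_iff₀ hc]
    linarith
  · have h1 : ∫ q, p j q * (I⁻¹ * g q.1 * (I⁻¹ * g q.2)) ∂μ.prod μ =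
        (I * I)⁻¹ * ∫ q, p j q * (g q.1 * g q.2) ∂μ.prod μ := by
      rw [← integral_const_mul]
      refine integral_congr_ae (ae_of_all _ fun q => ?_)
      simp only [mul_inv]; ring
    rw [h1, inv_mul_le_iff₀ hII, mul_one]
    have := hsum j hj
    have := mul_nonneg hc.le hsq
    linarith

lemma exists_dense_sphere {n : ℕ} (hn : 1 ≤ n) :
    ∃ ξ : ℕ → Eucl n, (∀ i, ‖ξ i‖ = 1) ∧ ∀ z : Eucl n, ‖z‖ = 1 → z ∈ closure (Set.range ξ) := by
  have : NeZero n := ⟨by omega⟩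
  have : Nonempty (Metric.sphere (0 : Eucl n) 1) :=
    ⟨⟨EuclideanSpace.single 0 1, by simp⟩⟩
  refine ⟨fun i => (TopologicalSpace.denseSeq (Metric.sphere (0 : Eucl n) 1) i : Eucl n),
    fun i => by simp, fun z hz => ?_⟩
  have h1 := (TopologicalSpace.denseRange_denseSeq (Metric.sphere (0 : Eucl n) 1))
    ⟨z, by simpa using hz⟩
  have h2 := image_closure_subset_closure_image continuous_subtype_val
    (Set.mem_image_of_mem ((↑) : Metric.sphere (0 : Eucl n) 1 → Eucl n) h1)
  rwa [← Set.range_comp] at h2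

lemma integral_le_of_independent {n : ℕ} (hn : 1 ≤ n) {Q : Set (Eucl n)} (hQ : MeasurableSet Q)
    [IsFiniteMeasure (volume.restrict Q)] {f : Eucl n → ℝ} (hf : Continuous f)
    (hf1 : ∀ z, |f z| ≤ 1) (hf2 : ∀ z, f (-z) = f z) (hf0 : f 0 = 1)
    (hfs : ∀ z, ‖z‖ = 1 → f z = 0) (hpos : IsPointwisePositive f) {b : ℝ}
    (hb : ∀ I ⊆ Q, MeasurableSet I → (∀ x ∈ I, ∀ y ∈ I, ‖x - y‖ ≠ 1) → volume.real I ≤ b) :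
    ∫ q, f (q.1 - q.2) ∂(volume.restrict Q).prod (volume.restrict Q) ≤
      b * (volume.restrict Q).real Set.univ := by
  set μ := volume.restrict Q with hμ
  set V := μ.real Set.univ
  have hV : 0 ≤ V := measureReal_nonneg
  have hb0 : 0 ≤ b := by
    have := hb ∅ (Set.empty_subset _) MeasurableSet.empty (by simp)
    simpa using this
  set J := ∫ q, f (q.1 - q.2) ∂μ.prod μ
  by_contra! hJ
  set D := J - b * V with hD
  have hD0 : 0 < D := by linarith
  -- Strictly above b, yet the excess costs at most D/2 after multiplication by V; with ε = D/4 this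
  -- leaves cV + ε < J.
  set c := b + D / (2 * (V + 1)) with hc
  have hcb : b < c := by
    have : 0 < D / (2 * (V + 1)) := by positivity
    linarith
  have hc0 : 0 < c := hb0.trans_lt hcb
  set ε := D / 4 with hε
  have hε0 : 0 < ε := by positivity
  have hlt : c * V + ε < J := by
    have h1 : D / (2 * (V + 1)) * V ≤ D / 2 := by
      rw [div_mul_eq_mul_div, div_le_div_iff₀ (by positivity) two_pos]
      nlinarith
    rw [hc, add_mul]
    linarith
  obtain ⟨ξ, hξ1, hξ⟩ := exists_dense_sphere hn
  -- The denominator absorbs the weight m + 1 and the volume, and the power of 1/2 indexed by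
  -- `Nat.pair i m` makes all penalties together contribute at most ε.
  set η : ℕ → ℕ → ℝ := fun i m =>
    ε * (1 / 2) ^ (Nat.pair i m + 1) / (((m : ℝ) + 1) * (V + 1)) with hη
  have hη0 : ∀ i m, 0 < η i m := fun i m => by positivity
  have hsex : ∀ i m : ℕ, ∃ s : ℝ, 0 < s ∧ s ≤ 1 / ((m : ℝ) + 1) ∧
      ∀ z ∈ Metric.closedBall (ξ i) s, |f z| ≤ η i m := by
    intro i m
    obtain ⟨r, hr, hr'⟩ := Metric.continuousAt_iff.1 (hf.continuousAt (x := ξ i)) _ (hη0 i m)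
    refine ⟨min (r / 2) (1 / ((m : ℝ) + 1)), by positivity, min_le_right _ _, fun z hz => ?_⟩
    have h1 : dist z (ξ i) < r :=
      ((Metric.mem_closedBall.1 hz).trans (min_le_left _ _)).trans_lt (half_lt_self hr)
    have h2 := hr' h1
    rw [hfs _ (hξ1 i), Real.dist_0_eq_abs] at h2
    exact h2.le
  choose s hs0 hs1 hsη using hsex
  set p : ℕ → Eucl n × Eucl n → ℝ := fun j =>
    shiftKernel (ξ (Nat.unpair j).1) (s (Nat.unpair j).1 (Nat.unpair j).2)
      (((Nat.unpair j).2 : ℝ) + 1) with hp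
  have hpi : ∀ j, Integrable (p j) (μ.prod μ) := fun j =>
    integrable_shiftKernel μ _ _ (by positivity)
  have hpf : ∀ j, ∫ q, p j q * f (q.1 - q.2) ∂μ.prod μ ≤ ε * (1 / 2) ^ (j + 1) := by
    intro j
    set i := (Nat.unpair j).1
    set m := (Nat.unpair j).2
    refine (integral_shiftKernel_mul_le Q hf hf1 hf2 (hs0 i m) (by positivity) (hη0 i m).le
      (hsη i m)).trans ?_
    have hj : Nat.pair i m = j := Nat.pair_unpair j
    rw [hη]
    simp only [hj]
    change _ * (_ * V) ≤ _
    rw [div_mul_eq_mul_div, div_le_iff₀ (by positivity)]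
    gcongr
    linarith
  have hsum : ∀ M, ∑ j ∈ Finset.range M, ∫ q, p j q * f (q.1 - q.2) ∂μ.prod μ ≤ ε := by
    intro M
    refine (Finset.sum_le_sum fun j _ => hpf j).trans ?_
    have h1 := sum_geometric_two_le M
    have h2 : ∑ j ∈ Finset.range M, ε * (1 / 2 : ℝ) ^ (j + 1) =
        ε / 2 * ∑ j ∈ Finset.range M, (1 / 2 : ℝ) ^ j := by
      rw [Finset.mul_sum]
      refine Finset.sum_congr rfl fun j _ => ?_
      ring
    rw [h2]
    nlinarith
  choose h hhm hh0 hhC hh1 hhc hhp using fun M => exists_test_function Q hf hf1 hf0 hpos hc0 hlt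
    hpi (fun j => shiftKernel_nonneg _ _ (by positivity)) M (hsum M)
  have hhL : ∀ M, MemLp (h M) 2 μ := fun M => by
    obtain ⟨C, hC⟩ := hhC M
    exact memLp_two_of_bounded (hhm M) fun x => (abs_of_nonneg (hh0 M x)).trans_le (hC x)
  have : Fact ((2 : ℝ≥0∞) ≠ ∞) := ⟨by norm_num⟩
  obtain ⟨G, φ, hφ, hGm, hG0, hGL, hGc, hlim⟩ := exists_weak_limit hhL hh0 hhc
  have hG1 : ∫ x, G x ∂μ = 1 := by
    have h1 := hlim (fun _ => 1) (memLp_const 1)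
    simp only [mul_one] at h1
    exact tendsto_nhds_unique h1 (tendsto_const_nhds.congr fun k => (hh1 (φ k)).symm)
  have hGp : ∀ i m : ℕ, ∫ q, shiftKernel (ξ i) (s i m) ((m : ℝ) + 1) q * (G q.1 * G q.2)
      ∂μ.prod μ ≤ 1 := by
    intro i m
    have h1 := tendsto_kernel_of_weak (fun k => hhm (φ k)) (fun k => hhL (φ k))
      (fun k => hhc (φ k)) hGm hGL hlim (measurable_shiftKernel (ξ i) (s i m) ((m : ℝ) + 1))
      (abs_shiftKernel_le (ξ i) (s i m) (by positivity))
    refine le_of_tendsto h1 ?_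
    filter_upwards [eventually_gt_atTop (Nat.pair i m)] with k hk
    -- Each fixed penalty is imposed on all but finitely many test functions, so it survives in the
    -- weak limit.
    have h2 := hhp (φ k) (Nat.pair i m) (hk.trans_le hφ.le_apply)
    simpa only [hp, Nat.unpair_pair] using h2
  exact absurd (le_of_penalties hQ hc0 hb hξ hs0 hs1 hGm hG0 hGL hG1 hGc hGp) (not_le.2 hcb)

/-! ### The independence density is an upper bound -/

lemma measurableSet_cube {n : ℕ} (p : Eucl n) (T : ℝ) : MeasurableSet (cube p T) := by
  have h : cube p T = ⋂ i, {x : Eucl n | |x i - p i| ≤ T} := by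
    ext x; simp [cube]
  rw [h]
  exact MeasurableSet.iInter fun i => measurableSet_le (by fun_prop) measurable_const

/-- For each direction, the addition formula writes the double integral of the cosine as a sum of
two squares. -/
lemma integral_omega_mul_norm_nonneg {n : ℕ} (hn : 1 ≤ n) (μ : Measure (Eucl n))
    [IsFiniteMeasure μ] (t : ℝ≥0) :
    0 ≤ ∫ q, Omega n (t * ‖q.1 - q.2‖) ∂μ.prod μ := by
  have h1 : ∀ q : Eucl n × Eucl n, Omega n (t * ‖q.1 - q.2‖) =
      ∫ ξ, Real.cos ⟪(t : ℝ) • (q.1 - q.2), ξ⟫ ∂sphereUnif n := fun q => by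
    rw [← omega_norm hn, norm_smul, NNReal.norm_eq]
  simp_rw [h1]
  rw [integral_integral_swap (Integrable.of_bound (by fun_prop) 1
    (ae_of_all _ fun q => Real.abs_cos_le_one _))]
  refine integral_nonneg fun ξ => ?_
  have h2 : ∀ q : Eucl n × Eucl n, Real.cos ⟪(t : ℝ) • (q.1 - q.2), ξ⟫ =
      Real.cos ⟪(t : ℝ) • q.1, ξ⟫ * Real.cos ⟪(t : ℝ) • q.2, ξ⟫ +
        Real.sin ⟪(t : ℝ) • q.1, ξ⟫ * Real.sin ⟪(t : ℝ) • q.2, ξ⟫ := fun q => by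
    rw [smul_sub, inner_sub_left, Real.cos_sub]
  simp_rw [h2]
  have hc : Integrable (fun x : Eucl n => Real.cos ⟪(t : ℝ) • x, ξ⟫) μ :=
    Integrable.of_bound (by fun_prop) 1 (ae_of_all _ fun x => Real.abs_cos_le_one _)
  have hs : Integrable (fun x : Eucl n => Real.sin ⟪(t : ℝ) • x, ξ⟫) μ :=
    Integrable.of_bound (by fun_prop) 1 (ae_of_all _ fun x => Real.abs_sin_le_one _)
  rw [integral_add (hc.mul_prod hc) (hs.mul_prod hs),
    integral_prod_mul (fun x : Eucl n => Real.cos ⟪(t : ℝ) • x, ξ⟫)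
      (fun x : Eucl n => Real.cos ⟪(t : ℝ) • x, ξ⟫),
    integral_prod_mul (fun x : Eucl n => Real.sin ⟪(t : ℝ) • x, ξ⟫)
      (fun x : Eucl n => Real.sin ⟪(t : ℝ) • x, ξ⟫)]
  exact add_nonneg (mul_self_nonneg _) (mul_self_nonneg _)

/-- After Fubini every t contributes a nonnegative amount, and t = 0 contributes μ(univ)² because
Ω_n(0) = 1. -/
lemma mass_zero_le_integral_radialTransform {n : ℕ} (hn : 1 ≤ n) (α : Measure ℝ≥0)
    [IsFiniteMeasure α] (μ : Measure (Eucl n)) [IsFiniteMeasure μ] :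
    α.real {0} * (μ.real Set.univ * μ.real Set.univ) ≤
      ∫ q, radialTransform n α (q.1 - q.2) ∂μ.prod μ := by
  have hi := integrable_omega_mul_norm_prod hn α (μ.prod μ)
  have h1 : ∫ q, radialTransform n α (q.1 - q.2) ∂μ.prod μ =
      ∫ t : ℝ≥0, ∫ q, Omega n (t * ‖q.1 - q.2‖) ∂μ.prod μ ∂α :=
    (integral_integral_swap hi).symm
  have h2 : ∫ t in ({0} : Set ℝ≥0), ∫ q, Omega n (t * ‖q.1 - q.2‖) ∂μ.prod μ ∂α =
      α.real {0} * (μ.real Set.univ * μ.real Set.univ) := by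
    rw [integral_singleton]
    simp [omega_zero hn, ← Set.univ_prod_univ, measureReal_prod_prod]
  rw [h1, ← h2]
  exact setIntegral_le_integral hi.integral_prod_left
    (ae_of_all _ fun t => integral_omega_mul_norm_nonneg hn μ t)

/-- The vector `c v`, for an integer vector `v`. -/
noncomputable def latticePoint {n : ℕ} (c : ℝ) (v : Fin n → ℤ) : Eucl n :=
  WithLp.toLp 2 fun i => c * v i

lemma one_lt_abs_sub_of_ne {T a b : ℝ} {v w : ℤ} (hvw : v ≠ w)
    (ha : |a - 2 * (T + 1) * v| ≤ T) (hb : |b - 2 * (T + 1) * w| ≤ T) : 1 < |a - b| := by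
  have hT : 0 ≤ T := (abs_nonneg _).trans ha
  rw [abs_le] at ha hb
  rcases lt_or_gt_of_ne hvw with h | h
  · have h1 : (v : ℝ) + 1 ≤ w := by exact_mod_cast h
    rw [lt_abs]; right
    nlinarith
  · have h1 : (w : ℝ) + 1 ≤ v := by exact_mod_cast h
    rw [lt_abs]; left
    nlinarith

/-- The copies of a bounded independent set along a coarse lattice form an independent set whose
density is the volume of the set divided by the volume of the fundamental cell. -/
lemma volume_div_le_independenceDensity {n : ℕ} {T : ℝ} (hT : 0 < T) {I : Set (Eucl n)}
    (hIT : I ⊆ cube 0 T) (hI : MeasurableSet I) (hI1 : ∀ x ∈ I, ∀ y ∈ I, ‖x - y‖ ≠ 1) :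
    volume I / volume (cube (0 : Eucl n) (T + 1)) ≤
      independenceDensity (distanceGraph n {1}) := by
  set c := 2 * (T + 1) with hc
  have hc0 : 0 < c := by positivity
  set S : (Fin n → ℤ) → Set (Eucl n) := fun v => (fun x => x - latticePoint c v) ⁻¹' I
  have hSm : ∀ v, MeasurableSet (S v) := fun v => (measurable_sub_const _) hI
  have hSc : ∀ v, ∀ x ∈ S v, ∀ i, |x i - c * v i| ≤ T := fun v x hx i => by
    have h := hIT hx i
    simpa [latticePoint] using h
  have hfar : ∀ v w, v ≠ w → ∀ x ∈ S v, ∀ y ∈ S w, 1 < ‖x - y‖ := by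
    intro v w hvw x hx y hy
    obtain ⟨i, hi⟩ := Function.ne_iff.1 hvw
    have h1 := one_lt_abs_sub_of_ne hi (hSc v x hx i) (hSc w y hy i)
    exact h1.trans_le (by simpa using PiLp.norm_apply_le (x - y) i)
  have hdisj : Pairwise (Function.onFun Disjoint S) := by
    intro v w hvw
    rw [Function.onFun, Set.disjoint_left]
    intro x hx hy
    have := hfar v w hvw x hx x hy
    simp at this
    linarith
  have hSvol : ∀ v, volume (S v) = volume I := fun v => by
    simp only [S, sub_eq_add_neg]
    exact measure_preimage_add_right _ _ _
  set X := ⋃ v, S v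
  have hX : (distanceGraph n {1}).IsIndepSet X := by
    intro x hx y hy _ hadj
    obtain ⟨v, hv⟩ := Set.mem_iUnion.1 hx
    obtain ⟨w, hw⟩ := Set.mem_iUnion.1 hy
    have h1 : ‖x - y‖ = 1 := hadj.2
    by_cases hvw : v = w
    · subst hvw
      refine hI1 _ hv _ hw ?_
      simpa using h1
    · exact (hfar v w hvw x hv y hw).ne' h1
  refine le_trans ?_ (le_iSup (fun J : {J : Set (Eucl n) // NullMeasurableSet J volume ∧
    (distanceGraph n {1}).IsIndepSet J} => upperDensity J.1)
    ⟨X, (MeasurableSet.iUnion hSm).nullMeasurableSet, hX⟩)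
  refine le_trans ?_ (le_iSup (fun p : Eucl n => limsup (fun T : ℝ =>
    volume (X ∩ cube p T) / volume (cube (0 : Eucl n) T)) atTop) 0)
  -- A limsup needs only arbitrarily large cubes: those of half-side c m + (T + 1) have exactly the
  -- volume of (2m + 1)ⁿ cells and contain that many complete copies.
  refine le_limsup_of_frequently_le' ?_
  rw [frequently_atTop]
  intro A
  obtain ⟨m, hm⟩ := exists_nat_ge (A / c)
  have hm' : A ≤ c * m := by
    rw [div_le_iff₀ hc0] at hm; linarith
  refine ⟨c * m + (T + 1), by linarith, ?_⟩
  set F : Finset (Fin n → ℤ) := Fintype.piFinset fun _ => Finset.Icc (-(m : ℤ)) m with hF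
  have hFc : F.card = (2 * m + 1) ^ n := by
    simp only [hF, Fintype.card_piFinset, Int.card_Icc, Finset.prod_const, Finset.card_univ,
      Fintype.card_fin]
    congr 1
    omega
  have h1 : (F.card : ℝ≥0∞) * volume I ≤
      volume (X ∩ cube (0 : Eucl n) (c * m + (T + 1))) := by
    have h2 : volume (⋃ v ∈ F, S v) = F.card * volume I := by
      rw [measure_biUnion_finset (fun v _ w _ hvw => hdisj hvw) fun v _ => hSm v]
      simp [hSvol]
    rw [← h2]
    refine measure_mono (Set.iUnion₂_subset fun v hv => Set.subset_inter
      (Set.subset_iUnion _ v) fun x hx i => ?_)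
    have h3 := hSc v x hx i
    have h4 := Fintype.mem_piFinset.1 hv i
    rw [Finset.mem_Icc] at h4
    have h5 : -(m : ℝ) ≤ v i := by exact_mod_cast h4.1
    have h6 : (v i : ℝ) ≤ m := by exact_mod_cast h4.2
    rw [abs_le] at h3 ⊢
    simp only [PiLp.zero_apply, sub_zero]
    constructor <;> nlinarith
  have h7 : volume (cube (0 : Eucl n) (c * m + (T + 1))) =
      F.card * volume (cube (0 : Eucl n) (T + 1)) := by
    rw [volume_cube, volume_cube, hFc]
    push_cast
    rw [← mul_pow]
    congr 1
    have h8 : (2 * (m : ℝ≥0∞) + 1) = ENNReal.ofReal (2 * m + 1) := by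
      rw [ENNReal.ofReal_add (by positivity) zero_le_one, ENNReal.ofReal_mul zero_le_two]
      simp
    rw [h8, ← ENNReal.ofReal_mul (by positivity)]
    congr 1
    rw [hc]; ring
  have hF0 : (F.card : ℝ≥0∞) ≠ 0 := by
    rw [hFc]; positivity
  calc volume I / volume (cube (0 : Eucl n) (T + 1))
      = F.card * volume I / (F.card * volume (cube (0 : Eucl n) (T + 1))) :=
        (ENNReal.mul_div_mul_left _ _ hF0 (ENNReal.natCast_ne_top _)).symm
    _ ≤ _ := by
        rw [h7]
        gcongr

/-- On a cube Q of volume V, α({0})V² ≤ ∬ f ≤ bV with b the independence density times the volume of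
the cube enlarged by 1. Hence α({0}) is at most the density times a volume ratio that tends to 1. -/
lemma optimalValue_le_independenceDensity {n : ℕ} (hn : 1 ≤ n)
    {T : (U : Finset (Eucl n)) → Set (Matrix U U ℝ)} (hT : IsCountableDenseChoice T) :
    optimalValue n (thickFunctions T) ≤ independenceDensity (distanceGraph n {1}) := by
  refine iSup_le fun ⟨α, hα⟩ => ?_
  have : NeZero n := ⟨by omega⟩
  have : IsProbabilityMeasure α := ⟨hα.total_mass⟩
  set β := independenceDensity (distanceGraph n {1})
  by_cases hβ : β = ∞
  · rw [hβ]; exact le_top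
  set f := radialTransform n α
  have hf0 : f 0 = 1 := (radialTransform_zero hn α).trans (by simp)
  have hfs : ∀ z : Eucl n, ‖z‖ = 1 → f z = 0 := fun z hz => by
    simpa [f, radialTransform, hz] using hα.forbidden_distance
  have hlim : Tendsto (fun t : ℝ => β *
      (volume (cube (0 : Eucl n) (t + 1)) / volume (cube (0 : Eucl n) t))) atTop (𝓝 β) := by
    simpa using ENNReal.Tendsto.const_mul (tendsto_volume_cube_ratio n) (Or.inr hβ)
  refine ge_of_tendsto hlim ?_
  filter_upwards [eventually_gt_atTop 0] with t ht
  have hfin : ∀ s : ℝ, volume (cube (0 : Eucl n) s) ≠ ∞ := fun s => by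
    rw [volume_cube]; exact ENNReal.pow_ne_top ENNReal.ofReal_ne_top
  have hpos : ∀ s : ℝ, 0 < s → volume (cube (0 : Eucl n) s) ≠ 0 := fun s hs => by
    rw [volume_cube]; positivity
  set Q := cube (0 : Eucl n) t
  have : IsFiniteMeasure (volume.restrict Q) := isFiniteMeasure_restrict.2 (hfin t)
  have h1 := integral_le_of_independent hn (measurableSet_cube 0 t)
    (continuous_radialTransform hn α) (abs_radialTransform_le hn α) (radialTransform_neg α)
    hf0 hfs (isPointwisePositive_radialTransform hn hT hα)
    (b := (β * volume (cube (0 : Eucl n) (t + 1))).toReal) fun I hIQ hI hI1 =>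
      ENNReal.toReal_mono (ENNReal.mul_ne_top hβ (hfin _)) ((ENNReal.div_le_iff
        (hpos _ (by linarith)) (hfin _)).1 (volume_div_le_independenceDensity ht hIQ hI hI1))
  have h2 := (mass_zero_le_integral_radialTransform hn α (volume.restrict Q)).trans h1
  have hV : (volume.restrict Q).real Set.univ = (volume Q).toReal := by
    simp [measureReal_def]
  rw [hV, ← mul_assoc] at h2
  have hV0 : 0 < (volume Q).toReal := ENNReal.toReal_pos (hpos t ht) (hfin t)
  have h3 := le_of_mul_le_mul_right h2 hV0
  rw [measureReal_def, ← ENNReal.toReal_mul, ENNReal.toReal_le_toReal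
    (ENNReal.mul_ne_top (measure_ne_top _ _) (hfin t)) (ENNReal.mul_ne_top hβ (hfin _))] at h3
  rw [← mul_div_assoc]
  exact (ENNReal.le_div_iff_mul_le (Or.inl (hpos t ht)) (Or.inl (hfin t))).2 h3

end ThickLP

theorem mainTheorem7 (n : ℕ) (hn : 2 ≤ n) :
    (∃ r : ℕ → ℝ≥0 → ℝ, ThickLP.IsThickEnumeration n r) ∧
    ∀ r : ℕ → ℝ≥0 → ℝ, ThickLP.IsThickEnumeration n r →
      Tendsto (fun N : ℕ => ThickLP.thetaN n r N) atTop (𝓝 (ThickLP.thetaInfty n r)) ∧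
      ThickLP.thetaInfty n r =
        ThickLP.independenceDensity (ThickLP.distanceGraph n {1}) := by
  have hn1 : 1 ≤ n := by omega
  refine ⟨ThickLP.exists_isThickEnumeration n, fun r ⟨T, hT, hr⟩ => ⟨?_, ?_⟩⟩
  · have hk : ∀ k, Continuous (r k) ∧ Tendsto (r k) atTop (𝓝 0) := fun k => by
      have h : r k ∈ ThickLP.thickFunctions T := hr ▸ Set.mem_range_self k
      obtain ⟨U, _, _, Z, _, j, _, h⟩ := h
      rw [h]
      exact ⟨ThickLP.continuous_thickFunction hn1 U Z _, ThickLP.tendsto_thickFunction hn U Z _⟩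
    exact ThickLP.tendsto_optimalValue hn r (fun k => (hk k).1) fun k => (hk k).2
  · rw [ThickLP.thetaInfty, hr]
    exact le_antisymm (ThickLP.optimalValue_le_independenceDensity hn1 hT)
      (ThickLP.independenceDensity_le_optimalValue hn1 hT)
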